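/- Let $n\ge 3$ and let $F\colon\mathbb R^n\to\mathbb R$ be a Minkowski norm: $F$ is continuous on $\mathbb R^n$, smooth on $\mathbb R^n\setminus\{0\}$, convex, even, positively $1$-homogeneous, positive on $\mathbb R^n\setminus\{0\}$, and $\mathrm{Hess}(F^2)$ is positive definite on $\mathbb R^n\setminus\{0\}$. Let $F^0(x)=\sup_{\xi\ne 0}\langle \xi,x\rangle/F(\xi)$ be its dual norm, let $\mathcal W=\{x\in\mathbb R^n: F^0(x)<1\}$ be the Wulff ball, and let $\partial\mathcal W$ be the Wulff shape. For an oriented smooth hypersurface $M\subset\mathbb R^n$ with unit normal $\nu$ and area element $d\mu$, let $d\mu_F=F(\nu)\,d\mu$ be the anisotropic area element, $|M|_F=\int_M F(\nu)\,d\mu$ the anisotropic area, $\nu_F=DF(\nu)$ the anisotropic Gauss map, and $H_F=\mathrm{tr}(d\nu_F\colon T_xM\to T_xM)$ the anisotropic mean curvature (here $T_{\nu_F(x)}\partial\mathcal W$ is identified with the parallel hyperplane $T_xM$). Let $M$ be a nonempty embedded smooth compact oriented hypersurface without boundary in $\mathbb R^n$ (not necessarily connected). Then $$\int_M |H_F|^{n-1}\,d\mu_F\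 \ge\ (n-1)^{n-1}\,|\partial\mathcal W|_F ,$$ and equality holds if and only if $M$ is a translated scaled Wulff shape, i.e. $M=x_0+r\,\partial\mathcal W$ for some $x_0\in\mathbb R^n$ and $r>0$. -/

import Mathlib

open MeasureTheory Set
open scoped ContDiff RealInnerProductSpace

noncomputable section

namespace AnisoWillmore

/-- A Minkowski norm on `ℝⁿ`: continuous, smooth away from the origin, convex, even, positively
`1`-homogeneous, positive away from the origin, and with `Hess (F ^ 2)` positive definite away from
the origin. -/
structure IsMinkowskiNorm {n : ℕ} (F : EuclideanSpace ℝ (Fin n) → ℝ) : Prop where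
  continuous : Continuous F
  contDiffOn : ContDiffOn ℝ ∞ F {0}ᶜ
  convexOn : ConvexOn ℝ univ F
  even : ∀ ξ, F (-ξ) = F ξ
  homogeneous : ∀ (t : ℝ) (ξ : EuclideanSpace ℝ (Fin n)), 0 < t → F (t • ξ) = t * F ξ
  pos : ∀ ξ, ξ ≠ 0 → 0 < F ξ
  hess_pos : ∀ ξ, ξ ≠ 0 → ∀ v : EuclideanSpace ℝ (Fin n), v ≠ 0 →
    0 < iteratedFDeriv ℝ 2 (fun η => F η ^ 2) ξ ![v, v]

/-- The dual norm `F⁰ x = sup_{ξ ≠ 0} ⟨ξ, x⟩ / F ξ`. -/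
def dualNorm {n : ℕ} (F : EuclideanSpace ℝ (Fin n) → ℝ) (x : EuclideanSpace ℝ (Fin n)) : ℝ :=
  ⨆ ξ : {ξ : EuclideanSpace ℝ (Fin n) // ξ ≠ 0}, ⟪(ξ : EuclideanSpace ℝ (Fin n)), x⟫ / F ξ

/-- The Wulff ball `{F⁰ < 1}`. -/
def wulffBall {n : ℕ} (F : EuclideanSpace ℝ (Fin n) → ℝ) : Set (EuclideanSpace ℝ (Fin n)) :=
  {x | dualNorm F x < 1}

/-- The Wulff shape, the boundary of the Wulff ball. -/
def wulffShape {n : ℕ} (F : EuclideanSpace ℝ (Fin n) → ℝ) : Set (EuclideanSpace ℝ (Fin n)) :=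
  frontier (wulffBall F)

/-- The outer unit normal of the Wulff shape, which is the level set `{F⁰ = 1}`. -/
def wulffNormal {n : ℕ} (F : EuclideanSpace ℝ (Fin n) → ℝ) (x : EuclideanSpace ℝ (Fin n)) :
    EuclideanSpace ℝ (Fin n) :=
  ‖gradient (dualNorm F) x‖⁻¹ • gradient (dualNorm F) x

/-- `M` is an embedded smooth hypersurface without boundary: near each of its points it is the zero
set of a smooth function with nowhere vanishing differential. -/
def IsSmoothHypersurface {n : ℕ} (M : Set (EuclideanSpace ℝ (Fin n))) : Prop :=
  ∀ p ∈ M, ∃ (U : Set (EuclideanSpace ℝ (Fin n))) (f : EuclideanSpace ℝ (Fin n) → ℝ),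
    IsOpen U ∧ p ∈ U ∧ ContDiffOn ℝ ∞ f U ∧ (∀ x ∈ U, fderiv ℝ f x ≠ 0) ∧
      M ∩ U = {x ∈ U | f x = 0}

/-- The tangent space `T_x M`, spanned by the tangent directions to `M` at `x`. -/
def tangentSpace {n : ℕ} (M : Set (EuclideanSpace ℝ (Fin n))) (x : EuclideanSpace ℝ (Fin n)) :
    Submodule ℝ (EuclideanSpace ℝ (Fin n)) :=
  Submodule.span ℝ (tangentConeAt ℝ M x)

/-- `ν` is an orientation of `M`: a continuous unit normal field along `M` (the values of `ν` off
`M` play no role). On a smooth hypersurface such a field is automatically smooth. -/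
structure IsUnitNormal {n : ℕ} (M : Set (EuclideanSpace ℝ (Fin n)))
    (ν : EuclideanSpace ℝ (Fin n) → EuclideanSpace ℝ (Fin n)) : Prop where
  continuousOn : ContinuousOn ν M
  norm_eq_one : ∀ x ∈ M, ‖ν x‖ = 1
  inner_eq_zero : ∀ x ∈ M, ∀ v ∈ tangentSpace M x, ⟪ν x, v⟫ = 0

/-- The anisotropic Gauss map `ν_F = DF(ν)`. -/
def anisoNormal {n : ℕ} (F : EuclideanSpace ℝ (Fin n) → ℝ)
    (ν : EuclideanSpace ℝ (Fin n) → EuclideanSpace ℝ (Fin n)) (x : EuclideanSpace ℝ (Fin n)) :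
    EuclideanSpace ℝ (Fin n) :=
  gradient F (ν x)

/-- The differential along `M` of a map differentiable within `M` does not depend on the
derivative that `fderivWithin` selects: all of them agree on `T_x M`. -/
theorem fderivWithin_eq_on_tangentSpace {n : ℕ} {M : Set (EuclideanSpace ℝ (Fin n))}
    {φ : EuclideanSpace ℝ (Fin n) → EuclideanSpace ℝ (Fin n)} {x : EuclideanSpace ℝ (Fin n)}
    {L : EuclideanSpace ℝ (Fin n) →L[ℝ] EuclideanSpace ℝ (Fin n)}
    (h : HasFDerivWithinAt φ L M x) {v : EuclideanSpace ℝ (Fin n)} (hv : v ∈ tangentSpace M x) :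
    fderivWithin ℝ φ M x v = L v := by
  have key := h.differentiableWithinAt.hasFDerivWithinAt.unique_on h
  exact LinearMap.eqOn_span (f := (fderivWithin ℝ φ M x).toLinearMap) (g := L.toLinearMap) key hv

/-- The anisotropic Weingarten map `dν_F : T_x M → T_{ν_F(x)} ∂W = T_x M`, the differential of the
anisotropic Gauss map along `M`. Its values lie in `T_x M`; the orthogonal projection onto `T_x M`
only serves to give the map this codomain. -/
def weingarten {n : ℕ} (F : EuclideanSpace ℝ (Fin n) → ℝ) (M : Set (EuclideanSpace ℝ (Fin n)))
    (ν : EuclideanSpace ℝ (Fin n) → EuclideanSpace ℝ (Fin n)) (x : EuclideanSpace ℝ (Fin n)) :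
    tangentSpace M x →ₗ[ℝ] tangentSpace M x :=
  (tangentSpace M x).orthogonalProjectionOnto.toLinearMap ∘ₗ
    (fderivWithin ℝ (anisoNormal F ν) M x).toLinearMap ∘ₗ (tangentSpace M x).subtype

/-- The anisotropic mean curvature `H_F = tr (dν_F)`. -/
def meanCurvature {n : ℕ} (F : EuclideanSpace ℝ (Fin n) → ℝ) (M : Set (EuclideanSpace ℝ (Fin n)))
    (ν : EuclideanSpace ℝ (Fin n) → EuclideanSpace ℝ (Fin n)) (x : EuclideanSpace ℝ (Fin n)) : ℝ :=
  LinearMap.trace ℝ (tangentSpace M x) (weingarten F M ν x)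

/-- The integral `∫_M g dμ_F`, where `dμ_F = F(ν) dμ` is the anisotropic area element and `μ` is
the area, i.e. the normalized `(n - 1)`-dimensional Hausdorff measure. -/
def anisoIntegral {n : ℕ} (F : EuclideanSpace ℝ (Fin n) → ℝ) (M : Set (EuclideanSpace ℝ (Fin n)))
    (ν : EuclideanSpace ℝ (Fin n) → EuclideanSpace ℝ (Fin n))
    (g : EuclideanSpace ℝ (Fin n) → ℝ) : ℝ :=
  ∫ x in M, g x * F (ν x) ∂(μHE[n - 1])

/-- The anisotropic area `|M|_F = ∫_M F(ν) dμ`. -/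
def anisoArea {n : ℕ} (F : EuclideanSpace ℝ (Fin n) → ℝ) (M : Set (EuclideanSpace ℝ (Fin n)))
    (ν : EuclideanSpace ℝ (Fin n) → EuclideanSpace ℝ (Fin n)) : ℝ :=
  ∫ x in M, F (ν x) ∂(μHE[n - 1])

/-- `M = x₀ + r ∂W` for some `r > 0` and some point `x₀`. -/
def IsTranslatedScaledWulffShape {n : ℕ} (F : EuclideanSpace ℝ (Fin n) → ℝ)
    (M : Set (EuclideanSpace ℝ (Fin n))) : Prop :=
  ∃ (r : ℝ) (x₀ : EuclideanSpace ℝ (Fin n)), 0 < r ∧ M = (fun y => x₀ + r • y) '' wulffShape F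

end AnisoWillmore

end

/-! For a unit vector `u`, let `x` be a point of `M` where `⟪u, ·⟫` is maximal. The normal there is
`u` or `-u`, and `M` lies on one side of its tangent hyperplane. Hence the anisotropic Gauss map,
restricted to such support points, already covers the whole Wulff shape, which is the image of the
unit sphere under `gradient F` (`mem_wulffShape_iff`, `wulffShape_subset`).

At a support point `dν_F` is the product of the Hessian of `F`, positive definite on the tangent
space, and a second fundamental form that is semidefinite because `M` lies on one side. The
arithmetic-geometric mean inequality for the eigenvalues then gives `det dν_F ≤ (H_F / (n - 1)) ^ (n
- 1)` (`det_weingarten_le`). The Wulff normal at `ν_F(x)` is `ν x`, so both anisotropic area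
elements carry the same weight `F (ν x)`. Comparing the area of the image with the integral of the
determinant (`wulffArea_image_le`) proves the inequality. The orientation `ν` need not point
outward; since `F` is even, support points for `-ν` are treated in the same way.

In case of equality, every point with `H_F ≠ 0` is a support point and is umbilical: `dν_F = c •
id`. In tangent dimension at least two, which is where `n ≥ 3` enters, the factor `c` and the centre
are locally constant (`eventually_center_eq`). The points sharing curvature and centre with a given
point of nonzero curvature form an open and closed part of `M`, which is a translated scaled Wulff
shape. Any remaining part would be a compact hypersurface with its own Willmore inequality, hence
would carry positive extra energy, which equality forbids. Conversely, on a Wulff shape of radius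
`r` one has `dν_F = ± r⁻¹ • id`, and scaling gives equality. -/

namespace AnisoWillmore

/-! ### Arithmetic-geometric mean inequality for products of symmetric operators -/

section LinearAlgebra

open Matrix
open scoped MatrixOrder Matrix.Norms.L2Operator

/-- This is the mean inequality for the eigenvalues with equal weights. Equality makes all
eigenvalues coincide, and the spectral theorem turns this into a scalar matrix. -/
theorem Matrix.PosSemidef.det_le_trace_pow {ι : Type*} [Fintype ι] [DecidableEq ι] [Nonempty ι]
    {S : Matrix ι ι ℝ} (hS : S.PosSemidef) :
    S.det ≤ (S.trace / Fintype.card ι) ^ Fintype.card ι ∧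
      (S.det = (S.trace / Fintype.card ι) ^ Fintype.card ι → ∃ c : ℝ, S = c • (1 : Matrix ι ι ℝ)) := by
  set d := Fintype.card ι with hd
  have hd0 : (d : ℝ) ≠ 0 := by simp [hd]
  have hd1 : d ≠ 0 := by simp [hd]
  set z := hS.1.eigenvalues with hz
  have hz0 : ∀ i, 0 ≤ z i := hS.eigenvalues_nonneg
  have hdet : S.det = ∏ i, z i := by simpa using hS.1.det_eq_prod_eigenvalues
  have htr : S.trace = ∑ i, z i := by simpa using hS.1.trace_eq_sum_eigenvalues
  have hw : ∑ _i : ι, ((d : ℝ)⁻¹) = 1 := by simp [hd]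
  have hwpos : ∀ i ∈ (Finset.univ : Finset ι), 0 < (d : ℝ)⁻¹ := fun i _ => by
    have : (0 : ℝ) ≤ d := Nat.cast_nonneg d
    positivity
  have hmean : ∑ i, (d : ℝ)⁻¹ * z i = S.trace / d := by
    rw [htr, ← Finset.mul_sum]; ring
  have hgeom : (∏ i, z i ^ ((d : ℝ)⁻¹)) ^ d = S.det := by
    rw [hdet, ← Finset.prod_pow]
    refine Finset.prod_congr rfl fun i _ => ?_
    exact Real.rpow_inv_natCast_pow (hz0 i) hd1
  have hgeom0 : 0 ≤ ∏ i, z i ^ ((d : ℝ)⁻¹) := Finset.prod_nonneg fun i _ => Real.rpow_nonneg (hz0 i) _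
  have hle := Real.geom_mean_le_arith_mean_weighted Finset.univ (fun _ => (d : ℝ)⁻¹) z
    (fun i hi => (hwpos i hi).le) hw (fun i _ => hz0 i)
  have htr0 : 0 ≤ S.trace / d := hgeom0.trans (hmean ▸ hle)
  refine ⟨?_, fun heq => ?_⟩
  · rw [← hgeom, ← hmean]
    exact pow_le_pow_left₀ hgeom0 hle d
  · rw [← hgeom, ← hmean] at heq
    have h1 := (pow_left_inj₀ hgeom0 (hmean ▸ htr0) hd1).1 heq
    have h2 := (Real.geom_mean_eq_arith_mean_weighted_iff_of_pos' Finset.univ (fun _ => (d : ℝ)⁻¹) z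
      hwpos hw (fun i _ => hz0 i)).1 h1
    refine ⟨∑ i, (d : ℝ)⁻¹ * z i, ?_⟩
    have h3 : z = fun _ => ∑ i, (d : ℝ)⁻¹ * z i := funext fun j => h2 j (Finset.mem_univ j)
    generalize (∑ i, (d : ℝ)⁻¹ * z i) = c at h3
    have h4 := hS.1.spectral_theorem
    rw [← hz, h3] at h4
    rw [h4]
    have : Matrix.diagonal ((RCLike.ofReal : ℝ → ℝ) ∘ fun _ : ι => c) = c • (1 : Matrix ι ι ℝ) := by
      ext i j; simp [Matrix.diagonal_apply, Matrix.one_apply]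
    rw [this]
    rw [map_smul, map_one]

/-- The product `A * B` need not be symmetric, but writing `A = Cᴴ * C` it has the determinant and
trace of the positive semidefinite matrix `C * B * Cᴴ`. -/
theorem Matrix.PosDef.det_mul_le_trace_pow {ι : Type*} [Fintype ι] [DecidableEq ι] [Nonempty ι]
    {A B : Matrix ι ι ℝ} (hA : A.PosDef) (hB : B.PosSemidef) :
    0 ≤ (A * B).det ∧ 0 ≤ (A * B).trace ∧
    (A * B).det ≤ ((A * B).trace / Fintype.card ι) ^ Fintype.card ι ∧
      ((A * B).det = ((A * B).trace / Fintype.card ι) ^ Fintype.card ι →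
        ∃ c : ℝ, A * B = c • (1 : Matrix ι ι ℝ)) := by
  obtain ⟨C, hC⟩ : ∃ C : Matrix ι ι ℝ, A = Cᴴ * C :=
    CStarAlgebra.nonneg_iff_eq_star_mul_self.mp hA.posSemidef.nonneg
  have hS : (C * B * Cᴴ).PosSemidef := hB.mul_mul_conjTranspose_same C
  have hdet : (A * B).det = (C * B * Cᴴ).det := by
    rw [hC]; simp only [Matrix.det_mul]; ring
  have htr : (A * B).trace = (C * B * Cᴴ).trace := by
    rw [hC, Matrix.mul_assoc, Matrix.trace_mul_comm]
  have hCu : IsUnit C.det := by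
    have := hA.det_pos.ne'
    rw [hC, Matrix.det_mul] at this
    exact (right_ne_zero_of_mul this).isUnit
  obtain ⟨h1, h2⟩ := Matrix.PosSemidef.det_le_trace_pow hS
  rw [hdet, htr]
  refine ⟨hS.det_nonneg, hS.trace_nonneg, h1, fun heq => ?_⟩
  obtain ⟨c, hc⟩ := h2 heq
  refine ⟨c, ?_⟩
  -- From `C * B * Cᴴ = c • 1`, multiplying by `C` on the right and cancelling `C` on the left gives
  -- `B * A = c • 1`; transposing exchanges the factors.
  have h3 : C * (B * A) = C * (c • (1 : Matrix ι ι ℝ)) := by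
    rw [hC, ← Matrix.mul_assoc, ← Matrix.mul_assoc, hc]; simp
  have h4 : B * A = c • (1 : Matrix ι ι ℝ) :=
    ((Matrix.isUnit_iff_isUnit_det C).2 hCu).mul_left_cancel h3
  have h5 := congrArg Matrix.conjTranspose h4
  rwa [Matrix.conjTranspose_mul, hA.1.eq, hB.1.eq, Matrix.conjTranspose_smul,
    Matrix.conjTranspose_one, star_trivial] at h5

/-- The arithmetic-geometric mean inequality for the eigenvalues of the product of a positive
definite and a positive semidefinite symmetric operator. -/
theorem det_comp_le_trace_pow {V : Type*} [NormedAddCommGroup V] [InnerProductSpace ℝ V]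
    [FiniteDimensional ℝ V] {d : ℕ} (hd : Module.finrank ℝ V = d) (hd0 : 0 < d) {A B : V →ₗ[ℝ] V}
    (hAs : A.IsSymmetric) (hA : ∀ v, v ≠ 0 → 0 < ⟪A v, v⟫)
    (hBs : B.IsSymmetric) (hB : ∀ v, 0 ≤ ⟪B v, v⟫) :
    0 ≤ LinearMap.det (A ∘ₗ B) ∧ 0 ≤ LinearMap.trace ℝ V (A ∘ₗ B) ∧
    LinearMap.det (A ∘ₗ B) ≤ (LinearMap.trace ℝ V (A ∘ₗ B) / d) ^ d ∧
      (LinearMap.det (A ∘ₗ B) = (LinearMap.trace ℝ V (A ∘ₗ B) / d) ^ d →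
        ∃ c : ℝ, A ∘ₗ B = c • LinearMap.id) := by
  subst hd
  have : Nonempty (Fin (Module.finrank ℝ V)) := ⟨⟨0, hd0⟩⟩
  let b := stdOrthonormalBasis ℝ V
  have hquad : ∀ (L : V →ₗ[ℝ] V) (x : Fin (Module.finrank ℝ V) → ℝ),
      star x ⬝ᵥ (LinearMap.toMatrix b.toBasis b.toBasis L) *ᵥ x =
        ⟪L (b.toBasis.equivFun.symm x), b.toBasis.equivFun.symm x⟫ := by
    intro L x
    set v := b.toBasis.equivFun.symm x with hv
    have hx : x = b.toBasis.repr v := by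
      rw [← b.toBasis.equivFun_apply, hv, LinearEquiv.apply_symm_apply]
    rw [hx, LinearMap.toMatrix_mulVec_repr, real_inner_comm, ← b.sum_inner_mul_inner]
    simp [dotProduct, b.coe_toBasis_repr_apply, b.repr_apply_apply, real_inner_comm]
  have hAm : (LinearMap.toMatrix b.toBasis b.toBasis A).PosDef := by
    refine Matrix.PosDef.of_dotProduct_mulVec_pos ((LinearMap.isHermitian_toMatrix_iff b).2 hAs) fun x hx => ?_
    rw [hquad]
    exact hA _ (by simpa using hx)
  have hBm : (LinearMap.toMatrix b.toBasis b.toBasis B).PosSemidef := by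
    refine Matrix.PosSemidef.of_dotProduct_mulVec_nonneg ((LinearMap.isHermitian_toMatrix_iff b).2 hBs) fun x => ?_
    rw [hquad]
    exact hB _
  have h := Matrix.PosDef.det_mul_le_trace_pow hAm hBm
  rw [← LinearMap.toMatrix_comp, LinearMap.det_toMatrix, ← LinearMap.trace_eq_matrix_trace,
    Fintype.card_fin] at h
  refine ⟨h.1, h.2.1, h.2.2.1, fun heq => ?_⟩
  obtain ⟨c, hc⟩ := h.2.2.2 heq
  refine ⟨c, (LinearMap.toMatrix b.toBasis b.toBasis).injective ?_⟩
  rw [hc, map_smul, LinearMap.toMatrix_id]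

end LinearAlgebra

end AnisoWillmore

namespace AnisoWillmore

open Filter Topology

/-! ### Gradients and Hessians as operators -/

section Gradient

variable {E : Type*} [NormedAddCommGroup E] [InnerProductSpace ℝ E] [CompleteSpace E]

theorem inner_gradient_eq_fderiv (f : E → ℝ) (x v : E) : ⟪gradient f x, v⟫ = fderiv ℝ f x v := by
  simp [gradient]

theorem gradient_ne_zero {f : E → ℝ} {x : E} (h : fderiv ℝ f x ≠ 0) : gradient f x ≠ 0 := by
  simpa [gradient] using h

theorem contDiffAt_gradient {f : E → ℝ} {x : E} (hf : ContDiffAt ℝ ∞ f x) :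
    ContDiffAt ℝ ∞ (gradient f) x := by
  have h1 : ContDiffAt ℝ ∞ (fderiv ℝ f) x := hf.fderiv_right (by simp)
  exact (InnerProductSpace.toDual ℝ E).symm.toContinuousLinearEquiv.contDiff.contDiffAt.comp x h1

theorem inner_fderiv_gradient {f : E → ℝ} {x : E} (hf : ContDiffAt ℝ ∞ f x) (v w : E) :
    ⟪fderiv ℝ (gradient f) x v, w⟫ = fderiv ℝ (fderiv ℝ f) x v w := by
  have h1 : ContDiffAt ℝ ∞ (fderiv ℝ f) x := hf.fderiv_right (by simp)
  have h2 := (InnerProductSpace.toDual ℝ E).symm.toContinuousLinearEquiv.hasFDerivAt.comp x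
    (h1.differentiableAt (by simp)).hasFDerivAt
  have h3 : fderiv ℝ (gradient f) x = _ := HasFDerivAt.fderiv h2
  rw [h3]
  simp

theorem isSymmetric_fderiv_gradient {f : E → ℝ} {x : E} (hf : ContDiffAt ℝ ∞ f x) :
    (fderiv ℝ (gradient f) x).toLinearMap.IsSymmetric := by
  intro v w
  rw [ContinuousLinearMap.coe_coe, inner_fderiv_gradient hf, real_inner_comm,
    inner_fderiv_gradient hf]
  exact hf.isSymmSndFDerivAt (by simpa using ENat.LEInfty.out) v w

end Gradient

/-! ### Homogeneity and strict convexity of a Minkowski norm -/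

section MinkowskiNorm

variable {n : ℕ} {F : EuclideanSpace ℝ (Fin n) → ℝ}

local notation "𝔼" => EuclideanSpace ℝ (Fin n)

namespace IsMinkowskiNorm

theorem contDiffAt (hF : IsMinkowskiNorm F) {ξ : 𝔼} (hξ : ξ ≠ 0) : ContDiffAt ℝ ∞ F ξ :=
  hF.contDiffOn.contDiffAt (isOpen_compl_singleton.mem_nhds hξ)

theorem differentiableAt (hF : IsMinkowskiNorm F) {ξ : 𝔼} (hξ : ξ ≠ 0) :
    DifferentiableAt ℝ F ξ :=
  (hF.contDiffAt hξ).differentiableAt (by simp)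

theorem map_zero (hF : IsMinkowskiNorm F) : F 0 = 0 := by
  have := hF.homogeneous 2 0 (by norm_num)
  rw [smul_zero] at this
  linarith

theorem nonneg (hF : IsMinkowskiNorm F) (ξ : 𝔼) : 0 ≤ F ξ := by
  rcases eq_or_ne ξ 0 with rfl | h
  · exact hF.map_zero.ge
  · exact (hF.pos ξ h).le

theorem gradient_smul (hF : IsMinkowskiNorm F) {t : ℝ} (ht : 0 < t) {ξ : 𝔼} (hξ : ξ ≠ 0) :
    gradient F (t • ξ) = gradient F ξ := by
  refine ext_inner_right ℝ fun v => ?_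
  rw [inner_gradient_eq_fderiv, inner_gradient_eq_fderiv]
  have htξ : t • ξ ≠ 0 := smul_ne_zero ht.ne' hξ
  have h1 : HasFDerivAt (fun η : 𝔼 => F (t • η)) (t • fderiv ℝ F ξ) ξ := by
    have : (fun η : 𝔼 => F (t • η)) = fun η => t * F η := funext fun η => hF.homogeneous t η ht
    rw [this]
    exact (hF.differentiableAt hξ).hasFDerivAt.const_mul t
  have h2 : HasFDerivAt (fun η : 𝔼 => F (t • η))
      ((fderiv ℝ F (t • ξ)).comp (t • ContinuousLinearMap.id ℝ 𝔼)) ξ :=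
    (hF.differentiableAt htξ).hasFDerivAt.comp ξ ((hasFDerivAt_id ξ).const_smul t)
  have h3 := congrArg (fun L : 𝔼 →L[ℝ] ℝ => L v) (h1.unique h2)
  simp only [_root_.smul_apply, smul_eq_mul, ContinuousLinearMap.comp_apply,
    ContinuousLinearMap.id_apply, map_smul] at h3
  exact (mul_left_cancel₀ ht.ne' h3).symm

theorem gradient_neg (hF : IsMinkowskiNorm F) {ξ : 𝔼} (hξ : ξ ≠ 0) :
    gradient F (-ξ) = -gradient F ξ := by
  refine ext_inner_right ℝ fun v => ?_
  rw [inner_neg_left, inner_gradient_eq_fderiv, inner_gradient_eq_fderiv]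
  have h1 : HasFDerivAt (fun η : 𝔼 => F (-η)) (fderiv ℝ F ξ) ξ := by
    have : (fun η : 𝔼 => F (-η)) = F := funext fun η => hF.even η
    rw [this]
    exact (hF.differentiableAt hξ).hasFDerivAt
  have h2 : HasFDerivAt (fun η : 𝔼 => F (-η))
      ((fderiv ℝ F (-ξ)).comp (-ContinuousLinearMap.id ℝ 𝔼)) ξ :=
    (hF.differentiableAt (neg_ne_zero.2 hξ)).hasFDerivAt.comp ξ (hasFDerivAt_id ξ).neg
  have h3 := congrArg (fun L : 𝔼 →L[ℝ] ℝ => L v) (h1.unique h2)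
  simp at h3
  linarith

theorem inner_gradient_self (hF : IsMinkowskiNorm F) {ξ : 𝔼} (hξ : ξ ≠ 0) :
    ⟪gradient F ξ, ξ⟫ = F ξ := by
  rw [inner_gradient_eq_fderiv]
  have h1 : HasDerivAt (fun t : ℝ => F (t • ξ)) (fderiv ℝ F ξ ξ) 1 := by
    have h := HasFDerivAt.comp_hasDerivAt (f := fun t : ℝ => t • ξ) (x := (1 : ℝ)) (l := F)
      (l' := fderiv ℝ F ξ) (f' := ξ)
      (by simpa using (hF.differentiableAt hξ).hasFDerivAt)
      (by simpa using (hasDerivAt_id (1 : ℝ)).smul_const ξ)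
    exact h
  have h2 : HasDerivAt (fun t : ℝ => F (t • ξ)) (F ξ) 1 := by
    have h : HasDerivAt (fun t : ℝ => t * F ξ) (F ξ) 1 := by
      simpa using (hasDerivAt_id (1 : ℝ)).mul_const (F ξ)
    refine h.congr_of_eventuallyEq ?_
    filter_upwards [lt_mem_nhds (zero_lt_one (α := ℝ))] with t ht
    exact hF.homogeneous t ξ ht
  exact h1.unique h2

/-- This is the supporting hyperplane inequality at `ξ`, in which Euler's relation cancels the
constant terms. It also yields the monotonicity of `gradient F`. -/
theorem inner_gradient_le (hF : IsMinkowskiNorm F) {ξ : 𝔼} (hξ : ξ ≠ 0) (η : 𝔼) :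
    ⟪gradient F ξ, η⟫ ≤ F η := by
  -- the slope of the convex function `t ↦ F (ξ + t (η - ξ))` at `0` is at most its increment
  have hd : HasDerivAt (fun t : ℝ => F (ξ + t • (η - ξ))) (fderiv ℝ F ξ (η - ξ)) 0 := by
    exact HasFDerivAt.comp_hasDerivAt (f := fun t : ℝ => ξ + t • (η - ξ)) (x := (0 : ℝ)) (l := F)
      (l' := fderiv ℝ F ξ) (f' := η - ξ)
      (by simpa using (hF.differentiableAt hξ).hasFDerivAt)
      (by simpa using ((hasDerivAt_id (0 : ℝ)).smul_const (η - ξ)).const_add ξ)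
  have hc : ConvexOn ℝ univ (fun t : ℝ => F (ξ + t • (η - ξ))) := by
    have := hF.convexOn.comp_affineMap (AffineMap.lineMap ξ η : ℝ →ᵃ[ℝ] 𝔼)
    rw [preimage_univ] at this
    have heq : (fun t : ℝ => F (ξ + t • (η - ξ))) = F ∘ (AffineMap.lineMap ξ η : ℝ →ᵃ[ℝ] 𝔼) := by
      ext t
      simp [AffineMap.lineMap_apply, add_comm]
    rw [heq]
    exact this
  have h := hc.le_slope_of_hasDerivAt (mem_univ 0) (mem_univ 1) zero_lt_one hd
  rw [slope_def_field] at h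
  simp only [one_smul, add_sub_cancel, zero_smul, add_zero, sub_zero, div_one] at h
  rw [map_sub, ← inner_gradient_eq_fderiv, ← inner_gradient_eq_fderiv,
    hF.inner_gradient_self hξ] at h
  linarith

/-- The gradient is homogeneous of degree zero, so it is constant along the ray through `ξ`. -/
theorem fderiv_gradient_self (hF : IsMinkowskiNorm F) {ξ : 𝔼} (hξ : ξ ≠ 0) :
    fderiv ℝ (gradient F) ξ ξ = 0 := by
  have hg : DifferentiableAt ℝ (gradient F) ξ :=
    (contDiffAt_gradient (hF.contDiffAt hξ)).differentiableAt (by simp)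
  have h1 : HasDerivAt (fun t : ℝ => gradient F (t • ξ)) (fderiv ℝ (gradient F) ξ ξ) 1 :=
    HasFDerivAt.comp_hasDerivAt (f := fun t : ℝ => t • ξ) (x := (1 : ℝ)) (l := gradient F)
      (l' := fderiv ℝ (gradient F) ξ) (f' := ξ)
      (by simpa using hg.hasFDerivAt)
      (by simpa using (hasDerivAt_id (1 : ℝ)).smul_const ξ)
  have h2 : HasDerivAt (fun t : ℝ => gradient F (t • ξ)) 0 1 := by
    refine (hasDerivAt_const (1 : ℝ) (gradient F ξ)).congr_of_eventuallyEq ?_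
    filter_upwards [lt_mem_nhds (zero_lt_one (α := ℝ))] with t ht
    exact hF.gradient_smul ht hξ
  exact h1.unique h2

/-- The Hessian of `F ^ 2` is `2 F · Hess F + 2 dF ⊗ dF`, and the second term vanishes on the kernel
of `dF`. -/
theorem inner_fderiv_gradient_pos_of_inner_gradient_eq_zero (hF : IsMinkowskiNorm F) {ξ v : 𝔼}
    (hξ : ξ ≠ 0) (hv : v ≠ 0) (h0 : ⟪gradient F ξ, v⟫ = 0) :
    0 < ⟪fderiv ℝ (gradient F) ξ v, v⟫ := by
  rw [inner_fderiv_gradient (hF.contDiffAt hξ)]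
  rw [inner_gradient_eq_fderiv] at h0
  have hpos := hF.hess_pos ξ hξ v hv
  rw [iteratedFDeriv_two_apply] at hpos
  simp only [Matrix.cons_val_zero, Matrix.cons_val_one] at hpos
  have hev : fderiv ℝ (fun η => F η ^ 2) =ᶠ[𝓝 ξ] fun η => (2 * F η) • fderiv ℝ F η := by
    filter_upwards [isOpen_compl_singleton.mem_nhds hξ] with η hη
    have := ((hF.differentiableAt hη).hasFDerivAt.pow 2).fderiv
    simpa using this
  have hd : HasFDerivAt (fun η => (2 * F η) • fderiv ℝ F η)
      ((2 * F ξ) • fderiv ℝ (fderiv ℝ F) ξ +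
        ((2 : ℝ) • fderiv ℝ F ξ).smulRight (fderiv ℝ F ξ)) ξ := by
    have h1 : ContDiffAt ℝ ∞ (fderiv ℝ F) ξ := (hF.contDiffAt hξ).fderiv_right (by simp)
    exact ((hF.differentiableAt hξ).hasFDerivAt.const_mul 2).smul
      (h1.differentiableAt (by simp)).hasFDerivAt
  rw [hev.fderiv_eq, hd.fderiv] at hpos
  simp only [_root_.add_apply, _root_.smul_apply,
    ContinuousLinearMap.smulRight_apply, h0, smul_eq_mul, mul_zero, add_zero] at hpos
  have := hF.pos ξ hξ
  exact pos_of_mul_pos_right hpos (by positivity)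

/-- Subtracting a multiple of `ξ` moves `v` into the kernel of `dF`. The quadratic form does not
change, because `ξ` is in the kernel of the symmetric operator `Hess F`; the result is nonzero
because `v ⊥ ξ`. -/
theorem inner_fderiv_gradient_pos (hF : IsMinkowskiNorm F) {ξ v : 𝔼}
    (hξ : ξ ≠ 0) (hv : v ≠ 0) (h0 : ⟪ξ, v⟫ = 0) :
    0 < ⟪fderiv ℝ (gradient F) ξ v, v⟫ := by
  have hFξ := hF.pos ξ hξ
  set a := ⟪gradient F ξ, v⟫ / F ξ with ha
  set w := v - a • ξ with hw
  have hw0 : w ≠ 0 := by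
    intro h
    have h1 : v = a • ξ := sub_eq_zero.1 h
    have h2 : ⟪v, v⟫ = 0 := by
      nth_rw 1 [h1]; rw [inner_smul_left, h0]; simp
    exact hv (inner_self_eq_zero.1 h2)
  have h1 : ⟪gradient F ξ, w⟫ = 0 := by
    rw [hw, inner_sub_right, inner_smul_right, hF.inner_gradient_self hξ, ha]
    field_simp
    ring
  have h2 := hF.inner_fderiv_gradient_pos_of_inner_gradient_eq_zero hξ hw0 h1
  have hs := isSymmetric_fderiv_gradient (hF.contDiffAt hξ)
  have h3 : ⟪fderiv ℝ (gradient F) ξ v, ξ⟫ = 0 := by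
    have := hs v ξ
    rw [ContinuousLinearMap.coe_coe, hF.fderiv_gradient_self hξ, inner_zero_right] at this
    exact this
  have h4 : fderiv ℝ (gradient F) ξ w = fderiv ℝ (gradient F) ξ v := by
    rw [hw, map_sub, map_smul, hF.fderiv_gradient_self hξ, smul_zero, sub_zero]
  rwa [h4, hw, inner_sub_right, inner_smul_right, h3, mul_zero, sub_zero] at h2

/-- With `ξ` normal to `M`, this is why `dν_F` takes values in the tangent space. -/
theorem inner_fderiv_gradient_self (hF : IsMinkowskiNorm F) {ξ : 𝔼} (hξ : ξ ≠ 0) (v : 𝔼) :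
    ⟪ξ, fderiv ℝ (gradient F) ξ v⟫ = 0 := by
  have := isSymmetric_fderiv_gradient (hF.contDiffAt hξ) ξ v
  rw [ContinuousLinearMap.coe_coe, hF.fderiv_gradient_self hξ, inner_zero_left] at this
  exact this.symm

/-- If the supporting hyperplane of `F` at `u` touches the graph over `η`, then `η` is a multiple
of `u`. -/
theorem eq_smul_of_inner_gradient_eq (hF : IsMinkowskiNorm F) {u η : 𝔼} (hu : u ≠ 0) (hη : η ≠ 0)
    (h : ⟪gradient F u, η⟫ = F η) : u = (F u / F η) • η := by
  have hFu := hF.pos u hu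
  have hFη := hF.pos η hη
  set c := F u / F η with hc
  have hcpos : 0 < c := div_pos hFu hFη
  by_contra hne
  set v := c • η - u with hv
  have hv0 : v ≠ 0 := fun h0 => hne (sub_eq_zero.1 h0).symm
  have hinner : ⟪gradient F u, v⟫ = 0 := by
    rw [hv, inner_sub_right, inner_smul_right, h, hF.inner_gradient_self hu, hc]
    field_simp; ring
  -- On the segment from `u` to `c • η`, convexity bounds `F` from above by `F u` and the supporting
  -- hyperplane at `u` bounds it from below.
  have hseg : ∀ t ∈ Icc (0 : ℝ) 1, F (u + t • v) = F u := by
    intro t ht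
    apply le_antisymm
    · have := hF.convexOn.2 (mem_univ u) (mem_univ (c • η)) (sub_nonneg.2 ht.2) ht.1 (by ring)
      have h2 : F (c • η) = F u := by
        rw [hF.homogeneous c η hcpos, hc]; field_simp
      rw [h2] at this
      have h3 : (1 - t) • u + t • c • η = u + t • v := by rw [hv]; module
      rw [h3] at this
      simp only [smul_eq_mul] at this
      linarith
    · have := hF.inner_gradient_le hu (u + t • v)
      rwa [inner_add_right, inner_smul_right, hinner, mul_zero, add_zero,
        hF.inner_gradient_self hu] at this
  have hne0 : ∀ t ∈ Icc (0 : ℝ) 1, u + t • v ≠ 0 := by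
    intro t ht h0
    have := hseg t ht
    rw [h0, hF.map_zero] at this
    exact hFu.ne this
  have hd : ∀ t ∈ Ioo (0 : ℝ) 1, ⟪gradient F (u + t • v), v⟫ = 0 := by
    intro t ht
    have h1 : HasDerivAt (fun s : ℝ => F (u + s • v)) (fderiv ℝ F (u + t • v) v) t :=
      HasFDerivAt.comp_hasDerivAt (f := fun s : ℝ => u + s • v) t
        (hF.differentiableAt (hne0 t (Ioo_subset_Icc_self ht))).hasFDerivAt
        (by simpa using ((hasDerivAt_id t).smul_const v).const_add u)
    have h2 : HasDerivAt (fun s : ℝ => F (u + s • v)) 0 t := by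
      refine (hasDerivAt_const t (F u)).congr_of_eventuallyEq ?_
      filter_upwards [Ioo_mem_nhds ht.1 ht.2] with s hs
      exact hseg s (Ioo_subset_Icc_self hs)
    rw [inner_gradient_eq_fderiv]
    exact h1.unique h2
  -- At the midpoint `v` lies in the kernel of `dF`, so the second derivative along `v` is positive;
  -- but `F` is constant on the segment.
  have hhalf : (1 / 2 : ℝ) ∈ Ioo (0 : ℝ) 1 := by norm_num
  have hζ := hne0 _ (Ioo_subset_Icc_self hhalf)
  have hpos := hF.inner_fderiv_gradient_pos_of_inner_gradient_eq_zero hζ hv0 (hd _ hhalf)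
  have h1 : HasDerivAt (fun s : ℝ => ⟪gradient F (u + s • v), v⟫)
      ⟪fderiv ℝ (gradient F) (u + (1 / 2 : ℝ) • v) v, v⟫ (1 / 2 : ℝ) := by
    have hg : DifferentiableAt ℝ (gradient F) (u + (1 / 2 : ℝ) • v) :=
      (contDiffAt_gradient (hF.contDiffAt hζ)).differentiableAt (by simp)
    have h2 : HasDerivAt (fun s : ℝ => gradient F (u + s • v))
        (fderiv ℝ (gradient F) (u + (1 / 2 : ℝ) • v) v) (1 / 2 : ℝ) :=
      HasFDerivAt.comp_hasDerivAt (f := fun s : ℝ => u + s • v) (1 / 2 : ℝ) hg.hasFDerivAt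
        (by simpa using ((hasDerivAt_id (1 / 2 : ℝ)).smul_const v).const_add u)
    simpa using h2.inner ℝ (hasDerivAt_const (1 / 2 : ℝ) v)
  have h2 : HasDerivAt (fun s : ℝ => ⟪gradient F (u + s • v), v⟫) 0 (1 / 2 : ℝ) := by
    refine (hasDerivAt_const (1 / 2 : ℝ) (0 : ℝ)).congr_of_eventuallyEq ?_
    filter_upwards [Ioo_mem_nhds hhalf.1 hhalf.2] with s hs
    exact hd s hs
  exact hpos.ne' (h1.unique h2)

theorem eq_of_inner_gradient_eq (hF : IsMinkowskiNorm F) {u η : 𝔼} (hu : ‖u‖ = 1) (hη : ‖η‖ = 1)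
    (h : ⟪gradient F u, η⟫ = F η) : u = η := by
  have hu0 : u ≠ 0 := by rintro rfl; simp at hu
  have hη0 : η ≠ 0 := by rintro rfl; simp at hη
  have h1 := hF.eq_smul_of_inner_gradient_eq hu0 hη0 h
  have hc : 0 < F u / F η := div_pos (hF.pos u hu0) (hF.pos η hη0)
  have h2 := congrArg norm h1
  rw [norm_smul, hu, hη, mul_one, Real.norm_of_nonneg hc.le] at h2
  rwa [← h2, one_smul] at h1

end IsMinkowskiNorm

end MinkowskiNorm

end AnisoWillmore

namespace AnisoWillmore

open Filter Topology

/-! ### The dual norm and the Gauss parametrization of the Wulff shape -/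

section DualNorm

variable {n : ℕ} {F : EuclideanSpace ℝ (Fin n) → ℝ}

local notation "𝔼" => EuclideanSpace ℝ (Fin n)

namespace IsMinkowskiNorm

theorem exists_mul_norm_le (hF : IsMinkowskiNorm F) : ∃ m > 0, ∀ ξ, m * ‖ξ‖ ≤ F ξ := by
  -- The unit sphere is empty exactly when `n = 0`; otherwise `m` is the minimum of `F` on it.
  rcases (Metric.sphere (0 : 𝔼) 1).eq_empty_or_nonempty with he | hne
  · refine ⟨1, one_pos, fun ξ => ?_⟩
    rcases eq_or_ne ξ 0 with rfl | h
    · simp [hF.map_zero]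
    · have : ‖ξ‖⁻¹ • ξ ∈ Metric.sphere (0 : 𝔼) 1 := by
        simp [norm_smul, norm_ne_zero_iff.2 h]
      rw [he] at this
      exact this.elim
  · obtain ⟨u, hu, hmin⟩ := (isCompact_sphere (0 : 𝔼) 1).exists_isMinOn hne
      hF.continuous.continuousOn
    have hu0 : u ≠ 0 := by rintro rfl; simp at hu
    refine ⟨F u, hF.pos u hu0, fun ξ => ?_⟩
    rcases eq_or_ne ξ 0 with rfl | h
    · simp [hF.map_zero]
    · have h0 : 0 < ‖ξ‖ := norm_pos_iff.2 h
      have hmem : ‖ξ‖⁻¹ • ξ ∈ Metric.sphere (0 : 𝔼) 1 := by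
        simp [norm_smul, h0.ne']
      have h1 : F u ≤ F (‖ξ‖⁻¹ • ξ) := hmin hmem
      rw [hF.homogeneous _ ξ (inv_pos.2 h0)] at h1
      rwa [← le_inv_mul_iff₀' h0]

/-- A real supremum over an unbounded family defaults to `0`; this bound makes `dualNorm` a genuine
supremum. -/
theorem bddAbove_dualNorm (hF : IsMinkowskiNorm F) (x : 𝔼) :
    BddAbove (range fun ξ : {ξ : 𝔼 // ξ ≠ 0} => ⟪(ξ : 𝔼), x⟫ / F ξ) := by
  obtain ⟨m, hm, h⟩ := hF.exists_mul_norm_le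
  refine ⟨‖x‖ / m, ?_⟩
  rintro _ ⟨⟨ξ, hξ⟩, rfl⟩
  have h0 : 0 < ‖ξ‖ := norm_pos_iff.2 hξ
  rw [div_le_div_iff₀ (hF.pos ξ hξ) hm]
  calc ⟪ξ, x⟫ * m ≤ ‖ξ‖ * ‖x‖ * m := by gcongr; exact real_inner_le_norm ξ x
    _ = ‖x‖ * (m * ‖ξ‖) := by ring
    _ ≤ ‖x‖ * F ξ := by gcongr; exact h ξ

theorem inner_le_dualNorm_mul (hF : IsMinkowskiNorm F) (ξ x : 𝔼) :
    ⟪ξ, x⟫ ≤ dualNorm F x * F ξ := by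
  rcases eq_or_ne ξ 0 with rfl | h
  · simp [hF.map_zero]
  · rw [← div_le_iff₀ (hF.pos ξ h)]
    exact le_ciSup (hF.bddAbove_dualNorm x) ⟨ξ, h⟩

theorem exists_inner_eq_dualNorm_mul (hF : IsMinkowskiNorm F) (hn : 0 < n) (x : 𝔼) :
    ∃ ξ : 𝔼, ‖ξ‖ = 1 ∧ ⟪ξ, x⟫ = dualNorm F x * F ξ := by
  have : Nonempty (Fin n) := ⟨⟨0, hn⟩⟩
  have hne : (Metric.sphere (0 : 𝔼) 1).Nonempty := NormedSpace.sphere_nonempty.2 zero_le_one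
  have hs0 : ∀ ξ ∈ Metric.sphere (0 : 𝔼) 1, ξ ≠ 0 := by
    rintro ξ hξ rfl; simp at hξ
  have hcont : ContinuousOn (fun ξ : 𝔼 => ⟪ξ, x⟫ / F ξ) (Metric.sphere (0 : 𝔼) 1) :=
    (by fun_prop : Continuous fun ξ : 𝔼 => ⟪ξ, x⟫).continuousOn.div hF.continuous.continuousOn
      fun ξ hξ => (hF.pos ξ (hs0 ξ hξ)).ne'
  obtain ⟨u, hu, hmax⟩ := (isCompact_sphere (0 : 𝔼) 1).exists_isMaxOn hne hcont
  have hu1 : ‖u‖ = 1 := by simpa using hu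
  have hu0 := hs0 u hu
  refine ⟨u, hu1, le_antisymm (hF.inner_le_dualNorm_mul u x) ?_⟩
  rw [← le_div_iff₀ (hF.pos u hu0)]
  have : Nonempty {ξ : 𝔼 // ξ ≠ 0} := ⟨⟨u, hu0⟩⟩
  refine ciSup_le fun ⟨ξ, hξ⟩ => ?_
  have h0 : 0 < ‖ξ‖ := norm_pos_iff.2 hξ
  have hmem : ‖ξ‖⁻¹ • ξ ∈ Metric.sphere (0 : 𝔼) 1 := by
    simp [norm_smul, h0.ne']
  have h1 : ⟪‖ξ‖⁻¹ • ξ, x⟫ / F (‖ξ‖⁻¹ • ξ) ≤ ⟪u, x⟫ / F u := hmax hmem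
  rwa [hF.homogeneous _ ξ (inv_pos.2 h0), real_inner_smul_left,
    mul_div_mul_left _ _ (inv_pos.2 h0).ne'] at h1

theorem dualNorm_gradient (hF : IsMinkowskiNorm F) {u : 𝔼} (hu : u ≠ 0) :
    dualNorm F (gradient F u) = 1 := by
  have : Nonempty {ξ : 𝔼 // ξ ≠ 0} := ⟨⟨u, hu⟩⟩
  apply le_antisymm
  · refine ciSup_le fun ⟨ξ, hξ⟩ => ?_
    rw [div_le_one (hF.pos ξ hξ), real_inner_comm]
    exact hF.inner_gradient_le hu ξ
  · have := hF.inner_le_dualNorm_mul u (gradient F u)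
    rw [real_inner_comm, hF.inner_gradient_self hu] at this
    exact le_of_mul_le_mul_right (by linarith) (hF.pos u hu)

theorem dualNorm_smul {t : ℝ} (ht : 0 ≤ t) (x : 𝔼) :
    dualNorm F (t • x) = t * dualNorm F x := by
  simp only [dualNorm]
  rw [Real.mul_iSup_of_nonneg ht]
  congr 1 with ξ
  rw [real_inner_smul_right, mul_div_assoc]

/-- A direction attaining the supremum in `dualNorm F x` minimizes `F - ⟪x, ·⟫`, so the derivative
of this difference vanishes there. -/
theorem exists_gradient_eq_of_dualNorm_eq_one (hF : IsMinkowskiNorm F) (hn : 0 < n) {x : 𝔼}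
    (hx : dualNorm F x = 1) : ∃ u : 𝔼, ‖u‖ = 1 ∧ gradient F u = x := by
  obtain ⟨u, hu, h⟩ := hF.exists_inner_eq_dualNorm_mul hn x
  have hu0 : u ≠ 0 := by rintro rfl; simp at hu
  refine ⟨u, hu, ?_⟩
  rw [hx, one_mul] at h
  have hmin : IsLocalMin (fun η : 𝔼 => F η - ⟪x, η⟫) u := by
    refine Eventually.of_forall fun η => ?_
    have := hF.inner_le_dualNorm_mul η x
    rw [hx, one_mul, real_inner_comm] at this
    show F u - ⟪x, u⟫ ≤ F η - ⟪x, η⟫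
    rw [real_inner_comm u x, h]
    linarith
  have hd : HasFDerivAt (fun η : 𝔼 => F η - ⟪x, η⟫) (fderiv ℝ F u - innerSL ℝ x) u :=
    (hF.differentiableAt hu0).hasFDerivAt.sub (innerSL ℝ x).hasFDerivAt
  have h0 := hmin.hasFDerivAt_eq_zero hd
  refine ext_inner_right ℝ fun v => ?_
  have := congrArg (fun L : 𝔼 →L[ℝ] ℝ => L v) h0
  simp at this
  rw [inner_gradient_eq_fderiv]
  linarith

/-- Testing `y` against the maximizing direction of `x` gives the Lipschitz constant `m⁻¹`. -/
theorem continuous_dualNorm (hF : IsMinkowskiNorm F) (hn : 0 < n) : Continuous (dualNorm F) := by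
  obtain ⟨m, hm, h⟩ := hF.exists_mul_norm_le
  have key : ∀ x y : 𝔼, dualNorm F x ≤ dualNorm F y + m⁻¹ * ‖x - y‖ := by
    intro x y
    obtain ⟨ξ, hξ, hx⟩ := hF.exists_inner_eq_dualNorm_mul hn x
    have hξ0 : ξ ≠ 0 := by rintro rfl; simp at hξ
    have hpos := hF.pos ξ hξ0
    have h1 := hF.inner_le_dualNorm_mul ξ y
    have h2 : ⟪ξ, x⟫ = ⟪ξ, y⟫ + ⟪ξ, x - y⟫ := by rw [inner_sub_right]; ring
    have h3 : ⟪ξ, x - y⟫ ≤ ‖x - y‖ := by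
      simpa [hξ] using real_inner_le_norm ξ (x - y)
    have h4 : ‖x - y‖ ≤ m⁻¹ * ‖x - y‖ * F ξ := by
      have h5 : 1 ≤ m⁻¹ * F ξ := by
        rw [← div_eq_inv_mul, one_le_div hm]; simpa [hξ] using h ξ
      nlinarith [norm_nonneg (x - y)]
    refine le_of_mul_le_mul_right ?_ hpos
    rw [add_mul]
    linarith
  refine (LipschitzWith.of_le_add_mul (Real.toNNReal m⁻¹) fun x y => ?_).continuous
  rw [Real.coe_toNNReal _ (inv_pos.2 hm).le, dist_eq_norm]
  exact key x y

theorem mem_wulffShape_iff (hF : IsMinkowskiNorm F) (hn : 0 < n) {x : 𝔼} :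
    x ∈ wulffShape F ↔ ∃ u : 𝔼, ‖u‖ = 1 ∧ gradient F u = x := by
  have hc := hF.continuous_dualNorm hn
  have h1 : ∀ u : 𝔼, ‖u‖ = 1 → gradient F u ∈ wulffShape F := by
    intro u hu
    have hu0 : u ≠ 0 := by rintro rfl; simp at hu
    have hd := hF.dualNorm_gradient hu0
    have hopen : IsOpen (wulffBall F) := isOpen_lt hc continuous_const
    rw [wulffShape, frontier, hopen.interior_eq]
    refine ⟨?_, fun h => ?_⟩
    -- The point is approached radially from inside: at `t • gradient F u` the dual norm equals `t <
    -- 1`.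
    · have htend : Tendsto (fun t : ℝ => t • gradient F u) (𝓝[<] 1) (𝓝 (gradient F u)) := by
        have : Continuous fun t : ℝ => t • gradient F u := by fun_prop
        simpa using (this.tendsto 1).mono_left nhdsWithin_le_nhds
      refine mem_closure_of_tendsto htend ?_
      filter_upwards [Ioo_mem_nhdsLT (zero_lt_one (α := ℝ))] with t ht
      show dualNorm F (t • gradient F u) < 1
      rw [dualNorm_smul ht.1.le, hd, mul_one]
      exact ht.2
    · have h' : dualNorm F (gradient F u) < 1 := h
      linarith
  refine ⟨fun hx => ?_, ?_⟩
  · exact hF.exists_gradient_eq_of_dualNorm_eq_one hn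
      (frontier_lt_subset_eq hc continuous_const hx)
  · rintro ⟨u, hu, rfl⟩
    exact h1 u hu

/-- The maximizer of the dual norm depends continuously on `x` at `gradient F u`. There `u` is the
only maximizer by strict convexity, so by compactness competitors at distance at least `ε` fall
short by a fixed gap, which a small change of `x` cannot close. -/
theorem norm_sub_lt_of_inner_eq_dualNorm (hF : IsMinkowskiNorm F) {u : 𝔼} (hu : u ≠ 0)
    (hFu : F u = 1) {ε : ℝ} (hε : 0 < ε) :
    ∀ᶠ x in 𝓝 (gradient F u), ∀ ξ, F ξ = 1 → ⟪ξ, x⟫ = dualNorm F x → ‖ξ - u‖ < ε := by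
  obtain ⟨m, hm, hmF⟩ := hF.exists_mul_norm_le
  set x₀ := gradient F u with hx₀
  set K : Set 𝔼 := {ξ | F ξ = 1} ∩ {ξ | ε ≤ ‖ξ - u‖} with hK
  have hbound : ∀ ξ, F ξ = 1 → ‖ξ‖ ≤ m⁻¹ := fun ξ h => by
    have := hmF ξ
    rw [h] at this
    rw [← one_div, le_div_iff₀' hm]; exact this
  have hKc : IsCompact K := by
    refine Metric.isCompact_of_isClosed_isBounded
      ((isClosed_eq hF.continuous continuous_const).inter
        (isClosed_le continuous_const (by fun_prop))) ?_
    exact (Metric.isBounded_iff_subset_closedBall 0).2 ⟨m⁻¹, fun ξ hξ => by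
      simpa using hbound ξ hξ.1⟩
  have hlt : ∀ ξ ∈ K, ⟪ξ, x₀⟫ < 1 := by
    rintro ξ ⟨h1, h2⟩
    have h1' : F ξ = 1 := h1
    have hle : ⟪ξ, x₀⟫ ≤ 1 := by
      rw [real_inner_comm, ← h1']; exact hF.inner_gradient_le hu ξ
    refine lt_of_le_of_ne hle fun heq => ?_
    have hξ0 : ξ ≠ 0 := by rintro rfl; rw [hF.map_zero] at h1'; exact zero_ne_one h1'
    have := hF.eq_smul_of_inner_gradient_eq hu hξ0 (by rw [real_inner_comm, heq, h1'])
    rw [hFu, h1', div_one, one_smul] at this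
    rw [this] at h2
    simp at h2
    linarith
  obtain ⟨c, hc0, hc⟩ : ∃ c > 0, ∀ ξ ∈ K, ⟪ξ, x₀⟫ ≤ 1 - c := by
    rcases K.eq_empty_or_nonempty with he | hne
    · exact ⟨1, one_pos, fun ξ hξ => by rw [he] at hξ; exact hξ.elim⟩
    · obtain ⟨ξ₀, hξ₀, hmax⟩ := hKc.exists_isMaxOn hne
        (by fun_prop : Continuous fun ξ : 𝔼 => ⟪ξ, x₀⟫).continuousOn
      exact ⟨1 - ⟪ξ₀, x₀⟫, by linarith [hlt ξ₀ hξ₀], fun ξ hξ => by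
        have : ⟪ξ, x₀⟫ ≤ ⟪ξ₀, x₀⟫ := hmax hξ
        linarith⟩
  -- Vectors with `F ζ = 1` have norm at most `m⁻¹`, so this radius changes each pairing by less
  -- than `c / 2`, and two such changes stay below the gap `c`.
  filter_upwards [Metric.ball_mem_nhds x₀ (show 0 < c * m / 2 by positivity)] with x hx ξ h1 h2
  by_contra hcon
  have hxn : ‖x - x₀‖ < c * m / 2 := by rwa [mem_ball_iff_norm] at hx
  have h3 := hc ξ ⟨h1, not_lt.1 hcon⟩
  have h4 : ∀ ζ, F ζ = 1 → |⟪ζ, x⟫ - ⟪ζ, x₀⟫| < c / 2 := by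
    intro ζ hζ
    rw [← inner_sub_right]
    calc |⟪ζ, x - x₀⟫| ≤ ‖ζ‖ * ‖x - x₀‖ := abs_real_inner_le_norm _ _
      _ ≤ m⁻¹ * ‖x - x₀‖ := by gcongr; exact hbound ζ hζ
      _ < m⁻¹ * (c * m / 2) := by gcongr
      _ = c / 2 := by field_simp
  have h5 := abs_lt.1 (h4 ξ h1)
  have h6 := abs_lt.1 (h4 u hFu)
  have h7 := hF.inner_le_dualNorm_mul u x
  have h8 : ⟪u, x₀⟫ = 1 := by rw [real_inner_comm, hF.inner_gradient_self hu, hFu]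
  rw [hFu, mul_one] at h7
  linarith [h5.2, h6.1]

/-- The derivative of a supremum is its unique maximizer. Testing with `u` bounds the increment from
below; the maximizer `ζ` at the nearby point bounds it from above, with an error controlled by `‖ζ -
u‖ < ε`. -/
theorem gradient_dualNorm (hF : IsMinkowskiNorm F) (hn : 0 < n) {u : 𝔼} (hu : u ≠ 0)
    (hFu : F u = 1) : gradient (dualNorm F) (gradient F u) = u := by
  have hd : HasFDerivAt (dualNorm F) (innerSL ℝ u) (gradient F u) := by
    rw [hasFDerivAt_iff_isLittleO, Asymptotics.isLittleO_iff]
    intro ε hε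
    filter_upwards [hF.norm_sub_lt_of_inner_eq_dualNorm hu hFu hε] with x hx
    obtain ⟨ξ, hξ, h⟩ := hF.exists_inner_eq_dualNorm_mul hn x
    have hξ0 : ξ ≠ 0 := by rintro rfl; simp at hξ
    have hpos := hF.pos ξ hξ0
    set ζ := (F ξ)⁻¹ • ξ with hζ
    have hFζ : F ζ = 1 := by
      rw [hζ, hF.homogeneous _ ξ (inv_pos.2 hpos), inv_mul_cancel₀ hpos.ne']
    have hζx : ⟪ζ, x⟫ = dualNorm F x := by
      rw [hζ, real_inner_smul_left, h]; field_simp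
    have h1 := hx ζ hFζ hζx
    have h2 : ⟪u, gradient F u⟫ = 1 := by rw [real_inner_comm, hF.inner_gradient_self hu, hFu]
    have h3 := hF.inner_le_dualNorm_mul u x
    have h4 : ⟪ζ, gradient F u⟫ ≤ 1 := by
      rw [real_inner_comm, ← hFζ]; exact hF.inner_gradient_le hu ζ
    rw [hFu, mul_one] at h3
    rw [hF.dualNorm_gradient hu, innerSL_apply_apply, inner_sub_right, h2, Real.norm_eq_abs,
      abs_of_nonneg (by linarith)]
    have h5 : dualNorm F x - 1 - (⟪u, x⟫ - 1) ≤ ⟪ζ - u, x - gradient F u⟫ := by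
      rw [inner_sub_left, inner_sub_right, inner_sub_right, h2, hζx]
      linarith
    calc _ ≤ ⟪ζ - u, x - gradient F u⟫ := h5
      _ ≤ ‖ζ - u‖ * ‖x - gradient F u‖ := real_inner_le_norm _ _
      _ ≤ ε * ‖x - gradient F u‖ := by gcongr
  refine ext_inner_right ℝ fun v => ?_
  rw [inner_gradient_eq_fderiv, hd.fderiv, innerSL_apply_apply]

/-- The Wulff normal at `ν_F(x)` is therefore `ν x`, so the weights `F(ν)` on `M` and on the Wulff
shape match under the Gauss map. -/
theorem wulffNormal_gradient (hF : IsMinkowskiNorm F) (hn : 0 < n) {u : 𝔼} (hu : ‖u‖ = 1) :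
    wulffNormal F (gradient F u) = u := by
  have hu0 : u ≠ 0 := by rintro rfl; simp at hu
  have hpos := inv_pos.2 (hF.pos u hu0)
  have h := hF.gradient_dualNorm hn (u := (F u)⁻¹ • u) (smul_ne_zero hpos.ne' hu0)
    (by rw [hF.homogeneous _ u hpos, inv_mul_cancel₀ (hF.pos u hu0).ne'])
  rw [hF.gradient_smul hpos hu0] at h
  rw [wulffNormal, h, norm_smul, hu, mul_one, Real.norm_of_nonneg hpos.le, inv_inv, smul_smul,
    mul_inv_cancel₀ (hF.pos u hu0).ne', one_smul]

theorem measurable_wulffNormal (F : 𝔼 → ℝ) : Measurable (wulffNormal F) := by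
  have h : Measurable (gradient (dualNorm F)) :=
    (InnerProductSpace.toDual ℝ 𝔼).symm.continuous.measurable.comp (measurable_fderiv ℝ _)
  exact h.norm.inv.smul h

end IsMinkowskiNorm

end DualNorm

end AnisoWillmore

namespace AnisoWillmore

open Filter Topology

/-! ### Graph charts, tangent spaces and Hessians of level sets -/

section Chart

variable {E : Type*} [NormedAddCommGroup E] [InnerProductSpace ℝ E] [FiniteDimensional ℝ E]

/-- A regular level set of a smooth function is a graph over its tangent hyperplane. -/
theorem exists_chart {f : E → ℝ} {p : E} (hf : ContDiffAt ℝ ∞ f p) (hp : f p = 0)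
    (he : gradient f p ≠ 0) :
    ∃ X : (ℝ ∙ gradient f p)ᗮ → E, ContDiffAt ℝ ∞ X 0 ∧ X 0 = p ∧
      HasFDerivAt X (ℝ ∙ gradient f p)ᗮ.subtypeL 0 ∧
      (∀ᶠ t in 𝓝 0, f (X t) = 0) ∧
      (∀ᶠ t in 𝓝 0, (ℝ ∙ gradient f p)ᗮ.orthogonalProjectionOnto (X t - p) = t) ∧
      (∀ᶠ x in 𝓝 p, f x = 0 →
        X ((ℝ ∙ gradient f p)ᗮ.orthogonalProjectionOnto (x - p)) = x) := by
  set e := gradient f p with hedef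
  set T := (ℝ ∙ e)ᗮ with hT
  set Q := T.orthogonalProjectionOnto with hQ
  -- This map straightens the level set. Its differential is bijective because `T` is the kernel of
  -- `df`, and `X` is its local inverse restricted to `{0} × T`.
  let Ψ : E → ℝ × T := fun x => (f x, Q (x - p))
  have hΨp : Ψ p = (0, 0) := by simp [Ψ, hp]
  have hΨ : ContDiffAt ℝ ∞ Ψ p :=
    hf.prodMk (Q.contDiff.contDiffAt.comp p (contDiffAt_id.sub contDiffAt_const))
  have hfd : HasFDerivAt f (fderiv ℝ f p) p := (hf.differentiableAt (by simp)).hasFDerivAt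
  have hΨd : HasFDerivAt Ψ ((fderiv ℝ f p).prod Q) p := by
    refine hfd.prodMk ?_
    exact Q.hasFDerivAt.comp p ((hasFDerivAt_id p).sub_const p)
  have hker : LinearMap.ker ((fderiv ℝ f p).prod Q).toLinearMap = ⊥ := by
    rw [LinearMap.ker_eq_bot']
    intro v hv
    have h1 : fderiv ℝ f p v = 0 := congrArg Prod.fst hv
    have h2 : Q v = 0 := congrArg Prod.snd hv
    rw [← inner_gradient_eq_fderiv] at h1
    have h3 : v ∈ T := Submodule.mem_orthogonal_singleton_iff_inner_right.2 h1
    have h4 : Q v = ⟨v, h3⟩ := Submodule.orthogonalProjectionOnto_mem_subspace_eq_self ⟨v, h3⟩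
    rw [h2] at h4
    exact (congrArg Subtype.val h4).symm
  have hrange : LinearMap.range ((fderiv ℝ f p).prod Q).toLinearMap = ⊤ := by
    rw [LinearMap.range_eq_top]
    rintro ⟨a, t⟩
    have ht : ⟪e, (t : E)⟫ = 0 := Submodule.mem_orthogonal_singleton_iff_inner_right.1 t.2
    refine ⟨t + (a / ⟪e, e⟫) • e, Prod.ext ?_ ?_⟩
    · show fderiv ℝ f p _ = a
      rw [← inner_gradient_eq_fderiv, ← hedef, inner_add_right, ht, inner_smul_right, zero_add,
        div_mul_cancel₀ _ (inner_self_ne_zero.2 he)]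
    · show Q _ = t
      have h0 : Q e = 0 :=
        Submodule.orthogonalProjectionOnto_orthogonalComplement_singleton_eq_zero e
      rw [map_add, map_smul, h0, smul_zero, add_zero]
      exact Submodule.orthogonalProjectionOnto_mem_subspace_eq_self t
  let L : E ≃L[ℝ] ℝ × T := ContinuousLinearEquiv.ofBijective ((fderiv ℝ f p).prod Q) hker hrange
  have hL : HasFDerivAt Ψ (L : E →L[ℝ] ℝ × T) p := by
    rw [ContinuousLinearEquiv.coe_ofBijective]; exact hΨd
  have hne : (∞ : WithTop ℕ∞) ≠ 0 := by simp
  have hstrict := hΨ.hasStrictFDerivAt' hL hne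
  let G := hΨ.localInverse hL hne
  have hG : ContDiffAt ℝ ∞ G (0, 0) := hΨp ▸ hΨ.to_localInverse hL hne
  have hGp : G (0, 0) = p := by
    have := hΨ.localInverse_apply_image hL hne
    rwa [hΨp] at this
  have hleft : ∀ᶠ x in 𝓝 p, G (Ψ x) = x := hstrict.eventually_left_inverse
  have hright : ∀ᶠ y in 𝓝 ((0 : ℝ), (0 : T)), Ψ (G y) = y := by
    have := hstrict.eventually_right_inverse
    rw [hΨp] at this
    exact this
  have hin : ContDiff ℝ ∞ (fun t : T => ((0 : ℝ), t)) := contDiff_const.prodMk contDiff_id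
  have hX : ContDiffAt ℝ ∞ (fun t : T => G (0, t)) 0 := hG.comp (0 : T) hin.contDiffAt
  have htend : Tendsto (fun t : T => ((0 : ℝ), t)) (𝓝 0) (𝓝 (0, 0)) := hin.continuous.tendsto 0
  have hr' : ∀ᶠ t in 𝓝 (0 : T), Ψ (G (0, t)) = (0, t) := htend.eventually hright
  refine ⟨fun t => G (0, t), hX, hGp, ?_, ?_, ?_, ?_⟩
  · have hXd := (hX.differentiableAt (by simp)).hasFDerivAt
    have hcomp : HasFDerivAt (fun t : T => Ψ (G (0, t)))
        (((fderiv ℝ f p).prod Q).comp (fderiv ℝ (fun t : T => G (0, t)) 0)) 0 := by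
      refine HasFDerivAt.comp (g := Ψ) (f := fun t : T => G (0, t)) (0 : T) ?_ hXd
      rw [hGp]
      exact hΨd
    have hid : HasFDerivAt (fun t : T => Ψ (G (0, t))) (ContinuousLinearMap.inr ℝ ℝ T) 0 :=
      (ContinuousLinearMap.inr ℝ ℝ T).hasFDerivAt.congr_of_eventuallyEq (by
        filter_upwards [hr'] with t ht
        rw [ht]; simp)
    have heq := hcomp.unique hid
    have : fderiv ℝ (fun t : T => G (0, t)) 0 = T.subtypeL := by
      ext1 t
      set w := fderiv ℝ (fun t : T => G (0, t)) 0 t with hw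
      have h := congrArg (fun M : T →L[ℝ] ℝ × T => M t) heq
      have h1 : fderiv ℝ f p w = 0 := congrArg Prod.fst h
      have h2 : Q w = t := congrArg Prod.snd h
      rw [← inner_gradient_eq_fderiv] at h1
      have h3 : w ∈ T := Submodule.mem_orthogonal_singleton_iff_inner_right.2 h1
      have h4 : Q w = ⟨w, h3⟩ := Submodule.orthogonalProjectionOnto_mem_subspace_eq_self ⟨w, h3⟩
      rw [h2] at h4
      exact (congrArg Subtype.val h4).symm
    rwa [this] at hXd
  · filter_upwards [hr'] with t ht using congrArg Prod.fst ht
  · filter_upwards [hr'] with t ht using congrArg Prod.snd ht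
  · filter_upwards [hleft] with x hx hfx
    have : Ψ x = (0, Q (x - p)) := by simp [Ψ, hfx]
    rw [this] at hx
    exact hx

/-- Since `f` vanishes along `M`, its differential kills tangent directions. Conversely, every `v`
in the kernel is the velocity of the chart curve `s ↦ X (s • v)`. -/
theorem tangentConeAt_levelSet_span {f : E → ℝ} {M U : Set E} {p : E} (hU : U ∈ 𝓝 p)
    (hf : ContDiffAt ℝ ∞ f p) (he : gradient f p ≠ 0) (hp : p ∈ M)
    (hM : M ∩ U = {x ∈ U | f x = 0}) :
    Submodule.span ℝ (tangentConeAt ℝ M p) = (ℝ ∙ gradient f p)ᗮ := by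
  have hpU : p ∈ U := mem_of_mem_nhds hU
  have hfp : f p = 0 := ((Set.ext_iff.1 hM p).1 ⟨hp, hpU⟩).2
  apply le_antisymm
  · rw [Submodule.span_le]
    intro v hv
    have h1 : HasFDerivWithinAt f (fderiv ℝ f p) M p :=
      (hf.differentiableAt (by simp)).hasFDerivAt.hasFDerivWithinAt
    have h2 : HasFDerivWithinAt f (0 : E →L[ℝ] ℝ) M p := by
      refine (hasFDerivWithinAt_const (0 : ℝ) p M).congr_of_eventuallyEq ?_ hfp
      filter_upwards [self_mem_nhdsWithin, mem_nhdsWithin_of_mem_nhds hU] with x hx hxU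
      exact ((Set.ext_iff.1 hM x).1 ⟨hx, hxU⟩).2
    have h3 : fderiv ℝ f p v = 0 := h1.unique_on h2 hv
    rw [← inner_gradient_eq_fderiv] at h3
    exact Submodule.mem_orthogonal_singleton_iff_inner_right.2 h3
  · intro v hv
    apply Submodule.subset_span
    obtain ⟨X, -, hX0, hXd, hXf, -, -⟩ := exists_chart hf hfp he
    set t : (ℝ ∙ gradient f p)ᗮ := ⟨v, hv⟩
    have hc : Tendsto (fun s : ℝ => X (s • t)) (𝓝[≠] 0) (𝓝 p) := by
      have h1 : Tendsto (fun s : ℝ => s • t) (𝓝[≠] 0) (𝓝 0) := by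
        have : Continuous fun s : ℝ => s • t := by fun_prop
        simpa using (this.tendsto 0).mono_left nhdsWithin_le_nhds
      have h2 := hXd.continuousAt.tendsto
      rw [hX0] at h2
      exact h2.comp h1
    have ht0 : Tendsto (fun s : ℝ => s • t) (𝓝[≠] 0) (𝓝 0) := by
      have : Continuous fun s : ℝ => s • t := by fun_prop
      simpa using (this.tendsto 0).mono_left nhdsWithin_le_nhds
    refine mem_tangentConeAt_of_seq (𝓝[≠] (0 : ℝ)) (fun s => s⁻¹) (fun s => X (s • t) - p)
      ?_ ?_ ?_
    · simpa using hc.sub_const p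
    · filter_upwards [ht0.eventually hXf, hc.eventually hU] with s hs hsU
      have : X (s • t) ∈ M ∩ U := by rw [hM]; exact ⟨hsU, hs⟩
      simpa using this.1
    · have h := HasFDerivAt.comp_hasDerivAt (f := fun s : ℝ => s • t) (x := (0 : ℝ)) (l := X)
        (l' := (ℝ ∙ gradient f p)ᗮ.subtypeL) (f' := t) (by simpa using hXd)
        (by simpa using (hasDerivAt_id (0 : ℝ)).smul_const t)
      have h2 := h.tendsto_slope
      refine h2.congr fun s => ?_
      simp [slope_def_module, hX0]

/-- The necessary second-order condition at a local maximum. -/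
theorem deriv_deriv_nonpos_of_isLocalMax {k : ℝ → ℝ} {a : ℝ} (hk : IsLocalMax k a)
    (hc : ContinuousAt k a) : deriv (deriv k) a ≤ 0 := by
  by_contra! h
  -- A positive second derivative would make the local maximum also a local minimum, so `k` would be
  -- locally constant with vanishing second derivative.
  have hmin := isLocalMin_of_deriv_deriv_pos h hk.deriv_eq_zero hc
  have hconst : k =ᶠ[𝓝 a] fun _ => k a := by
    filter_upwards [hk, hmin] with x h1 h2 using le_antisymm h1 h2
  have h0 : deriv (deriv k) a = 0 := by
    rw [hconst.deriv.deriv_eq]; simp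
  exact h.ne' h0

/-- If a level set lies on the negative side of its tangent hyperplane, then the Hessian of the
defining function is nonnegative on the tangent hyperplane. -/
theorem inner_fderiv_gradient_nonneg_of_support {f : E → ℝ} {p : E}
    (hf : ContDiffAt ℝ ∞ f p) (hp : f p = 0) (he : gradient f p ≠ 0)
    (hs : ∀ᶠ x in 𝓝 p, f x = 0 → ⟪gradient f p, x - p⟫ ≤ 0) {v : E}
    (hv : ⟪gradient f p, v⟫ = 0) : 0 ≤ ⟪fderiv ℝ (gradient f) p v, v⟫ := by
  obtain ⟨X, hX, hX0, hXd, hXf, -, -⟩ := exists_chart hf hp he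
  set t : (ℝ ∙ gradient f p)ᗮ :=
    ⟨v, Submodule.mem_orthogonal_singleton_iff_inner_right.2 hv⟩
  have hline : ContDiff ℝ ∞ (fun s : ℝ => s • t) := contDiff_id.smul contDiff_const
  set c : ℝ → E := fun s => X (s • t) with hcdef
  have hc : ContDiffAt ℝ ∞ c 0 :=
    ContDiffAt.comp (0 : ℝ) (by simpa using hX) hline.contDiffAt
  have hc0 : c 0 = p := by simp [hcdef, hX0]
  have hcd0 : HasDerivAt c v 0 := by
    exact HasFDerivAt.comp_hasDerivAt (f := fun s : ℝ => s • t) (x := (0 : ℝ)) (l := X)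
        (l' := (ℝ ∙ gradient f p)ᗮ.subtypeL) (f' := t) (by simpa using hXd)
        (by simpa using (hasDerivAt_id (0 : ℝ)).smul_const t)
  have hcev : ∀ᶠ s in 𝓝 (0 : ℝ), HasDerivAt c (deriv c s) s := by
    filter_upwards [(hc.of_le (m := 1) (by exact_mod_cast le_top)).eventually (by simp)] with s hs
    exact (hs.differentiableAt (by simp)).hasDerivAt
  have hdc : ContDiffAt ℝ ∞ (deriv c) 0 := by
    have h1 : ContDiffAt ℝ ∞ (fderiv ℝ c) 0 := hc.fderiv_right (by simp)
    exact h1.clm_apply contDiffAt_const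
  have hdc' : HasDerivAt (deriv c) (deriv (deriv c) 0) 0 :=
    (hdc.differentiableAt (by simp)).hasDerivAt
  have hctend : Tendsto c (𝓝 0) (𝓝 p) := hc0 ▸ hc.continuousAt.tendsto
  have hfc : ∀ᶠ s in 𝓝 (0 : ℝ), f (c s) = 0 := by
    have : Tendsto (fun s : ℝ => s • t) (𝓝 0) (𝓝 0) := by
      simpa using hline.continuous.tendsto 0
    exact this.eventually hXf
  -- the second derivative of `f ∘ c` vanishes
  have h1 : ∀ᶠ s in 𝓝 (0 : ℝ), ⟪gradient f (c s), deriv c s⟫ = 0 := by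
    have hfd : ∀ᶠ x in 𝓝 p, DifferentiableAt ℝ f x := by
      filter_upwards [(hf.of_le (m := 1) (by exact_mod_cast le_top)).eventually (by simp)] with x hx
      exact hx.differentiableAt (by simp)
    filter_upwards [hfc.eventually_nhds, hcev, hctend.eventually hfd] with s h1 h2 h3
    rw [inner_gradient_eq_fderiv]
    have h4 : HasDerivAt (fun s => f (c s)) (fderiv ℝ f (c s) (deriv c s)) s :=
      h3.hasFDerivAt.comp_hasDerivAt s h2
    have h5 : HasDerivAt (fun s => f (c s)) 0 s :=
      (hasDerivAt_const s (0 : ℝ)).congr_of_eventuallyEq h1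
    exact h4.unique h5
  have hg : HasFDerivAt (gradient f) (fderiv ℝ (gradient f) p) p :=
    ((contDiffAt_gradient hf).differentiableAt (by simp)).hasFDerivAt
  have h2 : HasDerivAt (fun s => ⟪gradient f (c s), deriv c s⟫)
      (⟪gradient f p, deriv (deriv c) 0⟫ + ⟪fderiv ℝ (gradient f) p v, v⟫) 0 := by
    have h3 : HasDerivAt (fun s => gradient f (c s)) (fderiv ℝ (gradient f) p v) 0 := by
      exact HasFDerivAt.comp_hasDerivAt (0 : ℝ) (by rw [hc0]; exact hg) hcd0
    have := h3.inner ℝ hdc'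
    rwa [hc0, hcd0.deriv] at this
  have h3 : ⟪gradient f p, deriv (deriv c) 0⟫ + ⟪fderiv ℝ (gradient f) p v, v⟫ = 0 :=
    h2.unique ((hasDerivAt_const (0 : ℝ) (0 : ℝ)).congr_of_eventuallyEq h1)
  -- the height `⟪∇f p, c - p⟫` has a maximum at `0`
  set k : ℝ → ℝ := fun s => ⟪gradient f p, c s - p⟫ with hk
  have hmax : IsLocalMax k 0 := by
    filter_upwards [hfc, hctend.eventually hs] with s h4 h5
    simpa [hk, hc0] using h5 h4
  have hkd : deriv k =ᶠ[𝓝 0] fun s => ⟪gradient f p, deriv c s⟫ := by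
    filter_upwards [hcev] with s h
    have := (hasDerivAt_const s (gradient f p)).inner ℝ (h.sub_const p)
    exact this.deriv.trans (by simp)
  have hkdd : deriv (deriv k) 0 = ⟪gradient f p, deriv (deriv c) 0⟫ := by
    rw [hkd.deriv_eq]
    have := (hasDerivAt_const (0 : ℝ) (gradient f p)).inner ℝ hdc'
    simpa using this.deriv
  have hkc : ContinuousAt k 0 := by
    have : ContinuousAt c 0 := hc.continuousAt
    fun_prop
  have := deriv_deriv_nonpos_of_isLocalMax hmax hkc
  linarith

end Chart

end AnisoWillmore

namespace AnisoWillmore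

open Filter Topology

/-! ### Adapted defining functions and the anisotropic Weingarten map -/

section Hypersurface

variable {n : ℕ} {F : EuclideanSpace ℝ (Fin n) → ℝ} {M : Set (EuclideanSpace ℝ (Fin n))}
  {ν : EuclideanSpace ℝ (Fin n) → EuclideanSpace ℝ (Fin n)}

local notation "𝔼" => EuclideanSpace ℝ (Fin n)

/-- `f` is a smooth defining function of `M` in the open set `U` whose gradient points in the
direction of the unit normal `ν`. -/
structure IsAdapted (M : Set 𝔼) (ν : 𝔼 → 𝔼) (U : Set 𝔼) (f : 𝔼 → ℝ) : Prop where
  isOpen : IsOpen U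
  contDiffOn : ContDiffOn ℝ ∞ f U
  gradient_ne_zero : ∀ x ∈ U, gradient f x ≠ 0
  inter_eq : M ∩ U = {x ∈ U | f x = 0}
  normal_eq : ∀ x ∈ M ∩ U, ν x = ‖gradient f x‖⁻¹ • gradient f x

theorem IsUnitNormal.neg (hν : IsUnitNormal M ν) : IsUnitNormal M (fun x => -ν x) where
  continuousOn := hν.continuousOn.neg
  norm_eq_one x hx := by rw [norm_neg, hν.norm_eq_one x hx]
  inner_eq_zero x hx v hv := by rw [inner_neg_left, hν.inner_eq_zero x hx v hv, neg_zero]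

theorem IsUnitNormal.ne_zero (hν : IsUnitNormal M ν) {x : 𝔼} (hx : x ∈ M) : ν x ≠ 0 := by
  intro h
  have := hν.norm_eq_one x hx
  rw [h, norm_zero] at this
  exact zero_ne_one this

theorem eq_or_eq_neg_of_inner_eq_zero {a b : 𝔼} (ha : ‖a‖ = 1) (hb : ‖b‖ = 1)
    (h : ∀ v, ⟪b, v⟫ = 0 → ⟪a, v⟫ = 0) : a = b ∨ a = -b := by
  set c := ⟪b, a⟫ with hc
  have h1 : ⟪a, a - c • b⟫ = 0 := h _ (by
    rw [inner_sub_right, inner_smul_right, real_inner_self_eq_norm_sq, hb]; simp [hc])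
  have hcc : c * c = 1 := by
    rw [inner_sub_right, inner_smul_right, real_inner_self_eq_norm_sq, ha, real_inner_comm,
      ← hc] at h1
    linarith
  have h2 : ‖a - c • b‖ ^ 2 = 0 := by
    rw [norm_sub_sq_real, inner_smul_right, real_inner_comm, ← hc, norm_smul, ha, hb]
    rw [mul_one, Real.norm_eq_abs, sq_abs]
    nlinarith
  have h3 : a = c • b := by
    rw [← sub_eq_zero, ← norm_eq_zero]; exact pow_eq_zero_iff two_ne_zero |>.1 h2
  rcases mul_self_eq_one_iff.1 hcc with h | h
  · left; rw [h3, h, one_smul]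
  · right; rw [h3, h, neg_one_smul]

/-- The normalized gradient of any local defining function is `±ν`; the sign, locally constant by
continuity, is absorbed into the function. -/
theorem exists_isAdapted (hM : IsSmoothHypersurface M) (hν : IsUnitNormal M ν) {p : 𝔼}
    (hp : p ∈ M) : ∃ U f, p ∈ U ∧ IsAdapted M ν U f := by
  obtain ⟨U, f, hU, hpU, hf, hdf, hMU⟩ := hM p hp
  have hfx : ∀ x ∈ U, ContDiffAt ℝ ∞ f x := fun x hx => hf.contDiffAt (hU.mem_nhds hx)
  have hg0 : ∀ x ∈ U, gradient f x ≠ 0 := fun x hx => gradient_ne_zero (hdf x hx)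
  set N : 𝔼 → 𝔼 := fun x => ‖gradient f x‖⁻¹ • gradient f x with hN
  have hN1 : ∀ x ∈ U, ‖N x‖ = 1 := fun x hx => by
    rw [hN]; simp only
    rw [norm_smul, norm_inv, norm_norm, inv_mul_cancel₀ (norm_ne_zero_iff.2 (hg0 x hx))]
  have hpm : ∀ x ∈ M ∩ U, ν x = N x ∨ ν x = -N x := by
    intro x hx
    refine eq_or_eq_neg_of_inner_eq_zero (hν.norm_eq_one x hx.1) (hN1 x hx.2) fun v hv => ?_
    refine hν.inner_eq_zero x hx.1 v ?_
    rw [tangentSpace, tangentConeAt_levelSet_span (hU.mem_nhds hx.2) (hfx x hx.2) (hg0 x hx.2)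
      hx.1 hMU, Submodule.mem_orthogonal_singleton_iff_inner_right]
    rw [hN, real_inner_smul_left] at hv
    exact (mul_eq_zero.1 hv).resolve_left (inv_ne_zero (norm_ne_zero_iff.2 (hg0 x hx.2)))
  have hNc : ContinuousOn N U := by
    intro x hx
    have h1 : ContinuousAt (gradient f) x := (contDiffAt_gradient (hfx x hx)).continuousAt
    exact ((h1.norm.inv₀ (norm_ne_zero_iff.2 (hg0 x hx))).smul h1).continuousWithinAt
  -- the sign is locally constant
  have hsign : ∀ s : ℝ, ν p = s • N p → s * s = 1 →
      ∃ V, IsOpen V ∧ p ∈ V ∧ V ⊆ U ∧ ∀ x ∈ M ∩ V, ν x = s • N x := by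
    intro s hs hss
    have hcont : ContinuousWithinAt (fun x => ⟪ν x, s • N x⟫) (M ∩ U) p :=
      ((hν.continuousOn.mono inter_subset_left) p ⟨hp, hpU⟩).inner
        (((hNc.mono inter_subset_right) p ⟨hp, hpU⟩).const_smul s)
    have hpos : 0 < ⟪ν p, s • N p⟫ := by
      rw [← hs, real_inner_self_eq_norm_sq, hν.norm_eq_one p hp]; norm_num
    have hev := hcont.eventually (lt_mem_nhds hpos)
    obtain ⟨V, hV, hpV, hVsub⟩ := mem_nhdsWithin.1 hev
    refine ⟨V ∩ U, hV.inter hU, ⟨hpV, hpU⟩, inter_subset_right, fun x hx => ?_⟩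
    have hx0 : 0 < ⟪ν x, s • N x⟫ := hVsub ⟨hx.2.1, hx.1, hx.2.2⟩
    have hself : ⟪N x, N x⟫ = 1 := by rw [real_inner_self_eq_norm_sq, hN1 x hx.2.2]; norm_num
    rcases mul_self_eq_one_iff.1 hss with h | h <;> rcases hpm x ⟨hx.1, hx.2.2⟩ with h2 | h2
    · rw [h2, h, one_smul]
    · rw [h2, h, one_smul, inner_neg_left, hself] at hx0; linarith
    · rw [h2, h, neg_one_smul, inner_neg_right, hself] at hx0; linarith
    · rw [h2, h, neg_one_smul]
  obtain ⟨s, hs, hss⟩ : ∃ s : ℝ, ν p = s • N p ∧ s * s = 1 := by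
    rcases hpm p ⟨hp, hpU⟩ with h | h
    · exact ⟨1, by rw [h, one_smul], by norm_num⟩
    · exact ⟨-1, by rw [h, neg_one_smul], by norm_num⟩
  obtain ⟨V, hV, hpV, hVU, hVν⟩ := hsign s hs hss
  have hs0 : s ≠ 0 := by rintro rfl; simp at hss
  have hsabs : |s| = 1 := by
    rcases mul_self_eq_one_iff.1 hss with h | h <;> simp [h]
  have hgs : ∀ x ∈ V, gradient (fun x => s * f x) x = s • gradient f x := by
    intro x hx
    refine ext_inner_right ℝ fun v => ?_
    rw [inner_gradient_eq_fderiv, real_inner_smul_left, inner_gradient_eq_fderiv,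
      (((hfx x (hVU hx)).differentiableAt (by simp)).hasFDerivAt.const_mul s).fderiv]
    simp
  refine ⟨V, fun x => s * f x, hpV, hV, contDiffOn_const.mul (hf.mono hVU), fun x hx => ?_, ?_,
    fun x hx => ?_⟩
  · rw [hgs x hx]; exact smul_ne_zero hs0 (hg0 x (hVU hx))
  · ext x
    have := Set.ext_iff.1 hMU x
    simp only [mem_inter_iff, mem_ofPred_eq, mul_eq_zero, hs0, false_or] at this ⊢
    constructor
    · rintro ⟨h1, h2⟩; exact ⟨h2, (this.1 ⟨h1, hVU h2⟩).2⟩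
    · rintro ⟨h1, h2⟩; exact ⟨(this.2 ⟨hVU h1, h2⟩).1, h1⟩
  · rw [hVν x hx, hgs x hx.2, norm_smul, Real.norm_eq_abs, hsabs, one_mul, smul_comm]

namespace IsAdapted

variable {U : Set (EuclideanSpace ℝ (Fin n))} {f : EuclideanSpace ℝ (Fin n) → ℝ}

theorem contDiffAt (h : IsAdapted M ν U f) {x : 𝔼} (hx : x ∈ U) : ContDiffAt ℝ ∞ f x :=
  h.contDiffOn.contDiffAt (h.isOpen.mem_nhds hx)

theorem eq_zero (h : IsAdapted M ν U f) {x : 𝔼} (hxM : x ∈ M) (hx : x ∈ U) : f x = 0 :=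
  ((Set.ext_iff.1 h.inter_eq x).1 ⟨hxM, hx⟩).2

theorem mem_of_eq_zero (h : IsAdapted M ν U f) {x : 𝔼} (hx : x ∈ U) (h0 : f x = 0) : x ∈ M :=
  ((Set.ext_iff.1 h.inter_eq x).2 ⟨hx, h0⟩).1

theorem gradient_eq (h : IsAdapted M ν U f) {x : 𝔼} (hxM : x ∈ M) (hx : x ∈ U) :
    gradient f x = ‖gradient f x‖ • ν x := by
  rw [h.normal_eq x ⟨hxM, hx⟩, smul_smul,
    mul_inv_cancel₀ (norm_ne_zero_iff.2 (h.gradient_ne_zero x hx)), one_smul]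

theorem inner_gradient_eq_zero_iff (h : IsAdapted M ν U f) {x : 𝔼} (hxM : x ∈ M) (hx : x ∈ U)
    {v : 𝔼} : ⟪gradient f x, v⟫ = 0 ↔ ⟪ν x, v⟫ = 0 := by
  rw [h.gradient_eq hxM hx, real_inner_smul_left, mul_eq_zero, norm_eq_zero,
    or_iff_right (h.gradient_ne_zero x hx)]

theorem mem_tangentSpace_iff (h : IsAdapted M ν U f) {x : 𝔼} (hxM : x ∈ M) (hx : x ∈ U) {v : 𝔼} :
    v ∈ tangentSpace M x ↔ ⟪gradient f x, v⟫ = 0 := by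
  rw [tangentSpace, tangentConeAt_levelSet_span (h.isOpen.mem_nhds hx) (h.contDiffAt hx)
    (h.gradient_ne_zero x hx) hxM h.inter_eq, Submodule.mem_orthogonal_singleton_iff_inner_right]

theorem contDiffAt_gradient_gradient (h : IsAdapted M ν U f) (hF : IsMinkowskiNorm F) {x : 𝔼}
    (hx : x ∈ U) : ContDiffAt ℝ ∞ (fun y => gradient F (gradient f y)) x :=
  (contDiffAt_gradient (hF.contDiffAt (h.gradient_ne_zero x hx))).comp x
    (contDiffAt_gradient (h.contDiffAt hx))

/-- Homogeneity of degree zero removes the normalization of the gradient, so `ν_F` extends smoothly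
to an open set and can be differentiated there. -/
theorem anisoNormal_eq (h : IsAdapted M ν U f) (hF : IsMinkowskiNorm F) {x : 𝔼} (hxM : x ∈ M)
    (hx : x ∈ U) : anisoNormal F ν x = gradient F (gradient f x) := by
  rw [anisoNormal, h.normal_eq x ⟨hxM, hx⟩,
    hF.gradient_smul (inv_pos.2 (norm_pos_iff.2 (h.gradient_ne_zero x hx)))
      (h.gradient_ne_zero x hx)]

theorem fderiv_gradient_gradient (h : IsAdapted M ν U f) (hF : IsMinkowskiNorm F) {x : 𝔼}
    (hx : x ∈ U) (v : 𝔼) : fderiv ℝ (fun y => gradient F (gradient f y)) x v =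
      fderiv ℝ (gradient F) (gradient f x) (fderiv ℝ (gradient f) x v) := by
  have h1 := ((contDiffAt_gradient (hF.contDiffAt
    (h.gradient_ne_zero x hx))).differentiableAt (by simp)).hasFDerivAt
  have h2 := ((contDiffAt_gradient (h.contDiffAt hx)).differentiableAt (by simp)).hasFDerivAt
  have h3 : HasFDerivAt (fun y => gradient F (gradient f y)) _ x := h1.comp x h2
  rw [h3.fderiv]; rfl

theorem fderiv_mem_tangentSpace (h : IsAdapted M ν U f) (hF : IsMinkowskiNorm F) {x : 𝔼}
    (hxM : x ∈ M) (hx : x ∈ U) (v : 𝔼) :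
    fderiv ℝ (fun y => gradient F (gradient f y)) x v ∈ tangentSpace M x := by
  rw [h.mem_tangentSpace_iff hxM hx, h.fderiv_gradient_gradient hF hx]
  exact hF.inner_fderiv_gradient_self (h.gradient_ne_zero x hx) _

theorem hasFDerivWithinAt_anisoNormal (h : IsAdapted M ν U f) (hF : IsMinkowskiNorm F) {x : 𝔼}
    (hxM : x ∈ M) (hx : x ∈ U) : HasFDerivWithinAt (anisoNormal F ν)
      (fderiv ℝ (fun y => gradient F (gradient f y)) x) M x := by
  have h1 := ((h.contDiffAt_gradient_gradient hF hx).differentiableAt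
    (by simp)).hasFDerivAt.hasFDerivWithinAt (s := M)
  refine h1.congr_of_eventuallyEq ?_ (h.anisoNormal_eq hF hxM hx)
  filter_upwards [self_mem_nhdsWithin, mem_nhdsWithin_of_mem_nhds (h.isOpen.mem_nhds hx)]
    with y hyM hy using h.anisoNormal_eq hF hyM hy

theorem coe_weingarten (h : IsAdapted M ν U f) (hF : IsMinkowskiNorm F) {x : 𝔼}
    (hxM : x ∈ M) (hx : x ∈ U) (v : tangentSpace M x) :
    (weingarten F M ν x v : 𝔼) = fderiv ℝ (fun y => gradient F (gradient f y)) x v := by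
  have h1 : fderivWithin ℝ (anisoNormal F ν) M x v =
      fderiv ℝ (fun y => gradient F (gradient f y)) x v :=
    fderivWithin_eq_on_tangentSpace (h.hasFDerivWithinAt_anisoNormal hF hxM hx) v.2
  have h2 : weingarten F M ν x v = (tangentSpace M x).orthogonalProjectionOnto
    (fderivWithin ℝ (anisoNormal F ν) M x v) := rfl
  rw [h2, h1]
  exact congrArg Subtype.val (Submodule.orthogonalProjectionOnto_mem_subspace_eq_self
    (⟨_, h.fderiv_mem_tangentSpace hF hxM hx v⟩ : tangentSpace M x))

/-- The derivative maps the whole space into `T_x M`, so its trace is already that of the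
restriction. The ambient trace, free of the varying tangent space, is visibly continuous in `x`. -/
theorem meanCurvature_eq (h : IsAdapted M ν U f) (hF : IsMinkowskiNorm F) {x : 𝔼}
    (hxM : x ∈ M) (hx : x ∈ U) : meanCurvature F M ν x =
      LinearMap.trace ℝ 𝔼 (fderiv ℝ (fun y => gradient F (gradient f y)) x).toLinearMap := by
  rw [← LinearMap.trace_restrict_eq_of_forall_mem (tangentSpace M x) _
    (fun v => h.fderiv_mem_tangentSpace hF hxM hx v), meanCurvature]
  congr 1
  ext1 v
  exact Subtype.ext (h.coe_weingarten hF hxM hx v)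

end IsAdapted

theorem mem_tangentSpace_iff (hM : IsSmoothHypersurface M) (hν : IsUnitNormal M ν) {x v : 𝔼}
    (hx : x ∈ M) : v ∈ tangentSpace M x ↔ ⟪ν x, v⟫ = 0 := by
  obtain ⟨U, f, hxU, h⟩ := exists_isAdapted hM hν hx
  rw [h.mem_tangentSpace_iff hx hxU, h.inner_gradient_eq_zero_iff hx hxU]

theorem finrank_tangentSpace (hM : IsSmoothHypersurface M) (hν : IsUnitNormal M ν) {x : 𝔼}
    (hx : x ∈ M) : Module.finrank ℝ (tangentSpace M x) = n - 1 := by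
  have h1 : tangentSpace M x = (ℝ ∙ ν x)ᗮ := by
    ext v
    rw [mem_tangentSpace_iff hM hν hx, Submodule.mem_orthogonal_singleton_iff_inner_right]
  have h2 := Submodule.finrank_add_finrank_orthogonal (ℝ ∙ ν x)
  rw [finrank_span_singleton (hν.ne_zero hx), finrank_euclideanSpace_fin] at h2
  rw [h1]; omega

theorem continuousOn_anisoNormal (hF : IsMinkowskiNorm F) (hν : IsUnitNormal M ν) :
    ContinuousOn (anisoNormal F ν) M := fun x hx =>
  (contDiffAt_gradient (hF.contDiffAt (hν.ne_zero hx))).continuousAt.comp_continuousWithinAt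
    (hν.continuousOn x hx)

theorem continuousOn_meanCurvature (hF : IsMinkowskiNorm F) (hM : IsSmoothHypersurface M)
    (hν : IsUnitNormal M ν) : ContinuousOn (meanCurvature F M ν) M := by
  intro x hx
  obtain ⟨U, f, hxU, h⟩ := exists_isAdapted hM hν hx
  have h1 : ContinuousAt (fun y => LinearMap.trace ℝ 𝔼
      (fderiv ℝ (fun y => gradient F (gradient f y)) y).toLinearMap) x := by
    have h2 : ContinuousAt (fderiv ℝ (fun y => gradient F (gradient f y))) x :=
      ((h.contDiffAt_gradient_gradient hF hxU).fderiv_right (m := ∞) (by simp)).continuousAt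
    have h3 : Continuous fun L : 𝔼 →L[ℝ] 𝔼 => LinearMap.trace ℝ 𝔼 L.toLinearMap :=
      LinearMap.continuous_of_finiteDimensional
        ((LinearMap.trace ℝ 𝔼) ∘ₗ (ContinuousLinearMap.coeLM ℝ))
    exact h3.continuousAt.comp h2
  refine h1.continuousWithinAt.congr_of_eventuallyEq ?_ (h.meanCurvature_eq hF hx hxU)
  filter_upwards [self_mem_nhdsWithin, mem_nhdsWithin_of_mem_nhds (h.isOpen.mem_nhds hxU)]
    with y hyM hy using h.meanCurvature_eq hF hyM hy

/-- At a point of `M` where a linear function is maximal, the normal is its direction. -/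
theorem normal_eq_or_eq_neg_of_isMaxOn (hM : IsSmoothHypersurface M) (hν : IsUnitNormal M ν)
    {x u : 𝔼} (hx : x ∈ M) (hu : ‖u‖ = 1) (hmax : ∀ y ∈ M, ⟪u, y⟫ ≤ ⟪u, x⟫) :
    ν x = u ∨ ν x = -u := by
  obtain ⟨U, f, hxU, h⟩ := exists_isAdapted hM hν hx
  have key : ∀ v, ⟪ν x, v⟫ = 0 → ⟪u, v⟫ = 0 := by
    intro v hv
    obtain ⟨X, -, hX0, hXd, hXf, -, -⟩ := exists_chart (h.contDiffAt hxU) (h.eq_zero hx hxU)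
      (h.gradient_ne_zero x hxU)
    set t : (ℝ ∙ gradient f x)ᗮ := ⟨v, Submodule.mem_orthogonal_singleton_iff_inner_right.2
      ((h.inner_gradient_eq_zero_iff hx hxU).2 hv)⟩
    have hd : HasFDerivAt (fun t => ⟪u, X t⟫)
        ((innerSL ℝ u).comp (ℝ ∙ gradient f x)ᗮ.subtypeL) 0 :=
      (innerSL ℝ u).hasFDerivAt.comp 0 hXd
    have hloc : IsLocalMax (fun t => ⟪u, X t⟫) 0 := by
      have hXt : Tendsto X (𝓝 0) (𝓝 x) := by
        have := hXd.continuousAt.tendsto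
        rwa [hX0] at this
      filter_upwards [hXf, hXt.eventually (h.isOpen.mem_nhds hxU)] with t h1 h2
      rw [hX0]
      exact hmax _ (h.mem_of_eq_zero h2 h1)
    exact congrArg (fun L : (ℝ ∙ gradient f x)ᗮ →L[ℝ] ℝ => L t) (hloc.hasFDerivAt_eq_zero hd)
  rcases eq_or_eq_neg_of_inner_eq_zero hu (hν.norm_eq_one x hx) key with h | h
  · exact Or.inl h.symm
  · right; rw [h, neg_neg]

/-- At a supporting point with outer normal `ν`, the determinant of the anisotropic Weingarten map
is controlled by its trace, with equality only at umbilical points. -/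
theorem det_weingarten_le (hn : 2 ≤ n) (hF : IsMinkowskiNorm F) (hM : IsSmoothHypersurface M)
    (hν : IsUnitNormal M ν) {x : 𝔼} (hx : x ∈ M) (hs : ∀ y ∈ M, ⟪ν x, y - x⟫ ≤ 0) :
    0 ≤ LinearMap.det (weingarten F M ν x) ∧ 0 ≤ meanCurvature F M ν x ∧
      LinearMap.det (weingarten F M ν x) ≤ (meanCurvature F M ν x / ((n : ℝ) - 1)) ^ (n - 1) ∧
      (LinearMap.det (weingarten F M ν x) = (meanCurvature F M ν x / ((n : ℝ) - 1)) ^ (n - 1) →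
        ∃ c : ℝ, weingarten F M ν x = c • LinearMap.id) := by
  obtain ⟨U, f, hxU, h⟩ := exists_isAdapted hM hν hx
  set e := gradient f x with he
  have he0 : e ≠ 0 := h.gradient_ne_zero x hxU
  set T := tangentSpace M x with hT
  have hTmem : ∀ v, v ∈ T ↔ ⟪e, v⟫ = 0 := fun v => h.mem_tangentSpace_iff hx hxU
  have hAmem : ∀ v, fderiv ℝ (gradient F) e v ∈ T := fun v =>
    (hTmem _).2 (hF.inner_fderiv_gradient_self he0 v)
  -- `A` is the Hessian of `F` at the normal and `B` the compressed Hessian of the defining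
  -- function, a positive multiple of the second fundamental form.
  let A : T →ₗ[ℝ] T := (fderiv ℝ (gradient F) e).toLinearMap.restrict fun v _ => hAmem v
  let B : T →ₗ[ℝ] T := T.orthogonalProjectionOnto.toLinearMap ∘ₗ
    (fderiv ℝ (gradient f) x).toLinearMap ∘ₗ T.subtype
  have hBinner : ∀ v w : T, ⟪B v, w⟫ = ⟪fderiv ℝ (gradient f) x v, (w : 𝔼)⟫ := fun v w =>
    Submodule.inner_orthogonalProjectionOnto_eq_of_mem_right w _
  -- The projection inside `B` costs nothing: the part it discards is a multiple of `e`, which the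
  -- Hessian of `F` at `e` annihilates.
  have hW : weingarten F M ν x = A ∘ₗ B := by
    ext1 v
    apply Subtype.ext
    rw [h.coe_weingarten hF hx hxU, h.fderiv_gradient_gradient hF hxU]
    show _ = fderiv ℝ (gradient F) e (T.orthogonalProjectionOnto (fderiv ℝ (gradient f) x v) : 𝔼)
    set w := fderiv ℝ (gradient f) x v
    have h1 : w - T.starProjection w ∈ Tᗮ := Submodule.sub_starProjection_mem_orthogonal w
    have hTo : Tᗮ = ℝ ∙ e := by
      have : T = (ℝ ∙ e)ᗮ := by
        ext v; rw [hTmem, Submodule.mem_orthogonal_singleton_iff_inner_right]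
      rw [this, Submodule.orthogonal_orthogonal]
    rw [hTo, Submodule.mem_span_singleton] at h1
    obtain ⟨a, ha⟩ := h1
    have h2 := congrArg (fderiv ℝ (gradient F) e) ha
    rw [map_smul, hF.fderiv_gradient_self he0, smul_zero, map_sub] at h2
    exact sub_eq_zero.1 h2.symm
  have hcast : ((n - 1 : ℕ) : ℝ) = (n : ℝ) - 1 := by
    rw [Nat.cast_sub (by omega)]; simp
  have hf2 := h.contDiffAt hxU
  have := det_comp_le_trace_pow (A := A) (B := B) (finrank_tangentSpace hM hν hx) (by omega)
    (fun v w => isSymmetric_fderiv_gradient (hF.contDiffAt he0) v w)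
    (fun v hv => hF.inner_fderiv_gradient_pos he0 (by simpa using hv) ((hTmem _).1 v.2))
    (fun v w => (hBinner v w).trans ((isSymmetric_fderiv_gradient hf2 v w).trans
      ((real_inner_comm _ _).trans ((hBinner w v).symm.trans (real_inner_comm _ _)))))
    (fun v => by
      rw [hBinner]
      refine inner_fderiv_gradient_nonneg_of_support hf2 (h.eq_zero hx hxU) he0 ?_
        ((hTmem _).1 v.2)
      filter_upwards [h.isOpen.mem_nhds hxU] with y hy hy0
      rw [h.gradient_eq hx hxU, real_inner_smul_left]
      exact mul_nonpos_of_nonneg_of_nonpos (norm_nonneg _) (hs y (h.mem_of_eq_zero hy hy0)))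
  rw [← hW, hcast] at this
  exact this

end Hypersurface

end AnisoWillmore

namespace AnisoWillmore

open Filter Topology
open scoped NNReal ENNReal

/-! ### Hausdorff measure under projection to a hyperplane -/

section Projection

theorem euclideanHausdorffMeasure_image_le {X Y : Type*} [EMetricSpace X] [MeasurableSpace X]
    [BorelSpace X] [EMetricSpace Y] [MeasurableSpace Y] [BorelSpace Y] {K : ℝ≥0} {f : X → Y}
    {s : Set X} (h : LipschitzOnWith K f s) (d : ℕ) :
    μHE[d] (f '' s) ≤ (K : ℝ≥0∞) ^ d * μHE[d] s := by
  simp only [Measure.euclideanHausdorffMeasure_def, Measure.smul_apply]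
  have := h.hausdorffMeasure_image_le (d := d) (Nat.cast_nonneg d)
  rw [ENNReal.rpow_natCast] at this
  rw [mul_smul_comm]
  gcongr

variable {E : Type*} [NormedAddCommGroup E] [InnerProductSpace ℝ E] [FiniteDimensional ℝ E]
  [MeasurableSpace E] [BorelSpace E] {T : Submodule ℝ E} {d : ℕ}

/-- Orthogonal projection is 1-Lipschitz; no measurability of `A` is needed. -/
theorem volume_projection_image_le (hd : Module.finrank ℝ T = d) (A : Set E) :
    volume (T.orthogonalProjectionOnto '' A) ≤ μHE[d] A := by
  subst hd
  rw [← InnerProductSpace.euclideanHausdorffMeasure_eq_volume]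
  have h : LipschitzWith 1 T.orthogonalProjectionOnto :=
    T.orthogonalProjectionOnto.lipschitz.weaken T.orthogonalProjectionOnto_norm_le
  simpa using euclideanHausdorffMeasure_image_le (h.lipschitzOnWith (s := A)) _

/-- The cone condition makes the projection injective on `A` with a `K`-Lipschitz inverse. -/
theorem euclideanHausdorffMeasure_le_of_cone (hd : Module.finrank ℝ T = d) {A : Set E} {K : ℝ≥0}
    (hA : ∀ x ∈ A, ∀ y ∈ A, ‖x - y‖ ≤ K * ‖T.orthogonalProjectionOnto (x - y)‖) :
    μHE[d] A ≤ (K : ℝ≥0∞) ^ d * volume (T.orthogonalProjectionOnto '' A) := by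
  subst hd
  rcases A.eq_empty_or_nonempty with rfl | hne
  · simp
  have : Nonempty E := ⟨hne.some⟩
  rw [← InnerProductSpace.euclideanHausdorffMeasure_eq_volume]
  set Q := T.orthogonalProjectionOnto
  have hinj : InjOn Q A := by
    intro x hx y hy hxy
    have := hA x hx y hy
    rw [map_sub, hxy, sub_self, norm_zero, mul_zero] at this
    exact sub_eq_zero.1 (norm_le_zero_iff.1 this)
  have hleft : LeftInvOn (Function.invFunOn Q A) Q A := hinj.leftInvOn_invFunOn
  have himg : Function.invFunOn Q A '' (Q '' A) = A := hleft.image_image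
  have hlip : LipschitzOnWith K (Function.invFunOn Q A) (Q '' A) := by
    refine LipschitzOnWith.of_dist_le_mul ?_
    rintro _ ⟨x, hx, rfl⟩ _ ⟨y, hy, rfl⟩
    rw [hleft hx, hleft hy, dist_eq_norm, dist_eq_norm, ← map_sub]
    exact hA x hx y hy
  calc μHE[Module.finrank ℝ T] A = μHE[Module.finrank ℝ T] (Function.invFunOn Q A '' (Q '' A)) := by
        rw [himg]
    _ ≤ _ := euclideanHausdorffMeasure_image_le hlip _

omit [MeasurableSpace E] [BorelSpace E] in
theorem sub_orthogonalProjection_eq {e : E} (he : ‖e‖ = 1) (hT : ∀ v, v ∈ T ↔ ⟪e, v⟫ = 0) (v : E) :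
    v - (T.orthogonalProjectionOnto v : E) = ⟪e, v⟫ • e := by
  have hTo : T = (ℝ ∙ e)ᗮ := by
    ext v; rw [hT, Submodule.mem_orthogonal_singleton_iff_inner_right]
  have h1 : v - (T.orthogonalProjectionOnto v : E) ∈ ℝ ∙ e := by
    have := Submodule.sub_starProjection_mem_orthogonal (K := T) v
    rwa [hTo, Submodule.orthogonal_orthogonal, ← hTo] at this
  obtain ⟨a, ha⟩ := Submodule.mem_span_singleton.1 h1
  have h2 : ⟪e, (T.orthogonalProjectionOnto v : E)⟫ = 0 := (hT _).1 (Subtype.prop _)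
  have h3 : ⟪e, v⟫ = a := by
    have := congrArg (fun w => ⟪e, w⟫) ha
    simp only [inner_sub_right, h2, inner_smul_right, real_inner_self_eq_norm_sq, he] at this
    linarith
  rw [h3, ha]

omit [MeasurableSpace E] [BorelSpace E] in
theorem norm_le_of_abs_inner_le {e : E} (he : ‖e‖ = 1) (hT : ∀ v, v ∈ T ↔ ⟪e, v⟫ = 0) {v : E}
    {δ : ℝ} (hδ : δ < 1) (h : |⟪e, v⟫| ≤ δ * ‖v‖) :
    ‖v‖ ≤ (1 - δ)⁻¹ * ‖T.orthogonalProjectionOnto v‖ := by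
  have h1 := sub_orthogonalProjection_eq he hT v
  have h2 : ‖v‖ ≤ ‖T.orthogonalProjectionOnto v‖ + |⟪e, v⟫| := by
    calc ‖v‖ = ‖(T.orthogonalProjectionOnto v : E) + ⟪e, v⟫ • e‖ := by rw [← h1]; abel_nf
      _ ≤ ‖(T.orthogonalProjectionOnto v : E)‖ + ‖⟪e, v⟫ • e‖ := norm_add_le _ _
      _ = _ := by rw [norm_smul, he, mul_one, Real.norm_eq_abs]; rfl
  rw [le_inv_mul_iff₀ (by linarith)]
  linarith

omit [FiniteDimensional ℝ E] [MeasurableSpace E] [BorelSpace E] in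
-- This gives the cone condition for a chord `v = x - y` of two support points with normals `u` and
-- `w` close to `e`: each supporting hyperplane bounds one sign of `⟪e, v⟫`.
theorem abs_inner_le_of_monotone {e u w v : E} {δ : ℝ} (hu : ‖e - u‖ ≤ δ) (hw : ‖e - w‖ ≤ δ)
    (h1 : 0 ≤ ⟪u, v⟫) (h2 : ⟪w, v⟫ ≤ 0) : |⟪e, v⟫| ≤ δ * ‖v‖ := by
  have h3 : |⟪e - u, v⟫| ≤ δ * ‖v‖ := (abs_real_inner_le_norm _ _).trans (by gcongr)
  have h4 : |⟪e - w, v⟫| ≤ δ * ‖v‖ := (abs_real_inner_le_norm _ _).trans (by gcongr)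
  rw [inner_sub_left] at h3 h4
  rw [abs_le] at h3 h4 ⊢
  constructor <;> linarith

end Projection

/-! ### Area distortion of the Gauss map, finiteness and positivity of area -/

section Hypersurface

variable {n : ℕ} {F : EuclideanSpace ℝ (Fin n) → ℝ} {M : Set (EuclideanSpace ℝ (Fin n))}
  {ν : EuclideanSpace ℝ (Fin n) → EuclideanSpace ℝ (Fin n)}

local notation "𝔼" => EuclideanSpace ℝ (Fin n)

/-- The points of `M` at which `M` lies on the inner side of its tangent hyperplane. -/
def supportSet (M : Set 𝔼) (ν : 𝔼 → 𝔼) : Set 𝔼 :=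
  {x ∈ M | ∀ y ∈ M, ⟪ν x, y - x⟫ ≤ 0}

theorem supportSet_subset : supportSet M ν ⊆ M := fun _ hx => hx.1

/-- The anisotropic Gauss map stretches the area at support points by at most the determinant of
the anisotropic Weingarten map. -/
theorem exists_nhds_measure_image_le (hF : IsMinkowskiNorm F) (hM : IsSmoothHypersurface M)
    (hν : IsUnitNormal M ν) {p : 𝔼} (hp : p ∈ M) {m : ℝ≥0}
    (hm : ENNReal.ofReal |LinearMap.det (weingarten F M ν p)| < m) :
    ∃ V ∈ 𝓝 p, ∀ A ⊆ supportSet M ν ∩ V,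
      μHE[n - 1] (anisoNormal F ν '' A) ≤ m * μHE[n - 1] A := by
  obtain ⟨U, f, hpU, h⟩ := exists_isAdapted hM hν hp
  set T := tangentSpace M p with hTdef
  have hd : Module.finrank ℝ T = n - 1 := finrank_tangentSpace hM hν hp
  set Q := T.orthogonalProjectionOnto with hQ
  have hT : ∀ v, v ∈ T ↔ ⟪ν p, v⟫ = 0 := fun v => mem_tangentSpace_iff hM hν hp
  have he := hν.norm_eq_one p hp
  let W : T →L[ℝ] T := (weingarten F M ν p).toContinuousLinearMap
  set N : 𝔼 → 𝔼 := fun y => gradient F (gradient f y) with hN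
  set L := fderiv ℝ N p with hL
  have hWL : ∀ v : T, (W v : 𝔼) = L v := h.coe_weingarten hF hp hpU
  obtain ⟨m', hm', hm'm⟩ := ENNReal.lt_iff_exists_nnreal_btwn.1 hm
  have hm'm : m' < m := by exact_mod_cast hm'm
  have hdet : ENNReal.ofReal |W.det| < m' := hm'
  have hev1 := addHaar_image_le_mul_of_det_lt (volume : Measure T) W hdet
  obtain ⟨δ₀, hδ₀pos, hδ₀⟩ : ∃ δ₀ : ℝ≥0, 0 < δ₀ ∧ ∀ (s : Set T) (g : T → T),
      ApproximatesLinearOn g W s δ₀ → volume (g '' s) ≤ m' * volume s := by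
    obtain ⟨δ₀, h1, h2⟩ := (hev1.and self_mem_nhdsWithin).exists
    exact ⟨δ₀, h2, h1⟩
  -- Three demands on the tilt `δ`: chords at most double the length of their projections, the Gauss
  -- map read in `T` stays `δ₀`-close to `W`, and the area factor `(1 - δ)⁻¹ ^ (n - 1)` of the lift
  -- fits between `m'` and `m`.
  obtain ⟨δ, hδpos, hδhalf, hδL, hδm⟩ : ∃ δ : ℝ, 0 < δ ∧ δ < 1 / 2 ∧
      2 * (1 + ‖L‖) * δ ≤ δ₀ ∧ ((1 - δ)⁻¹) ^ (n - 1) * m' ≤ m := by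
    have t1 : Tendsto (fun δ : ℝ => 2 * (1 + ‖L‖) * δ) (𝓝[>] 0) (𝓝 0) := by
      have : Continuous fun δ : ℝ => 2 * (1 + ‖L‖) * δ := by fun_prop
      simpa using (this.tendsto 0).mono_left nhdsWithin_le_nhds
    have t2 : Tendsto (fun δ : ℝ => ((1 - δ)⁻¹) ^ (n - 1) * (m' : ℝ)) (𝓝[>] 0) (𝓝 m') := by
      have : ContinuousAt (fun δ : ℝ => ((1 - δ)⁻¹) ^ (n - 1) * (m' : ℝ)) 0 := by
        refine ContinuousAt.mul (ContinuousAt.pow (ContinuousAt.inv₀ (by fun_prop) (by simp)) _)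
          continuousAt_const
      simpa using this.tendsto.mono_left nhdsWithin_le_nhds
    have hδ₀' : (0 : ℝ) < δ₀ := hδ₀pos
    have hmm : (m' : ℝ) < m := hm'm
    obtain ⟨δ, h1, h2, h3⟩ := ((t1.eventually (gt_mem_nhds hδ₀')).and
      ((t2.eventually (gt_mem_nhds hmm)).and
        (Ioo_mem_nhdsGT (show (0 : ℝ) < 1 / 2 by norm_num)))).exists
    exact ⟨δ, h3.1, h3.2, h1.le, h2.le⟩
  have hstrict : HasStrictFDerivAt N L p :=
    (h.contDiffAt_gradient_gradient hF hpU).hasStrictFDerivAt (by simp)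
  obtain ⟨V₁, hV₁, happ⟩ := hstrict.approximates_deriv_on_nhds (c := ⟨δ, hδpos.le⟩)
    (Or.inr hδpos)
  obtain ⟨V₂, hV₂, hpV₂, hV₂ν⟩ := mem_nhdsWithin.1
    ((hν.continuousOn p hp).eventually (Metric.closedBall_mem_nhds (ν p) hδpos))
  refine ⟨V₁ ∩ (V₂ ∩ U), inter_mem hV₁ (inter_mem (hV₂.mem_nhds hpV₂) (h.isOpen.mem_nhds hpU)),
    fun A hA => ?_⟩
  have hAM : ∀ x ∈ A, x ∈ M := fun x hx => (hA hx).1.1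
  have hAν : ∀ x ∈ A, ‖ν p - ν x‖ ≤ δ := fun x hx => by
    have : ν x ∈ Metric.closedBall (ν p) δ := hV₂ν ⟨(hA hx).2.2.1, hAM x hx⟩
    rwa [mem_closedBall_iff_norm'] at this
  have hδ1 : δ < 1 := by linarith
  have hK0 : 0 ≤ (1 - δ)⁻¹ := inv_nonneg.2 (by linarith)
  have hcone : ∀ x ∈ A, ∀ y ∈ A, |⟪ν p, x - y⟫| ≤ δ * ‖x - y‖ := fun x hx y hy => by
    refine abs_inner_le_of_monotone (hAν x hx) (hAν y hy) ?_ ((hA hy).1.2 x (hAM x hx))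
    have := (hA hx).1.2 y (hAM y hy)
    rw [← neg_sub, inner_neg_right] at this
    linarith
  -- The image points support the Wulff shape with the same normals `ν x` and `ν y`, so the same
  -- cone condition holds for them.
  have hcone' : ∀ x ∈ A, ∀ y ∈ A, |⟪ν p, anisoNormal F ν x - anisoNormal F ν y⟫| ≤
      δ * ‖anisoNormal F ν x - anisoNormal F ν y‖ := fun x hx y hy => by
    have hx0 := hν.ne_zero (hAM x hx)
    have hy0 := hν.ne_zero (hAM y hy)
    have h1 := hF.inner_gradient_le hy0 (ν x)
    have h2 := hF.inner_gradient_le hx0 (ν y)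
    rw [← hF.inner_gradient_self hx0] at h1
    rw [← hF.inner_gradient_self hy0] at h2
    refine abs_inner_le_of_monotone (hAν x hx) (hAν y hy) ?_ ?_
    · rw [real_inner_comm, inner_sub_left]; exact sub_nonneg.2 h1
    · rw [real_inner_comm, inner_sub_left]; exact sub_nonpos.2 h2
  have hnorm : ∀ x ∈ A, ∀ y ∈ A, ‖x - y‖ ≤ (1 - δ)⁻¹ * ‖Q (x - y)‖ := fun x hx y hy =>
    norm_le_of_abs_inner_le he hT hδ1 (hcone x hx y hy)
  rcases A.eq_empty_or_nonempty with rfl | hne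
  · simp
  have hinj : InjOn Q A := by
    intro x hx y hy hxy
    have := hnorm x hx y hy
    rw [map_sub, hxy, sub_self, norm_zero, mul_zero] at this
    exact sub_eq_zero.1 (norm_le_zero_iff.1 this)
  have hleft : LeftInvOn (Function.invFunOn Q A) Q A := hinj.leftInvOn_invFunOn
  -- The Gauss map read in the hyperplane `T`, on the projection of `A`; this makes it a map between
  -- spaces of equal dimension, to which the determinant bound applies.
  set g : T → T := fun t => Q (anisoNormal F ν (Function.invFunOn Q A t)) with hg
  have hgimg : g '' (Q '' A) = Q '' (anisoNormal F ν '' A) := by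
    rw [image_image, image_image]
    refine image_congr fun x hx => ?_
    rw [hg]; simp only; rw [hleft hx]
  have hgapp : ApproximatesLinearOn g W (Q '' A) δ₀ := by
    rintro _ ⟨x, hx, rfl⟩ _ ⟨y, hy, rfl⟩
    have hgx : g (Q x) = Q (N x) := by
      rw [hg]; simp only; rw [hleft hx, h.anisoNormal_eq hF (hAM x hx) (hA hx).2.2.2]
    have hgy : g (Q y) = Q (N y) := by
      rw [hg]; simp only; rw [hleft hy, h.anisoNormal_eq hF (hAM y hy) (hA hy).2.2.2]
    have hN' : ‖N x - N y - L (x - y)‖ ≤ δ * ‖x - y‖ :=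
      happ x (hA hx).2.1 y (hA hy).2.1
    -- `L` agrees with `W` on tangential vectors; the normal part `w - Q w` of a chord is small by
    -- the cone condition.
    have hLQ : ∀ w, Q (L w) = W (Q w) + Q (L (w - Q w)) := by
      intro w
      apply Subtype.ext
      rw [Submodule.coe_add, hWL, map_sub L, map_sub Q, Submodule.coe_sub]
      have h1 : (Q (L (Q w)) : 𝔼) = L (Q w) := congrArg Subtype.val
        (Submodule.orthogonalProjectionOnto_mem_subspace_eq_self
          (⟨_, h.fderiv_mem_tangentSpace hF hp hpU (Q w : 𝔼)⟩ : T))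
      rw [h1]; abel
    have heq : g (Q x) - g (Q y) - W (Q x - Q y) =
        Q (N x - N y - L (x - y)) + Q (L ((x - y) - Q (x - y))) := by
      rw [hgx, hgy, map_sub Q (N x - N y), hLQ (x - y), ← map_sub Q x y, map_sub Q (N x)]
      abel
    have hQ1 : ∀ w, ‖Q w‖ ≤ ‖w‖ := fun w => T.norm_orthogonalProjectionOnto_apply_le w
    rw [heq]
    have hw : ‖x - y‖ ≤ 2 * ‖Q (x - y)‖ := by
      refine (hnorm x hx y hy).trans ?_
      gcongr
      rw [inv_le_comm₀ (by linarith) (by norm_num)]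
      linarith
    calc ‖Q (N x - N y - L (x - y)) + Q (L ((x - y) - Q (x - y)))‖
        ≤ ‖N x - N y - L (x - y)‖ + ‖L ((x - y) - Q (x - y))‖ :=
          (norm_add_le _ _).trans (add_le_add (hQ1 _) (hQ1 _))
      _ ≤ δ * ‖x - y‖ + ‖L‖ * (δ * ‖x - y‖) := by
          refine add_le_add hN' ((L.le_opNorm _).trans ?_)
          gcongr
          rw [sub_orthogonalProjection_eq he hT, norm_smul, he, mul_one]
          exact hcone x hx y hy
      _ = (1 + ‖L‖) * δ * ‖x - y‖ := by ring
      _ ≤ (1 + ‖L‖) * δ * (2 * ‖Q (x - y)‖) := by gcongr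
      _ = 2 * (1 + ‖L‖) * δ * ‖Q x - Q y‖ := by rw [map_sub]; ring
      _ ≤ δ₀ * ‖Q x - Q y‖ := by gcongr
  have hvol := hδ₀ (Q '' A) g hgapp
  rw [hgimg] at hvol
  set K : ℝ≥0 := ⟨(1 - δ)⁻¹, hK0⟩ with hK
  have hKm : (K : ℝ≥0∞) ^ (n - 1) * m' ≤ m := by
    have : K ^ (n - 1) * m' ≤ m := hδm
    exact_mod_cast this
  -- Projecting `A` to `T` does not increase area, `g` stretches it by at most `m'`, and lifting the
  -- image back from `T` costs `K ^ (n - 1)`.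
  calc μHE[n - 1] (anisoNormal F ν '' A)
      ≤ (K : ℝ≥0∞) ^ (n - 1) * volume (Q '' (anisoNormal F ν '' A)) := by
        refine euclideanHausdorffMeasure_le_of_cone hd ?_
        rintro _ ⟨x, hx, rfl⟩ _ ⟨y, hy, rfl⟩
        exact norm_le_of_abs_inner_le he hT hδ1 (hcone' x hx y hy)
    _ ≤ (K : ℝ≥0∞) ^ (n - 1) * (m' * volume (Q '' A)) := by gcongr
    _ ≤ (K : ℝ≥0∞) ^ (n - 1) * (m' * μHE[n - 1] A) := by
        gcongr; exact volume_projection_image_le hd A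
    _ = ((K : ℝ≥0∞) ^ (n - 1) * m') * μHE[n - 1] A := by rw [mul_assoc]
    _ ≤ m * μHE[n - 1] A := by gcongr

theorem exists_nhds_measure_lt_top (hM : IsSmoothHypersurface M) (hν : IsUnitNormal M ν) {p : 𝔼}
    (hp : p ∈ M) : ∃ V ∈ 𝓝 p, μHE[n - 1] (M ∩ V) < ⊤ := by
  obtain ⟨U, f, hpU, h⟩ := exists_isAdapted hM hν hp
  have hd := finrank_tangentSpace hM hν hp
  have hT : ∀ v, v ∈ tangentSpace M p ↔ ⟪ν p, v⟫ = 0 := fun v => mem_tangentSpace_iff hM hν hp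
  have he := hν.norm_eq_one p hp
  have hg0 := norm_pos_iff.2 (h.gradient_ne_zero p hpU)
  have hstrict : HasStrictFDerivAt f (fderiv ℝ f p) p :=
    (h.contDiffAt hpU).hasStrictFDerivAt (by simp)
  -- A tolerance of half the gradient norm becomes, after division by that norm, a cone condition
  -- with slope `1 / 2`, hence a lift with Lipschitz constant `2`.
  obtain ⟨V₁, hV₁, happ⟩ := hstrict.approximates_deriv_on_nhds
    (c := ⟨‖gradient f p‖ / 2, by positivity⟩) (Or.inr (half_pos hg0))
  refine ⟨V₁ ∩ U ∩ Metric.ball p 1, inter_mem (inter_mem hV₁ (h.isOpen.mem_nhds hpU))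
    (Metric.ball_mem_nhds p one_pos), ?_⟩
  set A := M ∩ (V₁ ∩ U ∩ Metric.ball p 1) with hA
  have hcone : ∀ x ∈ A, ∀ y ∈ A, |⟪ν p, x - y⟫| ≤ 1 / 2 * ‖x - y‖ := by
    intro x hx y hy
    have h1 : ‖f x - f y - fderiv ℝ f p (x - y)‖ ≤ ‖gradient f p‖ / 2 * ‖x - y‖ :=
      happ x hx.2.1.1 y hy.2.1.1
    rw [h.eq_zero hx.1 hx.2.1.2, h.eq_zero hy.1 hy.2.1.2, sub_zero, zero_sub, norm_neg,
      ← inner_gradient_eq_fderiv, h.gradient_eq hp hpU, real_inner_smul_left, norm_mul, norm_norm,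
      ← h.gradient_eq hp hpU, Real.norm_eq_abs] at h1
    refine le_of_mul_le_mul_left ?_ hg0
    linarith
  have hle := euclideanHausdorffMeasure_le_of_cone (K := 2) hd (A := A) fun x hx y hy => by
    have := norm_le_of_abs_inner_le he hT (by norm_num) (hcone x hx y hy)
    refine this.trans (le_of_eq ?_)
    norm_num
  refine hle.trans_lt (ENNReal.mul_lt_top (by simp) ?_)
  have hb : Bornology.IsBounded ((tangentSpace M p).orthogonalProjectionOnto '' A) :=
    (tangentSpace M p).orthogonalProjectionOnto.lipschitz.isBounded_image
      (Metric.isBounded_ball.subset fun x hx => hx.2.2)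
  exact hb.measure_lt_top

theorem measure_lt_top (hMc : IsCompact M) (hM : IsSmoothHypersurface M) (hν : IsUnitNormal M ν) :
    μHE[n - 1] M < ⊤ := by
  have := hMc.induction_on (p := fun s => μHE[n - 1] (M ∩ s) < ⊤) (by simp)
    (fun s t hst ht => (measure_mono (inter_subset_inter_right M hst)).trans_lt ht)
    (fun s t hs ht => by
      rw [inter_union_distrib_left]
      exact (measure_union_le _ _).trans_lt (ENNReal.add_lt_top.2 ⟨hs, ht⟩))
    (fun x hx => by
      obtain ⟨V, hV, h⟩ := exists_nhds_measure_lt_top hM hν hx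
      exact ⟨V, mem_nhdsWithin_of_mem_nhds hV, h⟩)
  rwa [inter_self] at this

/-- The chart shows that `M ∩ V` projects onto a neighbourhood in the tangent hyperplane, and
projection does not increase area. -/
theorem measure_inter_nhds_pos (hM : IsSmoothHypersurface M) (hν : IsUnitNormal M ν) {p : 𝔼}
    (hp : p ∈ M) {V : Set 𝔼} (hV : V ∈ 𝓝 p) : 0 < μHE[n - 1] (M ∩ V) := by
  obtain ⟨U, f, hpU, h⟩ := exists_isAdapted hM hν hp
  set T := (ℝ ∙ gradient f p)ᗮ with hT
  obtain ⟨X, -, hX0, hXd, hXf, hXQ, -⟩ := exists_chart (h.contDiffAt hpU) (h.eq_zero hp hpU)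
    (h.gradient_ne_zero p hpU)
  have hTe : tangentSpace M p = T := by
    ext v; rw [h.mem_tangentSpace_iff hp hpU, Submodule.mem_orthogonal_singleton_iff_inner_right]
  have hd : Module.finrank ℝ T = n - 1 := hTe ▸ finrank_tangentSpace hM hν hp
  have hXt : Tendsto X (𝓝 0) (𝓝 p) := by
    have := hXd.continuousAt.tendsto
    rwa [hX0] at this
  have hmem : T.orthogonalProjectionOnto '' (M ∩ V) ∈ 𝓝 (T.orthogonalProjectionOnto p) := by
    have h0 : Tendsto (fun t : T => t - T.orthogonalProjectionOnto p)
        (𝓝 (T.orthogonalProjectionOnto p)) (𝓝 0) := by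
      have : Continuous fun t : T => t - T.orthogonalProjectionOnto p := by fun_prop
      simpa using this.tendsto (T.orthogonalProjectionOnto p)
    filter_upwards [h0.eventually hXf, h0.eventually hXQ, h0.eventually (hXt.eventually hV),
      h0.eventually (hXt.eventually (h.isOpen.mem_nhds hpU))] with t h1 h2 h3 h4
    refine ⟨_, ⟨h.mem_of_eq_zero h4 h1, h3⟩, ?_⟩
    rw [map_sub] at h2
    exact sub_left_injective h2
  exact (Measure.measure_pos_of_mem_nhds volume hmem).trans_le (volume_projection_image_le hd _)

end Hypersurface

end AnisoWillmore

namespace AnisoWillmore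

open Filter Topology
open scoped NNReal ENNReal

/-! ### The Willmore inequality and umbilicity in the equality case -/

section Inequality

variable {n : ℕ} {F : EuclideanSpace ℝ (Fin n) → ℝ} {M : Set (EuclideanSpace ℝ (Fin n))}
  {ν : EuclideanSpace ℝ (Fin n) → EuclideanSpace ℝ (Fin n)}

local notation "𝔼" => EuclideanSpace ℝ (Fin n)

/-- The normalized integrand `(|H_F| / (n - 1)) ^ (n - 1) F(ν)` of the anisotropic Willmore
functional. -/
noncomputable def willmoreDensity (F : 𝔼 → ℝ) (M : Set 𝔼) (ν : 𝔼 → 𝔼) (x : 𝔼) : ℝ :=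
  (|meanCurvature F M ν x| / ((n : ℝ) - 1)) ^ (n - 1) * F (ν x)

/-- The anisotropic area of a subset of the Wulff shape. -/
noncomputable def wulffArea (F : 𝔼 → ℝ) (A : Set 𝔼) : ℝ≥0∞ :=
  ∫⁻ y in A, ENNReal.ofReal (F (wulffNormal F y)) ∂(μHE[n - 1])

/-- The normalized anisotropic Willmore energy of a subset of `M`. -/
noncomputable def willmoreEnergy (F : 𝔼 → ℝ) (M : Set 𝔼) (ν : 𝔼 → 𝔼) (A : Set 𝔼) : ℝ≥0∞ :=
  ∫⁻ x in A, ENNReal.ofReal (willmoreDensity F M ν x) ∂(μHE[n - 1])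

theorem continuousOn_willmoreDensity (hn : 2 ≤ n) (hF : IsMinkowskiNorm F)
    (hM : IsSmoothHypersurface M) (hν : IsUnitNormal M ν) :
    ContinuousOn (willmoreDensity F M ν) M := by
  have h : ((n : ℝ) - 1) ≠ 0 := by
    have : (2 : ℝ) ≤ n := by exact_mod_cast hn
    linarith
  exact (((continuousOn_meanCurvature hF hM hν).abs.div continuousOn_const fun _ _ => h).pow _).mul
    (hF.continuous.comp_continuousOn hν.continuousOn)

theorem willmoreDensity_nonneg (hn : 2 ≤ n) (hF : IsMinkowskiNorm F) (x : 𝔼) :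
    0 ≤ willmoreDensity F M ν x := by
  have : (2 : ℝ) ≤ n := by exact_mod_cast hn
  have h : 0 ≤ (n : ℝ) - 1 := by linarith
  exact mul_nonneg (pow_nonneg (div_nonneg (abs_nonneg _) h) _) (hF.nonneg _)

theorem willmoreDensity_pos (hn : 2 ≤ n) (hF : IsMinkowskiNorm F) (hν : IsUnitNormal M ν) {x : 𝔼}
    (hx : x ∈ M) (h : meanCurvature F M ν x ≠ 0) : 0 < willmoreDensity F M ν x := by
  have h2 : (2 : ℝ) ≤ n := by exact_mod_cast hn
  have h1 : 0 < (n : ℝ) - 1 := by linarith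
  have h3 := hF.pos _ (hν.ne_zero hx)
  have h4 := abs_pos.2 h
  unfold willmoreDensity
  positivity

theorem willmoreDensity_eq_zero (hn : 2 ≤ n) {x : 𝔼} (h : meanCurvature F M ν x = 0) :
    willmoreDensity F M ν x = 0 := by
  rw [willmoreDensity, h, abs_zero, zero_div, zero_pow (by omega), zero_mul]

theorem isClosed_supportSet (hMc : IsCompact M) (hν : IsUnitNormal M ν) :
    IsClosed (supportSet M ν) := by
  have h1 : supportSet M ν = M ∩ ⋂ y ∈ M, (M ∩ (fun x => ⟪ν x, y - x⟫) ⁻¹' Iic 0) := by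
    ext x
    simp only [supportSet, mem_ofPred_eq, mem_inter_iff, mem_iInter, mem_preimage, mem_Iic]
    exact ⟨fun h => ⟨h.1, fun y hy => ⟨h.1, h.2 y hy⟩⟩, fun h => ⟨h.1, fun y hy => (h.2 y hy).2⟩⟩
  rw [h1]
  refine hMc.isClosed.inter (isClosed_biInter fun y _ => ?_)
  exact (hν.continuousOn.inner (continuousOn_const.sub
    continuousOn_id)).preimage_isClosed_of_isClosed hMc.isClosed isClosed_Iic

/-- Evenness of `F` makes `gradient F` odd. The energy is thus insensitive to orientation, and
support points for `-ν` reduce to those for `ν`. -/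
theorem weingarten_neg (hF : IsMinkowskiNorm F) (hM : IsSmoothHypersurface M)
    (hν : IsUnitNormal M ν) {x : 𝔼} (hx : x ∈ M) :
    weingarten F M (fun x => -ν x) x = -weingarten F M ν x := by
  obtain ⟨U, f, hxU, h⟩ := exists_isAdapted hM hν hx
  have h1 : ∀ y ∈ M, anisoNormal F (fun x => -ν x) y = -anisoNormal F ν y := fun y hy =>
    hF.gradient_neg (hν.ne_zero hy)
  have h2 := h.hasFDerivWithinAt_anisoNormal hF hx hxU
  have h3 := h2.neg.congr (f₁ := anisoNormal F (fun x => -ν x)) h1 (h1 x hx)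
  ext1 v
  have h4 := fderivWithin_eq_on_tangentSpace h2 v.2
  have h5 := fderivWithin_eq_on_tangentSpace h3 v.2
  show (tangentSpace M x).orthogonalProjectionOnto _ =
    -(tangentSpace M x).orthogonalProjectionOnto _
  rw [← map_neg]
  congr 1
  exact h5.trans (by rw [← neg_eq_iff_eq_neg.2 (neg_neg _).symm]; exact (congrArg Neg.neg h4).symm)

theorem meanCurvature_neg (hF : IsMinkowskiNorm F) (hM : IsSmoothHypersurface M)
    (hν : IsUnitNormal M ν) {x : 𝔼} (hx : x ∈ M) :
    meanCurvature F M (fun x => -ν x) x = -meanCurvature F M ν x := by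
  rw [meanCurvature, weingarten_neg hF hM hν hx, map_neg, meanCurvature]

theorem willmoreDensity_neg (hF : IsMinkowskiNorm F) (hM : IsSmoothHypersurface M)
    (hν : IsUnitNormal M ν) {x : 𝔼} (hx : x ∈ M) :
    willmoreDensity F M (fun x => -ν x) x = willmoreDensity F M ν x := by
  rw [willmoreDensity, meanCurvature_neg hF hM hν hx, abs_neg, hF.even, willmoreDensity]

theorem willmoreEnergy_neg (hF : IsMinkowskiNorm F) (hM : IsSmoothHypersurface M)
    (hν : IsUnitNormal M ν) {A : Set 𝔼} (hA : MeasurableSet A) (hAM : A ⊆ M) :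
    willmoreEnergy F M (fun x => -ν x) A = willmoreEnergy F M ν A :=
  setLIntegral_congr_fun hA fun x hx => by
    rw [willmoreDensity_neg hF hM hν (hAM hx)]

theorem measurable_wulffDensity (hF : IsMinkowskiNorm F) :
    Measurable fun y => ENNReal.ofReal (F (wulffNormal F y)) :=
  (hF.continuous.measurable.comp (IsMinkowskiNorm.measurable_wulffNormal F)).ennreal_ofReal

theorem wulffArea_le_mul (hF : IsMinkowskiNorm F) {A : Set 𝔼} {c : ℝ≥0∞}
    (h : ∀ y ∈ A, ENNReal.ofReal (F (wulffNormal F y)) ≤ c) :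
    wulffArea F A ≤ c * μHE[n - 1] A := by
  calc wulffArea F A ≤ ∫⁻ _ in A, c ∂(μHE[n - 1]) := by
        refine lintegral_mono_ae ?_
        -- Only the pointwise condition needs to be measurable, not `A`, which in the applications
        -- is an image under the Gauss map.
        rw [ae_restrict_iff (measurableSet_le (measurable_wulffDensity hF) measurable_const)]
        exact Eventually.of_forall h
    _ = c * μHE[n - 1] A := setLIntegral_const A c

theorem wulffArea_union_le (A B : Set 𝔼) : wulffArea F (A ∪ B) ≤ wulffArea F A + wulffArea F B :=
  lintegral_union_le _ A B

theorem wulffArea_mono {A B : Set 𝔼} (h : A ⊆ B) : wulffArea F A ≤ wulffArea F B :=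
  lintegral_mono_set h

theorem mul_le_willmoreEnergy {A : Set 𝔼} (hA : MeasurableSet A) {c : ℝ}
    (h : ∀ x ∈ A, c ≤ willmoreDensity F M ν x) :
    ENNReal.ofReal c * μHE[n - 1] A ≤ willmoreEnergy F M ν A := by
  rw [← setLIntegral_const]
  exact setLIntegral_mono' hA fun x hx => ENNReal.ofReal_le_ofReal (h x hx)

theorem willmoreEnergy_lt_top (hn : 2 ≤ n) (hF : IsMinkowskiNorm F) (hMc : IsCompact M)
    (hM : IsSmoothHypersurface M) (hν : IsUnitNormal M ν) : willmoreEnergy F M ν M < ⊤ := by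
  obtain ⟨C, hC⟩ := (hMc.image_of_continuousOn
    (continuousOn_willmoreDensity hn hF hM hν)).bddAbove
  calc willmoreEnergy F M ν M ≤ ∫⁻ _ in M, ENNReal.ofReal C ∂(μHE[n - 1]) :=
        setLIntegral_mono' hMc.isClosed.measurableSet fun x hx =>
          ENNReal.ofReal_le_ofReal (hC ⟨x, hx, rfl⟩)
    _ = ENNReal.ofReal C * μHE[n - 1] M := setLIntegral_const _ _
    _ < ⊤ := ENNReal.mul_lt_top ENNReal.ofReal_lt_top (measure_lt_top hMc hM hν)

/-- Local comparison of the area of the anisotropic Gauss image with the area of a set of support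
points. -/
theorem exists_nhds_wulffArea_le (hn : 2 ≤ n) (hF : IsMinkowskiNorm F)
    (hM : IsSmoothHypersurface M) (hν : IsUnitNormal M ν) {p : 𝔼} (hp : p ∈ M) {b : ℝ}
    (hb : |LinearMap.det (weingarten F M ν p)| * F (ν p) < b) :
    ∃ V ∈ 𝓝 p, ∀ A ⊆ supportSet M ν ∩ V,
      wulffArea F (anisoNormal F ν '' A) ≤ ENNReal.ofReal b * μHE[n - 1] A := by
  set D := |LinearMap.det (weingarten F M ν p)| with hD
  have hD0 : 0 ≤ D := abs_nonneg _
  have hF0 := hF.pos _ (hν.ne_zero hp)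
  -- The slack below `b` is shared between the area distortion and the variation of `F (ν x)` near
  -- `p`.
  obtain ⟨η, hη, hηb⟩ : ∃ η : ℝ, 0 < η ∧ (D + η) * (F (ν p) + η) < b := by
    have t : Tendsto (fun η : ℝ => (D + η) * (F (ν p) + η)) (𝓝[>] 0) (𝓝 (D * F (ν p))) := by
      have : Continuous fun η : ℝ => (D + η) * (F (ν p) + η) := by fun_prop
      simpa using (this.tendsto 0).mono_left nhdsWithin_le_nhds
    obtain ⟨η, h1, h2⟩ := ((t.eventually (gt_mem_nhds hb)).and self_mem_nhdsWithin).exists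
    exact ⟨η, h2, h1⟩
  obtain ⟨V, hV, hVA⟩ := exists_nhds_measure_image_le hF hM hν hp
    (m := Real.toNNReal (D + η)) (by
      show ENNReal.ofReal D < ENNReal.ofReal (D + η)
      rw [ENNReal.ofReal_lt_ofReal_iff (by linarith)]; linarith)
  have hFc : ContinuousWithinAt (fun x => F (ν x)) M p :=
    (hF.continuous.comp_continuousOn hν.continuousOn) p hp
  obtain ⟨V', hV', hpV', hV'F⟩ := mem_nhdsWithin.1
    (hFc.eventually (gt_mem_nhds (show F (ν p) < F (ν p) + η by linarith)))
  refine ⟨V ∩ V', inter_mem hV (hV'.mem_nhds hpV'), fun A hA => ?_⟩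
  calc wulffArea F (anisoNormal F ν '' A)
      ≤ ENNReal.ofReal (F (ν p) + η) * μHE[n - 1] (anisoNormal F ν '' A) := by
        refine wulffArea_le_mul hF ?_
        rintro _ ⟨x, hx, rfl⟩
        have hxM := (hA hx).1.1
        rw [anisoNormal, hF.wulffNormal_gradient (by omega) (hν.norm_eq_one x hxM)]
        exact ENNReal.ofReal_le_ofReal (le_of_lt (hV'F ⟨(hA hx).2.2, hxM⟩))
    _ ≤ ENNReal.ofReal (F (ν p) + η) * (ENNReal.ofReal (D + η) * μHE[n - 1] A) := by
        gcongr
        exact hVA A fun x hx => ⟨(hA hx).1, (hA hx).2.1⟩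
    _ = ENNReal.ofReal ((D + η) * (F (ν p) + η)) * μHE[n - 1] A := by
        rw [← mul_assoc, mul_comm (D + η), ENNReal.ofReal_mul (by linarith)]
    _ ≤ ENNReal.ofReal b * μHE[n - 1] A := by
        gcongr

theorem abs_det_weingarten_mul_le (hn : 2 ≤ n) (hF : IsMinkowskiNorm F)
    (hM : IsSmoothHypersurface M) (hν : IsUnitNormal M ν) {p : 𝔼} (hp : p ∈ supportSet M ν) :
    |LinearMap.det (weingarten F M ν p)| * F (ν p) ≤ willmoreDensity F M ν p := by
  obtain ⟨h1, h2, h3, -⟩ := det_weingarten_le hn hF hM hν hp.1 hp.2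
  rw [willmoreDensity, abs_of_nonneg h1, abs_of_nonneg h2]
  exact mul_le_mul_of_nonneg_right h3 (hF.nonneg _)

/-- The area of the anisotropic Gauss image of a set of support points is at most its Willmore
energy. -/
theorem wulffArea_image_le (hn : 2 ≤ n) (hF : IsMinkowskiNorm F) (hMc : IsCompact M)
    (hM : IsSmoothHypersurface M) (hν : IsUnitNormal M ν) {A : Set 𝔼} (hA : MeasurableSet A)
    (hAS : A ⊆ supportSet M ν) :
    wulffArea F (anisoNormal F ν '' A) ≤ willmoreEnergy F M ν A := by
  have hMfin := measure_lt_top hMc hM hν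
  -- An error proportional to area adds up correctly over disjoint pieces, so a local estimate
  -- passes to the compact support set.
  have key : ∀ ε : ℝ, 0 < ε → ∀ A ⊆ supportSet M ν, MeasurableSet A →
      wulffArea F (anisoNormal F ν '' A) ≤
        willmoreEnergy F M ν A + ENNReal.ofReal ε * μHE[n - 1] A := by
    intro ε hε
    have hSc : IsCompact (supportSet M ν) :=
      hMc.of_isClosed_subset (isClosed_supportSet hMc hν) supportSet_subset
    -- Quantifying over all measurable `A` inside an open `O` lets the union step split `A` into the
    -- disjoint pieces `A ∩ O` and `A \ O`.
    have hind := hSc.induction_on (p := fun s => ∃ O, IsOpen O ∧ s ⊆ O ∧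
      ∀ A ⊆ supportSet M ν ∩ O, MeasurableSet A → wulffArea F (anisoNormal F ν '' A) ≤
        willmoreEnergy F M ν A + ENNReal.ofReal ε * μHE[n - 1] A) ?_ ?_ ?_ ?_
    · obtain ⟨O, -, hSO, hO⟩ := hind
      exact fun A hA hAm => hO A (subset_inter hA (hA.trans hSO)) hAm
    · refine ⟨∅, isOpen_empty, Subset.rfl, fun A hA _ => ?_⟩
      rw [inter_empty, subset_empty_iff] at hA
      simp [hA, wulffArea]
    · rintro s t hst ⟨O, h1, h2, h3⟩
      exact ⟨O, h1, hst.trans h2, h3⟩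
    · rintro s t ⟨O, h1, h2, h3⟩ ⟨O', h1', h2', h3'⟩
      refine ⟨O ∪ O', h1.union h1', union_subset_union h2 h2', fun A hA hAm => ?_⟩
      have hA1 := h3 (A ∩ O) (fun x hx => ⟨(hA hx.1).1, hx.2⟩) (hAm.inter h1.measurableSet)
      have hA2 := h3' (A \ O) (fun x hx => ⟨(hA hx.1).1, (hA hx.1).2.resolve_left hx.2⟩)
        (hAm.diff h1.measurableSet)
      have e1 : willmoreEnergy F M ν A =
          willmoreEnergy F M ν (A ∩ O) + willmoreEnergy F M ν (A \ O) :=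
        (lintegral_inter_add_sdiff _ A h1.measurableSet).symm
      have e2 := measure_inter_add_sdiff (μ := μHE[n - 1]) A h1.measurableSet
      calc wulffArea F (anisoNormal F ν '' A)
          ≤ wulffArea F (anisoNormal F ν '' (A ∩ O)) +
              wulffArea F (anisoNormal F ν '' (A \ O)) := by
            rw [← inter_union_sdiff A O, image_union]
            simpa using wulffArea_union_le _ _
        _ ≤ _ := add_le_add hA1 hA2
        _ = _ := by rw [e1, ← e2, mul_add]; ring
    · intro p hp
      have hlt : |LinearMap.det (weingarten F M ν p)| * F (ν p) <
          willmoreDensity F M ν p + ε / 2 := by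
        linarith [abs_det_weingarten_mul_le hn hF hM hν hp]
      obtain ⟨V, hV, hVA⟩ := exists_nhds_wulffArea_le hn hF hM hν hp.1 hlt
      obtain ⟨V', hV', hpV', hV'F⟩ := mem_nhdsWithin.1
        ((continuousOn_willmoreDensity hn hF hM hν p hp.1).eventually
          (lt_mem_nhds (show willmoreDensity F M ν p - ε / 2 < willmoreDensity F M ν p by linarith)))
      obtain ⟨V'', hV'', hV''o, hpV''⟩ := mem_nhds_iff.1 (inter_mem hV (hV'.mem_nhds hpV'))
      refine ⟨V'', mem_nhdsWithin_of_mem_nhds (hV''o.mem_nhds hpV''), V'', hV''o, Subset.rfl,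
        fun A hA hAm => ?_⟩
      calc wulffArea F (anisoNormal F ν '' A)
          ≤ ENNReal.ofReal (willmoreDensity F M ν p + ε / 2) * μHE[n - 1] A :=
            hVA A fun x hx => ⟨(hA hx).1, (hV'' (hA hx).2).1⟩
        _ = ∫⁻ _ in A, ENNReal.ofReal (willmoreDensity F M ν p + ε / 2) ∂(μHE[n - 1]) :=
            (setLIntegral_const _ _).symm
        _ ≤ ∫⁻ x in A, (ENNReal.ofReal (willmoreDensity F M ν x) + ENNReal.ofReal ε)
              ∂(μHE[n - 1]) := by
            refine setLIntegral_mono' hAm fun x hx => ?_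
            rw [← ENNReal.ofReal_add (willmoreDensity_nonneg hn hF x) hε.le]
            refine ENNReal.ofReal_le_ofReal ?_
            have : willmoreDensity F M ν p - ε / 2 < willmoreDensity F M ν x :=
              hV'F ⟨(hV'' (hA hx).2).2, (hA hx).1.1⟩
            linarith
        _ = _ := by
            rw [lintegral_add_right _ measurable_const, setLIntegral_const, willmoreEnergy]
  refine ENNReal.le_of_forall_pos_le_add fun ε hε _ => ?_
  set c := (μHE[n - 1] M).toReal with hc
  have hc0 : 0 ≤ c := ENNReal.toReal_nonneg
  have hε' : (0 : ℝ) < ε := hε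
  -- The `+ 1` keeps the denominator positive even if `c = 0`.
  have h1 := key (ε / (c + 1)) (by positivity) A hAS hA
  refine h1.trans ?_
  gcongr
  calc ENNReal.ofReal (ε / (c + 1)) * μHE[n - 1] A
      ≤ ENNReal.ofReal (ε / (c + 1)) * ENNReal.ofReal c := by
        rw [hc, ENNReal.ofReal_toReal hMfin.ne]
        gcongr
        exact hAS.trans supportSet_subset
    _ = ENNReal.ofReal (ε / (c + 1) * c) := (ENNReal.ofReal_mul (by positivity)).symm
    _ ≤ ENNReal.ofReal ε := by
        refine ENNReal.ofReal_le_ofReal ?_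
        rw [div_mul_eq_mul_div, div_le_iff₀ (by positivity)]
        nlinarith
    _ = ε := by simp

theorem exists_isMaxOn_inner (hMc : IsCompact M) (hne : M.Nonempty) (u : 𝔼) :
    ∃ x ∈ M, ∀ y ∈ M, ⟪u, y⟫ ≤ ⟪u, x⟫ :=
  hMc.exists_isMaxOn hne (by fun_prop : Continuous fun x : 𝔼 => ⟪u, x⟫).continuousOn

/-- Every point of the Wulff shape is the anisotropic normal of a support point. -/
theorem wulffShape_subset (hn : 2 ≤ n) (hF : IsMinkowskiNorm F) (hMc : IsCompact M)
    (hne : M.Nonempty) (hM : IsSmoothHypersurface M) (hν : IsUnitNormal M ν) :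
    wulffShape F ⊆ anisoNormal F ν '' supportSet M ν ∪
      anisoNormal F (fun x => -ν x) '' supportSet M (fun x => -ν x) := by
  intro y hy
  obtain ⟨u, hu, rfl⟩ := (hF.mem_wulffShape_iff (by omega)).1 hy
  obtain ⟨x, hx, hmax⟩ := exists_isMaxOn_inner hMc hne u
  have hmax' : ∀ y ∈ M, ⟪u, y - x⟫ ≤ 0 := fun y hy => by
    rw [inner_sub_right]; linarith [hmax y hy]
  rcases normal_eq_or_eq_neg_of_isMaxOn hM hν hx hu hmax with h | h
  · exact Or.inl ⟨x, ⟨hx, by rwa [h]⟩, by rw [anisoNormal, h]⟩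
  · refine Or.inr ⟨x, ⟨hx, ?_⟩, ?_⟩
    · simp only [h, neg_neg]; exact hmax'
    · simp only [anisoNormal, h, neg_neg]

/-- A common point `x` would place `M` in a hyperplane, so `± ν x` would be the normal everywhere.
But where a tangent direction `u ⊥ ν x` is maximal on `M`, the normal is `±u`. -/
theorem disjoint_supportSet (hn : 2 ≤ n) (hMc : IsCompact M) (hM : IsSmoothHypersurface M)
    (hν : IsUnitNormal M ν) : Disjoint (supportSet M ν) (supportSet M (fun x => -ν x)) := by
  rw [Set.disjoint_left]
  intro x hx hx'
  have h0 : ∀ y ∈ M, ⟪ν x, y - x⟫ = 0 := fun y hy => by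
    have h1 := hx.2 y hy
    have h2 := hx'.2 y hy
    rw [inner_neg_left] at h2
    linarith
  obtain ⟨v, hv⟩ : ∃ v : tangentSpace M x, v ≠ 0 := by
    have : 0 < Module.finrank ℝ (tangentSpace M x) := by
      rw [finrank_tangentSpace hM hν hx.1]; omega
    have := Module.finrank_pos_iff.1 this
    exact exists_ne 0
  have hv0 : (v : 𝔼) ≠ 0 := by simpa using hv
  have hvν : ⟪ν x, (v : 𝔼)⟫ = 0 := (mem_tangentSpace_iff hM hν hx.1).1 v.2
  set u := ‖(v : 𝔼)‖⁻¹ • (v : 𝔼) with hu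
  have hu1 : ‖u‖ = 1 := by
    rw [hu, norm_smul, norm_inv, norm_norm, inv_mul_cancel₀ (norm_ne_zero_iff.2 hv0)]
  have huν : ⟪ν x, u⟫ = 0 := by rw [hu, inner_smul_right, hvν, mul_zero]
  obtain ⟨y, hy, hmax⟩ := exists_isMaxOn_inner hMc ⟨x, hx.1⟩ u
  have hν1 := hν.norm_eq_one x hx.1
  have hself : ⟪ν x, ν x⟫ = 1 := by rw [real_inner_self_eq_norm_sq, hν1]; norm_num
  have h1 := normal_eq_or_eq_neg_of_isMaxOn hM hν hy hu1 hmax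
  have h2 := normal_eq_or_eq_neg_of_isMaxOn hM hν hy hν1 fun z hz => by
    have a := h0 z hz
    have b := h0 y hy
    rw [inner_sub_right] at a b
    linarith
  have h3 : ⟪ν x, ν y⟫ = 0 := by
    rcases h1 with h | h <;> rw [h]
    · exact huν
    · rw [inner_neg_right, huν, neg_zero]
  rcases h2 with h | h <;> rw [h] at h3
  · linarith
  · rw [inner_neg_right] at h3; linarith

theorem wulffArea_image_neg_le (hn : 2 ≤ n) (hF : IsMinkowskiNorm F) (hMc : IsCompact M)
    (hM : IsSmoothHypersurface M) (hν : IsUnitNormal M ν) :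
    wulffArea F (anisoNormal F (fun x => -ν x) '' supportSet M (fun x => -ν x)) ≤
      willmoreEnergy F M ν (supportSet M (fun x => -ν x)) := by
  have hm := (isClosed_supportSet hMc hν.neg).measurableSet
  rw [← willmoreEnergy_neg hF hM hν hm supportSet_subset]
  exact wulffArea_image_le hn hF hMc hM hν.neg hm Subset.rfl

theorem willmoreEnergy_union {A B : Set 𝔼} (hB : MeasurableSet B) (h : Disjoint A B) :
    willmoreEnergy F M ν (A ∪ B) = willmoreEnergy F M ν A + willmoreEnergy F M ν B :=
  lintegral_union hB h

theorem willmoreEnergy_mono {A B : Set 𝔼} (h : A ⊆ B) :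
    willmoreEnergy F M ν A ≤ willmoreEnergy F M ν B :=
  lintegral_mono_set h

/-- The anisotropic Willmore inequality, localized to the support points. -/
theorem wulffArea_wulffShape_le_supportSet (hn : 2 ≤ n) (hF : IsMinkowskiNorm F)
    (hMc : IsCompact M) (hne : M.Nonempty) (hM : IsSmoothHypersurface M) (hν : IsUnitNormal M ν) :
    wulffArea F (wulffShape F) ≤
      willmoreEnergy F M ν (supportSet M ν ∪ supportSet M (fun x => -ν x)) := by
  have hm := (isClosed_supportSet hMc hν).measurableSet
  have hm' := (isClosed_supportSet hMc hν.neg).measurableSet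
  rw [willmoreEnergy_union hm' (disjoint_supportSet hn hMc hM hν)]
  calc _ ≤ _ := wulffArea_mono (wulffShape_subset hn hF hMc hne hM hν)
    _ ≤ _ := wulffArea_union_le _ _
    _ ≤ _ := add_le_add (wulffArea_image_le hn hF hMc hM hν hm Subset.rfl)
      (wulffArea_image_neg_le hn hF hMc hM hν)

theorem wulffArea_wulffShape_le (hn : 2 ≤ n) (hF : IsMinkowskiNorm F) (hMc : IsCompact M)
    (hne : M.Nonempty) (hM : IsSmoothHypersurface M) (hν : IsUnitNormal M ν) :
    wulffArea F (wulffShape F) ≤ willmoreEnergy F M ν M :=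
  (wulffArea_wulffShape_le_supportSet hn hF hMc hne hM hν).trans
    (willmoreEnergy_mono (union_subset supportSet_subset supportSet_subset))

/-- If a set of positive energy can be removed without violating the upper bound for the area of
the Wulff shape, then the Willmore inequality is strict. -/
theorem willmoreEnergy_lt_of_forall_pos {A B : Set 𝔼} (hB : MeasurableSet B) (hAB : Disjoint A B)
    (hABM : A ∪ B ⊆ M) (hfin : willmoreEnergy F M ν M < ⊤) (hpos : 0 < willmoreEnergy F M ν B) :
    willmoreEnergy F M ν A < willmoreEnergy F M ν M := by
  have hA : willmoreEnergy F M ν A ≠ ⊤ :=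
    ((willmoreEnergy_mono (subset_union_left.trans hABM)).trans_lt hfin).ne
  calc willmoreEnergy F M ν A < willmoreEnergy F M ν A + willmoreEnergy F M ν B :=
        ENNReal.lt_add_right hA hpos.ne'
    _ = willmoreEnergy F M ν (A ∪ B) := (willmoreEnergy_union hB hAB).symm
    _ ≤ _ := willmoreEnergy_mono hABM

theorem willmoreEnergy_inter_nhds_pos (hn : 2 ≤ n) (hF : IsMinkowskiNorm F) (hMc : IsCompact M)
    (hM : IsSmoothHypersurface M) (hν : IsUnitNormal M ν) {p : 𝔼} (hp : p ∈ M)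
    (hH : meanCurvature F M ν p ≠ 0) {V : Set 𝔼} (hV : V ∈ 𝓝 p) :
    0 < willmoreEnergy F M ν (M ∩ V) := by
  have hpos := willmoreDensity_pos hn hF hν hp hH
  obtain ⟨V', hV', hpV', hV'F⟩ := mem_nhdsWithin.1
    ((continuousOn_willmoreDensity hn hF hM hν p hp).eventually (lt_mem_nhds (half_lt_self hpos)))
  obtain ⟨V'', hV'', hV''o, hpV''⟩ := mem_nhds_iff.1 (inter_mem hV (hV'.mem_nhds hpV'))
  have h1 : 0 < μHE[n - 1] (M ∩ V'') := measure_inter_nhds_pos hM hν hp (hV''o.mem_nhds hpV'')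
  calc 0 < ENNReal.ofReal (willmoreDensity F M ν p / 2) * μHE[n - 1] (M ∩ V'') :=
        ENNReal.mul_pos (ENNReal.ofReal_pos.2 (by linarith)).ne' h1.ne'
    _ ≤ willmoreEnergy F M ν (M ∩ V'') :=
        mul_le_willmoreEnergy (hMc.isClosed.measurableSet.inter hV''o.measurableSet)
          fun x hx => le_of_lt (hV'F ⟨(hV'' hx.2).2, hx.1⟩)
    _ ≤ _ := willmoreEnergy_mono (inter_subset_inter_right M fun x hx => (hV'' hx).1)

/-- The support points alone already account for the Wulff area, so no energy is left for a
neighbourhood of a non-support point with nonzero curvature. -/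
theorem mem_supportSet_of_energy_le (hn : 2 ≤ n) (hF : IsMinkowskiNorm F) (hMc : IsCompact M)
    (hM : IsSmoothHypersurface M) (hν : IsUnitNormal M ν)
    (hE : willmoreEnergy F M ν M ≤ wulffArea F (wulffShape F)) {p : 𝔼} (hp : p ∈ M)
    (hH : meanCurvature F M ν p ≠ 0) : p ∈ supportSet M ν ∪ supportSet M (fun x => -ν x) := by
  by_contra hcon
  have hcl : IsClosed (supportSet M ν ∪ supportSet M (fun x => -ν x)) :=
    (isClosed_supportSet hMc hν).union (isClosed_supportSet hMc hν.neg)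
  have hpos := willmoreEnergy_inter_nhds_pos hn hF hMc hM hν hp hH (hcl.isOpen_compl.mem_nhds hcon)
  have h1 := willmoreEnergy_lt_of_forall_pos
    (hMc.isClosed.measurableSet.inter hcl.isOpen_compl.measurableSet)
    (disjoint_compl_right.mono_right inter_subset_right)
    (union_subset (union_subset supportSet_subset supportSet_subset) inter_subset_left)
    (willmoreEnergy_lt_top hn hF hMc hM hν) hpos
  exact (hE.trans (wulffArea_wulffShape_le_supportSet hn hF hMc ⟨p, hp⟩ hM hν)).not_gt h1

/-- Without umbilicity the mean inequality is strict at `p`, hence by a definite margin nearby. The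
Gauss image of a neighbourhood then has less area than that neighbourhood has energy, and the total
inequality becomes strict. -/
theorem weingarten_eq_smul_of_energy_le_of_mem (hn : 2 ≤ n) (hF : IsMinkowskiNorm F)
    (hMc : IsCompact M) (hM : IsSmoothHypersurface M) (hν : IsUnitNormal M ν)
    (hE : willmoreEnergy F M ν M ≤ wulffArea F (wulffShape F)) {p : 𝔼} (hp : p ∈ supportSet M ν)
    (hH : meanCurvature F M ν p ≠ 0) : ∃ c : ℝ, weingarten F M ν p = c • LinearMap.id := by
  obtain ⟨h1, h2, h3, h4⟩ := det_weingarten_le hn hF hM hν hp.1 hp.2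
  by_contra hcon
  have hlt : |LinearMap.det (weingarten F M ν p)| * F (ν p) < willmoreDensity F M ν p := by
    rw [willmoreDensity, abs_of_nonneg h1, abs_of_nonneg h2]
    exact mul_lt_mul_of_pos_right (lt_of_le_of_ne h3 fun h => hcon (h4 h))
      (hF.pos _ (hν.ne_zero hp.1))
  -- Two intermediate values: `b` bounds the area distortion near `p` from above, `b'` bounds the
  -- density from below, and the gap `b < b'` survives integration.
  obtain ⟨b, hb1, hb2⟩ := exists_between hlt
  obtain ⟨b', hb'1, hb'2⟩ := exists_between hb2
  have hb0 : 0 ≤ b := (mul_nonneg (abs_nonneg _) (hF.nonneg _)).trans hb1.le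
  obtain ⟨V₁, hV₁, hV₁A⟩ := exists_nhds_wulffArea_le hn hF hM hν hp.1 hb1
  obtain ⟨V₂, hV₂, hpV₂, hV₂F⟩ := mem_nhdsWithin.1
    ((continuousOn_willmoreDensity hn hF hM hν p hp.1).eventually (lt_mem_nhds hb'2))
  obtain ⟨V₃, hV₃, hpV₃, hV₃H⟩ := mem_nhdsWithin.1
    ((continuousOn_meanCurvature hF hM hν p hp.1).eventually_ne hH)
  have hcl' := isClosed_supportSet hMc hν.neg
  have hpS' : p ∈ (supportSet M (fun x => -ν x))ᶜ :=
    fun h => (Set.disjoint_left.1 (disjoint_supportSet hn hMc hM hν)) hp h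
  obtain ⟨V, hV, hVo, hpV⟩ := mem_nhds_iff.1 (inter_mem (inter_mem hV₁ (hV₂.mem_nhds hpV₂))
    (inter_mem (hV₃.mem_nhds hpV₃) (hcl'.isOpen_compl.mem_nhds hpS')))
  set S := supportSet M ν with hS
  set S' := supportSet M (fun x => -ν x) with hS'
  -- Near `p` every point of `M` has nonzero curvature and so is a support point; this gives `S ∩ V`
  -- positive area.
  have hMV : M ∩ V = S ∩ V := by
    refine Subset.antisymm (fun x hx => ⟨?_, hx.2⟩) (inter_subset_inter_left V supportSet_subset)
    exact (mem_supportSet_of_energy_le hn hF hMc hM hν hE hx.1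
      (hV₃H ⟨(hV hx.2).2.1, hx.1⟩)).resolve_right (hV hx.2).2.2
  have hSm : MeasurableSet S := (isClosed_supportSet hMc hν).measurableSet
  have hAm : MeasurableSet (S ∩ V) := hSm.inter hVo.measurableSet
  have hμpos : 0 < μHE[n - 1] (S ∩ V) :=
    hMV ▸ measure_inter_nhds_pos hM hν hp.1 (hVo.mem_nhds hpV)
  have hμfin : μHE[n - 1] (S ∩ V) ≠ ⊤ :=
    ((measure_mono (inter_subset_left.trans supportSet_subset)).trans_lt
      (measure_lt_top hMc hM hν)).ne
  have hstep : wulffArea F (anisoNormal F ν '' (S ∩ V)) < willmoreEnergy F M ν (S ∩ V) := by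
    calc _ ≤ ENNReal.ofReal b * μHE[n - 1] (S ∩ V) :=
          hV₁A _ (inter_subset_inter_right S fun x hx => (hV hx).1.1)
      _ < ENNReal.ofReal b' * μHE[n - 1] (S ∩ V) := by
          refine ENNReal.mul_lt_mul_left hμpos.ne' hμfin ?_
          rw [ENNReal.ofReal_lt_ofReal_iff (by linarith)]
          exact hb'1
      _ ≤ _ := mul_le_willmoreEnergy hAm fun x hx =>
          le_of_lt (hV₂F ⟨(hV hx.2).1.2, hx.1.1⟩)
  have hrest := wulffArea_image_le hn hF hMc hM hν (hSm.diff hVo.measurableSet)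
    (sdiff_subset : S \ V ⊆ S)
  have hneg := wulffArea_image_neg_le hn hF hMc hM hν
  have hfin := willmoreEnergy_lt_top hn hF hMc hM hν
  have hfinA : ∀ A ⊆ M, willmoreEnergy F M ν A ≠ ⊤ := fun A hA =>
    ((willmoreEnergy_mono hA).trans_lt hfin).ne
  have htot : wulffArea F (wulffShape F) < willmoreEnergy F M ν M := by
    calc wulffArea F (wulffShape F) ≤ wulffArea F (anisoNormal F ν '' (S ∩ V) ∪
          anisoNormal F ν '' (S \ V) ∪ anisoNormal F (fun x => -ν x) '' S') := by
          rw [← image_union, inter_union_sdiff]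
          exact wulffArea_mono (wulffShape_subset hn hF hMc ⟨p, hp.1⟩ hM hν)
      _ ≤ wulffArea F (anisoNormal F ν '' (S ∩ V)) + wulffArea F (anisoNormal F ν '' (S \ V)) +
          wulffArea F (anisoNormal F (fun x => -ν x) '' S') :=
          (wulffArea_union_le _ _).trans (by gcongr; exact wulffArea_union_le _ _)
      _ ≤ wulffArea F (anisoNormal F ν '' (S ∩ V)) + willmoreEnergy F M ν (S \ V) +
          willmoreEnergy F M ν S' := by gcongr
      _ < willmoreEnergy F M ν (S ∩ V) + willmoreEnergy F M ν (S \ V) +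
          willmoreEnergy F M ν S' := by
          refine ENNReal.add_lt_add_right (hfinA _ supportSet_subset) ?_
          exact ENNReal.add_lt_add_right (hfinA _ (sdiff_subset.trans supportSet_subset)) hstep
      _ = willmoreEnergy F M ν (S ∪ S') := by
          rw [willmoreEnergy_union hcl'.measurableSet (disjoint_supportSet hn hMc hM hν)]
          congr 1
          exact lintegral_inter_add_sdiff _ S hVo.measurableSet
      _ ≤ willmoreEnergy F M ν M :=
          willmoreEnergy_mono (union_subset supportSet_subset supportSet_subset)
  exact hE.not_gt htot

/-- A hypersurface of minimal energy is anisotropically umbilical where its anisotropic mean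
curvature does not vanish. -/
theorem weingarten_eq_smul_of_energy_le (hn : 2 ≤ n) (hF : IsMinkowskiNorm F)
    (hMc : IsCompact M) (hM : IsSmoothHypersurface M) (hν : IsUnitNormal M ν)
    (hE : willmoreEnergy F M ν M ≤ wulffArea F (wulffShape F)) {p : 𝔼} (hp : p ∈ M)
    (hH : meanCurvature F M ν p ≠ 0) : ∃ c : ℝ, weingarten F M ν p = c • LinearMap.id := by
  rcases mem_supportSet_of_energy_le hn hF hMc hM hν hE hp hH with h | h
  · exact weingarten_eq_smul_of_energy_le_of_mem hn hF hMc hM hν hE h hH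
  · obtain ⟨c, hc⟩ := weingarten_eq_smul_of_energy_le_of_mem hn hF hMc hM hν.neg
      (by rwa [willmoreEnergy_neg hF hM hν hMc.isClosed.measurableSet Subset.rfl]) h
      (by rw [meanCurvature_neg hF hM hν hp]; exact neg_ne_zero.2 hH)
    rw [weingarten_neg hF hM hν hp] at hc
    exact ⟨-c, (neg_eq_iff_eq_neg.1 hc).trans (neg_smul c (LinearMap.id : tangentSpace M p →ₗ[ℝ] _)).symm⟩

end Inequality

end AnisoWillmore

namespace AnisoWillmore

open Filter Topology
open scoped NNReal ENNReal

/-! ### Local rigidity of umbilical hypersurfaces -/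

section Umbilic

/-- A `C²` map of a space of dimension at least two whose differential is a multiple of the identity
at every point of a ball has constant stretch factor there. -/
theorem stretch_const_of_fderiv_eq_smul_id {T : Type*} [NormedAddCommGroup T]
    [InnerProductSpace ℝ T] [FiniteDimensional ℝ T] (hT : 2 ≤ Module.finrank ℝ T) {g : T → T}
    {l : T → ℝ} {r : ℝ} (hg : ∀ t ∈ Metric.ball (0 : T) r, ContDiffAt ℝ 2 g t)
    (hl : ∀ t ∈ Metric.ball (0 : T) r, fderiv ℝ g t = l t • ContinuousLinearMap.id ℝ T) :
    ∀ t ∈ Metric.ball (0 : T) r, l t = l 0 := by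
  have : Nontrivial T := Module.finrank_pos_iff.1 (by omega : 0 < Module.finrank ℝ T)
  obtain ⟨e, he⟩ := exists_ne (0 : T)
  have hee : ⟪e, e⟫ ≠ 0 := inner_self_ne_zero.2 he
  have hB : IsOpen (Metric.ball (0 : T) r) := Metric.isOpen_ball
  have hld : ∀ t ∈ Metric.ball (0 : T) r, DifferentiableAt ℝ l t := by
    intro t ht
    have h1 : DifferentiableAt ℝ (fun s => fderiv ℝ g s) t :=
      ((hg t ht).fderiv_right (m := 1) (by norm_num)).differentiableAt (by simp)
    -- This expression recovers `l` from the differential of `g`, so `l` inherits differentiability.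
    have h2 : DifferentiableAt ℝ (fun s => ⟪fderiv ℝ g s e, e⟫ * ⟪e, e⟫⁻¹) t :=
      ((h1.clm_apply (differentiableAt_const e)).inner ℝ (differentiableAt_const e)).mul_const _
    refine h2.congr_of_eventuallyEq ?_
    filter_upwards [hB.mem_nhds ht] with s hs
    rw [hl s hs]
    simp only [_root_.smul_apply, ContinuousLinearMap.id_apply, real_inner_smul_left]
    field_simp
  have hl0 : ∀ t ∈ Metric.ball (0 : T) r, fderiv ℝ l t = 0 := by
    intro t ht
    have h1 : HasFDerivAt (fderiv ℝ g)
        ((fderiv ℝ l t).smulRight (ContinuousLinearMap.id ℝ T)) t := by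
      refine ((hld t ht).hasFDerivAt.smul_const (ContinuousLinearMap.id ℝ T)).congr_of_eventuallyEq
        ?_
      filter_upwards [hB.mem_nhds ht] with s hs using hl s hs
    -- Symmetry of the second derivative of `g`. Pairing with a nonzero `w ⊥ u`, which exists in
    -- dimension at least two, leaves `dl(u) = 0`.
    have hsymm : ∀ u w : T, fderiv ℝ l t u • w = fderiv ℝ l t w • u := by
      intro u w
      have h2 := (hg t ht).isSymmSndFDerivAt (by simp) u w
      rw [h1.fderiv] at h2
      simpa using h2
    ext u
    by_cases hu : u = 0
    · simp [hu]
    obtain ⟨w, hw⟩ : ∃ w : (ℝ ∙ u)ᗮ, w ≠ 0 := by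
      have h3 := Submodule.finrank_add_finrank_orthogonal (ℝ ∙ u)
      rw [finrank_span_singleton hu] at h3
      have := Module.finrank_pos_iff.1 (by omega : 0 < Module.finrank ℝ (ℝ ∙ u)ᗮ)
      exact exists_ne 0
    have huw : ⟪u, (w : T)⟫ = 0 := Submodule.mem_orthogonal_singleton_iff_inner_right.1 w.2
    have hww : ⟪(w : T), (w : T)⟫ ≠ 0 := inner_self_ne_zero.2 (by simpa using hw)
    have h4 := congrArg (fun z => ⟪z, (w : T)⟫) (hsymm u w)
    simp only [real_inner_smul_left, huw, mul_zero] at h4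
    exact (mul_eq_zero.1 h4).resolve_right hww
  intro t ht
  have h0 : (0 : T) ∈ Metric.ball (0 : T) r :=
    Metric.mem_ball_self (Metric.pos_of_mem_ball ht)
  exact hB.is_const_of_fderiv_eq_zero (convex_ball 0 r).isPreconnected
    (fun s hs => (hld s hs).differentiableWithinAt) hl0 ht h0

variable {n : ℕ} {F : EuclideanSpace ℝ (Fin n) → ℝ} {M : Set (EuclideanSpace ℝ (Fin n))}
  {ν : EuclideanSpace ℝ (Fin n) → EuclideanSpace ℝ (Fin n)}

local notation "𝔼" => EuclideanSpace ℝ (Fin n)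

theorem meanCurvature_of_weingarten_eq_smul (hn : 2 ≤ n) (hM : IsSmoothHypersurface M)
    (hν : IsUnitNormal M ν) {x : 𝔼} (hx : x ∈ M) {c : ℝ}
    (h : weingarten F M ν x = c • LinearMap.id) : meanCurvature F M ν x = c * ((n : ℝ) - 1) := by
  have h1 : meanCurvature F M ν x =
      LinearMap.trace ℝ (tangentSpace M x) (c • LinearMap.id) := congrArg _ h
  rw [h1, map_smul, LinearMap.trace_id, finrank_tangentSpace hM hν hx, smul_eq_mul,
    Nat.cast_sub (by omega), Nat.cast_one]

/-- Near an umbilical region the mean curvature and the center are locally constant. -/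
theorem eventually_center_eq (hn : 3 ≤ n) (hF : IsMinkowskiNorm F)
    (hM : IsSmoothHypersurface M) (hν : IsUnitNormal M ν) {p : 𝔼} (hp : p ∈ M)
    (humb : ∀ᶠ x in 𝓝 p, x ∈ M → ∃ c : ℝ, weingarten F M ν x = c • LinearMap.id) :
    ∀ᶠ x in 𝓝 p, x ∈ M → meanCurvature F M ν x = meanCurvature F M ν p ∧
      anisoNormal F ν x - (meanCurvature F M ν p / ((n : ℝ) - 1)) • x =
        anisoNormal F ν p - (meanCurvature F M ν p / ((n : ℝ) - 1)) • p := by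
  have hn1 : (n : ℝ) - 1 ≠ 0 := by
    have : (3 : ℝ) ≤ n := by exact_mod_cast hn
    linarith
  obtain ⟨U, f, hpU, h⟩ := exists_isAdapted hM hν hp
  set N : 𝔼 → 𝔼 := fun y => gradient F (gradient f y) with hN
  set lam : 𝔼 → ℝ := fun x => meanCurvature F M ν x / ((n : ℝ) - 1) with hlam
  set T := (ℝ ∙ gradient f p)ᗮ with hT
  set Q := T.orthogonalProjectionOnto with hQ
  obtain ⟨X, hX, hX0, hXd, hXf, hXQ, hXx⟩ := exists_chart (h.contDiffAt hpU) (h.eq_zero hp hpU)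
    (h.gradient_ne_zero p hpU)
  have hTfin : 2 ≤ Module.finrank ℝ T := by
    have hTe : tangentSpace M p = T := by
      ext v; rw [h.mem_tangentSpace_iff hp hpU, Submodule.mem_orthogonal_singleton_iff_inner_right]
    rw [← hTe, finrank_tangentSpace hM hν hp]; omega
  have hXt : Tendsto X (𝓝 0) (𝓝 p) := by
    have := hXd.continuousAt.tendsto
    rwa [hX0] at this
  have hX2 : ∀ᶠ t in 𝓝 (0 : T), ContDiffAt ℝ 2 X t :=
    (hX.of_le (m := 2) ENat.LEInfty.out).eventually (by simp)
  obtain ⟨r, hr, hball⟩ := Metric.eventually_nhds_iff_ball.1 (hX2.and (hXf.and (hXQ.and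
    ((hXt.eventually (h.isOpen.mem_nhds hpU)).and (hXt.eventually humb)))))
  set B := Metric.ball (0 : T) r with hB
  have hBo : IsOpen B := Metric.isOpen_ball
  have h0B : (0 : T) ∈ B := Metric.mem_ball_self hr
  have hXM : ∀ t ∈ B, X t ∈ M := fun t ht =>
    h.mem_of_eq_zero (hball t ht).2.2.2.1 (hball t ht).2.1
  have hXderiv : ∀ t ∈ B, HasFDerivAt X (fderiv ℝ X t) t := fun t ht =>
    ((hball t ht).1.differentiableAt (by simp)).hasFDerivAt
  have hN2 : ∀ t ∈ B, ContDiffAt ℝ ∞ N (X t) := fun t ht =>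
    h.contDiffAt_gradient_gradient hF (hball t ht).2.2.2.1
  have hNderiv : ∀ t ∈ B, HasFDerivAt N (fderiv ℝ N (X t)) (X t) := fun t ht =>
    ((hN2 t ht).differentiableAt (by simp)).hasFDerivAt
  have hXtan : ∀ t ∈ B, ∀ u, fderiv ℝ X t u ∈ tangentSpace M (X t) := by
    intro t ht u
    have hU := (hball t ht).2.2.2.1
    rw [h.mem_tangentSpace_iff (hXM t ht) hU, inner_gradient_eq_fderiv]
    have h1 : HasFDerivAt (fun t => f (X t)) ((fderiv ℝ f (X t)).comp (fderiv ℝ X t)) t :=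
      ((h.contDiffAt hU).differentiableAt (by simp)).hasFDerivAt.comp t (hXderiv t ht)
    have h2 : HasFDerivAt (fun t => f (X t)) (0 : T →L[ℝ] ℝ) t := by
      refine (hasFDerivAt_const (0 : ℝ) t).congr_of_eventuallyEq ?_
      filter_upwards [hBo.mem_nhds ht] with s hs using (hball s hs).2.1
    exact congrArg (fun L : T →L[ℝ] ℝ => L u) (h1.unique h2)
  have hQX : ∀ t ∈ B, ∀ u, Q (fderiv ℝ X t u) = u := by
    intro t ht u
    have h1 : HasFDerivAt (fun t => Q (X t - p)) (Q.comp (fderiv ℝ X t)) t :=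
      Q.hasFDerivAt.comp t ((hXderiv t ht).sub_const p)
    have h2 : HasFDerivAt (fun t => Q (X t - p)) (ContinuousLinearMap.id ℝ T) t := by
      refine (hasFDerivAt_id t).congr_of_eventuallyEq ?_
      filter_upwards [hBo.mem_nhds ht] with s hs using (hball s hs).2.2.1
    exact congrArg (fun L : T →L[ℝ] T => L u) (h1.unique h2)
  have hNX : ∀ t ∈ B, ∀ u, fderiv ℝ N (X t) (fderiv ℝ X t u) = lam (X t) • fderiv ℝ X t u := by
    intro t ht u
    obtain ⟨c, hc⟩ := (hball t ht).2.2.2.2 (hXM t ht)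
    have hlc : lam (X t) = c := by
      rw [hlam]; simp only
      rw [meanCurvature_of_weingarten_eq_smul (by omega) hM hν (hXM t ht) hc]
      field_simp
    rw [hlc]
    have h1 := h.coe_weingarten hF (hXM t ht) (hball t ht).2.2.2.1 ⟨_, hXtan t ht u⟩
    rw [← h1, hc]
    rfl
  -- Since `Q ∘ dX` is the identity, projecting the Gauss map to `T` turns umbilicity into a
  -- differential `lam • id` on a space of dimension `n - 1 ≥ 2`.
  have hlconst := stretch_const_of_fderiv_eq_smul_id hTfin (g := fun t => Q (N (X t)))
    (l := fun t => lam (X t)) (r := r)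
    (fun t ht => by
      have h1 : ContDiffAt ℝ 2 (fun t => N (X t)) t :=
        ((hN2 t ht).of_le (m := 2) ENat.LEInfty.out).comp t (hball t ht).1
      exact Q.contDiff.contDiffAt.comp t h1)
    (fun t ht => by
      have h1 : HasFDerivAt (fun t => Q (N (X t)))
          (Q.comp ((fderiv ℝ N (X t)).comp (fderiv ℝ X t))) t :=
        Q.hasFDerivAt.comp t ((hNderiv t ht).comp t (hXderiv t ht))
      rw [h1.fderiv]
      ext1 u
      rw [ContinuousLinearMap.comp_apply, ContinuousLinearMap.comp_apply, hNX t ht, map_smul,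
        hQX t ht]
      rfl)
  -- With `lam` now constant along the chart, `N ∘ X - lam p • X` has zero derivative.
  have hcenter : ∀ t ∈ B, N (X t) - lam p • X t = N p - lam p • p := by
    intro t ht
    have hd : ∀ s ∈ B, HasFDerivAt (fun s => N (X s) - lam p • X s) (0 : T →L[ℝ] 𝔼) s := by
      intro s hs
      have h1 : HasFDerivAt (fun s => N (X s) - lam p • X s)
          ((fderiv ℝ N (X s)).comp (fderiv ℝ X s) - lam p • fderiv ℝ X s) s :=
        ((hNderiv s hs).comp s (hXderiv s hs)).sub ((hXderiv s hs).const_smul (lam p))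
      have h2 : (fderiv ℝ N (X s)).comp (fderiv ℝ X s) - lam p • fderiv ℝ X s = 0 := by
        ext1 u
        have h3 := hlconst s hs
        simp only [hX0] at h3
        show fderiv ℝ N (X s) (fderiv ℝ X s u) - lam p • fderiv ℝ X s u = 0
        rw [hNX s hs, h3, sub_self]
      rwa [h2] at h1
    have := hBo.is_const_of_fderiv_eq_zero (convex_ball 0 r).isPreconnected
      (fun s hs => (hd s hs).differentiableAt.differentiableWithinAt)
      (fun s hs => (hd s hs).fderiv) ht h0B
    simpa [hX0] using this
  have hQt : Tendsto (fun x => Q (x - p)) (𝓝 p) (𝓝 0) := by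
    have : Continuous fun x => Q (x - p) := by fun_prop
    simpa using this.tendsto p
  filter_upwards [hXx, hQt.eventually (hBo.mem_nhds h0B), h.isOpen.mem_nhds hpU] with x h1 h2 h3 hxM
  have hx := h1 (h.eq_zero hxM h3)
  have h4 := hlconst _ h2
  have h5 := hcenter _ h2
  simp only [hX0] at h4
  rw [hx] at h4 h5
  refine ⟨?_, ?_⟩
  · rw [hlam] at h4
    exact (div_left_inj' hn1).1 h4
  · rw [h.anisoNormal_eq hF hxM h3, h.anisoNormal_eq hF hp hpU]
    exact h5

end Umbilic

/-! ### Restriction to relatively open parts of the hypersurface -/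

section OpenSubset

variable {n : ℕ} {F : EuclideanSpace ℝ (Fin n) → ℝ} {M V : Set (EuclideanSpace ℝ (Fin n))}
  {ν : EuclideanSpace ℝ (Fin n) → EuclideanSpace ℝ (Fin n)}

local notation "𝔼" => EuclideanSpace ℝ (Fin n)

/-- `V` is a relatively open subset of `M`. -/
def IsOpenSubset (V M : Set 𝔼) : Prop := V ⊆ M ∧ ∀ x ∈ V, ∃ O, IsOpen O ∧ x ∈ O ∧ M ∩ O ⊆ V

theorem IsOpenSubset.isSmoothHypersurface (h : IsOpenSubset V M) (hM : IsSmoothHypersurface M) :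
    IsSmoothHypersurface V := by
  intro p hp
  obtain ⟨O, hO, hpO, hOV⟩ := h.2 p hp
  obtain ⟨U, f, hU, hpU, hf, hdf, hMU⟩ := hM p (h.1 hp)
  refine ⟨U ∩ O, f, hU.inter hO, ⟨hpU, hpO⟩, hf.mono inter_subset_left,
    fun x hx => hdf x hx.1, ?_⟩
  ext x
  have := Set.ext_iff.1 hMU x
  constructor
  · rintro ⟨h1, h2⟩
    exact ⟨h2, (this.1 ⟨h.1 h1, h2.1⟩).2⟩
  · rintro ⟨h1, h2⟩
    exact ⟨hOV ⟨(this.2 ⟨h1.1, h2⟩).1, h1.2⟩, h1⟩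

theorem IsOpenSubset.isUnitNormal (h : IsOpenSubset V M) (hν : IsUnitNormal M ν) :
    IsUnitNormal V ν where
  continuousOn := hν.continuousOn.mono h.1
  norm_eq_one x hx := hν.norm_eq_one x (h.1 hx)
  inner_eq_zero x hx v hv := hν.inner_eq_zero x (h.1 hx) v
    (Submodule.span_mono (tangentConeAt_mono h.1) hv)

theorem IsOpenSubset.meanCurvature_eq (h : IsOpenSubset V M) (hF : IsMinkowskiNorm F)
    (hM : IsSmoothHypersurface M) (hν : IsUnitNormal M ν) {x : 𝔼} (hx : x ∈ V) :
    meanCurvature F V ν x = meanCurvature F M ν x := by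
  obtain ⟨U, f, hxU, had⟩ := exists_isAdapted hM hν (h.1 hx)
  obtain ⟨O, hO, hxO, hOV⟩ := h.2 x hx
  have had' : IsAdapted V ν (U ∩ O) f :=
    { isOpen := had.isOpen.inter hO
      contDiffOn := had.contDiffOn.mono inter_subset_left
      gradient_ne_zero := fun y hy => had.gradient_ne_zero y hy.1
      inter_eq := by
        ext y
        constructor
        · rintro ⟨h1, h2⟩
          exact ⟨h2, had.eq_zero (h.1 h1) h2.1⟩
        · rintro ⟨h1, h2⟩
          exact ⟨hOV ⟨had.mem_of_eq_zero h1.1 h2, h1.2⟩, h1⟩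
      normal_eq := fun y hy => had.normal_eq y ⟨h.1 hy.1, hy.2.1⟩ }
  rw [had.meanCurvature_eq hF (h.1 hx) hxU, had'.meanCurvature_eq hF hx ⟨hxU, hxO⟩]

theorem IsOpenSubset.willmoreEnergy_eq (h : IsOpenSubset V M) (hF : IsMinkowskiNorm F)
    (hM : IsSmoothHypersurface M) (hν : IsUnitNormal M ν) (hV : MeasurableSet V) :
    willmoreEnergy F V ν V = willmoreEnergy F M ν V :=
  setLIntegral_congr_fun hV fun x hx => by
    simp only [willmoreDensity, h.meanCurvature_eq hF hM hν hx]

end OpenSubset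

/-! ### Global rigidity in the equality case -/

section Rigidity

variable {n : ℕ} {F : EuclideanSpace ℝ (Fin n) → ℝ} {M : Set (EuclideanSpace ℝ (Fin n))}
  {ν : EuclideanSpace ℝ (Fin n) → EuclideanSpace ℝ (Fin n)}

local notation "𝔼" => EuclideanSpace ℝ (Fin n)

/-- The projection of the Wulff shape to a hyperplane contains the open slice of the Wulff ball, so
the shape has positive area, and `F` is bounded below on unit normals. -/
theorem wulffArea_wulffShape_pos (hn : 1 ≤ n) (hF : IsMinkowskiNorm F) :
    0 < wulffArea F (wulffShape F) := by
  have : Nonempty (Fin n) := ⟨⟨0, hn⟩⟩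
  obtain ⟨e, he⟩ := exists_ne (0 : 𝔼)
  set T := (ℝ ∙ e)ᗮ with hT
  have hd : Module.finrank ℝ T = n - 1 := by
    have h2 := Submodule.finrank_add_finrank_orthogonal (ℝ ∙ e)
    rw [finrank_span_singleton he, finrank_euclideanSpace_fin, ← hT] at h2
    omega
  have hc := hF.continuous_dualNorm hn
  have hsub : {t : T | dualNorm F t < 1} ⊆ T.orthogonalProjectionOnto '' wulffShape F := by
    intro t ht
    have ht' : dualNorm F (t : 𝔼) < 1 := ht
    have hee : 0 < ⟪e, e⟫ := real_inner_self_pos.2 he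
    have hFe := hF.pos e he
    -- At this height the pairing with `e` equals `F e`, forcing dual norm at least `1`; the
    -- intermediate value theorem then finds a point of the Wulff shape above `t`.
    set s₁ := F e / ⟪e, e⟫ with hs₁
    have hs₁0 : 0 ≤ s₁ := by positivity
    have hcont : ContinuousOn (fun s : ℝ => dualNorm F ((t : 𝔼) + s • e)) (Icc 0 s₁) :=
      (hc.comp (by fun_prop : Continuous fun s : ℝ => (t : 𝔼) + s • e)).continuousOn
    have h1 : 1 ≤ dualNorm F ((t : 𝔼) + s₁ • e) := by
      have h2 := hF.inner_le_dualNorm_mul e ((t : 𝔼) + s₁ • e)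
      have h3 : ⟪e, (t : 𝔼)⟫ = 0 := Submodule.mem_orthogonal_singleton_iff_inner_right.1 t.2
      rw [inner_add_right, h3, inner_smul_right, zero_add, hs₁, div_mul_cancel₀ _ hee.ne'] at h2
      exact le_of_mul_le_mul_right (by linarith) hFe
    obtain ⟨s, -, hs⟩ := intermediate_value_Icc hs₁0 hcont ⟨by simpa using ht'.le, h1⟩
    refine ⟨(t : 𝔼) + s • e, (hF.mem_wulffShape_iff hn).2
      (hF.exists_gradient_eq_of_dualNorm_eq_one hn hs), ?_⟩
    rw [map_add, map_smul, Submodule.orthogonalProjectionOnto_orthogonalComplement_singleton_eq_zero,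
      smul_zero, add_zero]
    exact Submodule.orthogonalProjectionOnto_mem_subspace_eq_self t
  have hopen : IsOpen {t : T | dualNorm F t < 1} :=
    isOpen_lt (hc.comp continuous_subtype_val) continuous_const
  have h0 : (0 : T) ∈ {t : T | dualNorm F t < 1} := by
    show dualNorm F ((0 : T) : 𝔼) < 1
    have := IsMinkowskiNorm.dualNorm_smul (F := F) le_rfl (0 : 𝔼)
    rw [zero_smul, zero_mul] at this
    rw [Submodule.coe_zero, this]; exact one_pos
  have hpos : 0 < μHE[n - 1] (wulffShape F) :=
    ((hopen.measure_pos volume ⟨0, h0⟩).trans_le (measure_mono hsub)).trans_le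
      (volume_projection_image_le hd _)
  obtain ⟨m, hm, hmF⟩ := hF.exists_mul_norm_le
  calc 0 < ENNReal.ofReal m * μHE[n - 1] (wulffShape F) :=
        ENNReal.mul_pos (ENNReal.ofReal_pos.2 hm).ne' hpos.ne'
    _ = ∫⁻ _ in wulffShape F, ENNReal.ofReal m ∂(μHE[n - 1]) := (setLIntegral_const _ _).symm
    _ ≤ wulffArea F (wulffShape F) := by
        refine setLIntegral_mono' isClosed_frontier.measurableSet fun y hy => ?_
        obtain ⟨u, hu, rfl⟩ := (hF.mem_wulffShape_iff hn).1 hy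
        rw [hF.wulffNormal_gradient hn hu]
        have := hmF u
        rw [hu, mul_one] at this
        exact ENNReal.ofReal_le_ofReal this

theorem neg_mem_wulffShape (hn : 1 ≤ n) (hF : IsMinkowskiNorm F) {y : 𝔼} (hy : y ∈ wulffShape F) :
    -y ∈ wulffShape F := by
  obtain ⟨u, hu, rfl⟩ := (hF.mem_wulffShape_iff hn).1 hy
  have hu0 : u ≠ 0 := by rintro rfl; simp at hu
  exact (hF.mem_wulffShape_iff hn).2 ⟨-u, by rwa [norm_neg], hF.gradient_neg hu0⟩

theorem anisoNormal_mem_wulffShape (hn : 1 ≤ n) (hF : IsMinkowskiNorm F) (hν : IsUnitNormal M ν)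
    {x : 𝔼} (hx : x ∈ M) : anisoNormal F ν x ∈ wulffShape F :=
  (hF.mem_wulffShape_iff hn).2 ⟨ν x, hν.norm_eq_one x hx, rfl⟩

/-- A compact hypersurface whose anisotropic normal is an affine function of the position is a
translated scaled Wulff shape. -/
theorem isTranslatedScaledWulffShape_of_anisoNormal_eq (hn : 2 ≤ n) (hF : IsMinkowskiNorm F)
    (hMc : IsCompact M) (hne : M.Nonempty) (hM : IsSmoothHypersurface M) (hν : IsUnitNormal M ν)
    {lam : ℝ} (hlam : lam ≠ 0) {b : 𝔼} (h : ∀ x ∈ M, anisoNormal F ν x - lam • x = b) :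
    IsTranslatedScaledWulffShape F M := by
  have hn1 : 1 ≤ n := by omega
  have hr : 0 < |lam|⁻¹ := inv_pos.2 (abs_pos.2 hlam)
  obtain ⟨s, hss, hs⟩ : ∃ s : ℝ, (s = 1 ∨ s = -1) ∧ lam⁻¹ = s * |lam|⁻¹ := by
    rcases abs_choice lam with h1 | h1
    · exact ⟨1, Or.inl rfl, by rw [h1, one_mul]⟩
    · exact ⟨-1, Or.inr rfl, by rw [h1, inv_neg]; ring⟩
  set r := |lam|⁻¹ with hrdef
  set x₀ := -(lam⁻¹ • b) with hx₀
  have hx : ∀ x ∈ M, x = x₀ + r • (s • anisoNormal F ν x) := by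
    intro x hx
    rw [smul_smul, mul_comm r s, ← hs, hx₀, ← h x hx, smul_sub, smul_smul, inv_mul_cancel₀ hlam,
      one_smul]
    abel
  have hsub : ∀ x ∈ M, ∃ w : 𝔼, ‖w‖ = 1 ∧ x = x₀ + r • gradient F w := by
    intro x hxM
    have h1 := anisoNormal_mem_wulffShape hn1 hF hν hxM
    have h2 : s • anisoNormal F ν x ∈ wulffShape F := by
      rcases hss with h3 | h3
      · rwa [h3, one_smul]
      · rw [h3, neg_one_smul]; exact neg_mem_wulffShape hn1 hF h1
    obtain ⟨w, hw, hw2⟩ := (hF.mem_wulffShape_iff hn1).1 h2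
    exact ⟨w, hw, by rw [hw2]; exact hx x hxM⟩
  refine ⟨r, x₀, hr, Subset.antisymm ?_ ?_⟩
  · intro x hxM
    obtain ⟨w, hw, hw2⟩ := hsub x hxM
    exact ⟨gradient F w, (hF.mem_wulffShape_iff hn1).2 ⟨w, hw, rfl⟩, hw2.symm⟩
  · rintro _ ⟨y, hy, rfl⟩
    obtain ⟨u, hu, rfl⟩ := (hF.mem_wulffShape_iff hn1).1 hy
    have hu0 : u ≠ 0 := by rintro rfl; simp at hu
    obtain ⟨x, hxM, hmax⟩ := exists_isMaxOn_inner hMc hne u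
    have hcases : x = x₀ + r • gradient F u ∨ x = x₀ + r • gradient F (-u) := by
      have h1 := hx x hxM
      rw [anisoNormal] at h1
      rcases normal_eq_or_eq_neg_of_isMaxOn hM hν hxM hu hmax with h2 | h2 <;>
        rcases hss with h3 | h3 <;> rw [h2, h3] at h1
      · left; rw [h1, one_smul]
      · right; rw [h1, hF.gradient_neg hu0, neg_one_smul]
      · right; rw [h1, one_smul]
      · left; rw [h1, hF.gradient_neg hu0, neg_one_smul, neg_neg]
    rcases hcases with h1 | h1
    · show x₀ + r • gradient F u ∈ M
      rw [← h1]; exact hxM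
    -- In this case the maximum of `⟪u, ·⟫` on `M` equals its minimum on the surrounding Wulff
    -- shape. By strict convexity `M` is the single point `x`, which would be a support point for
    -- both orientations.
    · exfalso
      have hsing : ∀ z ∈ M, z = x := by
        intro z hz
        obtain ⟨w, hw, hw2⟩ := hsub z hz
        have hw0 : w ≠ 0 := by rintro rfl; simp at hw
        have h2 := hmax z hz
        rw [hw2, h1, inner_add_right, inner_add_right, inner_smul_right, inner_smul_right,
          add_le_add_iff_left, mul_le_mul_iff_right₀ hr, hF.gradient_neg hu0, inner_neg_right,
          real_inner_comm (gradient F w) u, real_inner_comm (gradient F u) u, hF.inner_gradient_self hu0] at h2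
        have h3 : ⟪gradient F w, -u⟫ = F (-u) := by
          refine le_antisymm (hF.inner_gradient_le hw0 _) ?_
          rw [hF.even, inner_neg_right]; linarith
        have h4 := hF.eq_of_inner_gradient_eq hw (by rwa [norm_neg]) h3
        rw [hw2, h4, h1]
      have hsup : ∀ z ∈ M, ∀ v : 𝔼, ⟪v, z - x⟫ ≤ 0 := fun z hz v => by
        rw [hsing z hz, sub_self, inner_zero_right]
      exact (disjoint_supportSet hn hMc hM hν).le_bot
        ⟨⟨hxM, fun z hz => hsup z hz _⟩, ⟨hxM, fun z hz => hsup z hz _⟩⟩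

/-- A hypersurface of minimal anisotropic Willmore energy is a translated scaled Wulff shape. -/
theorem isTranslatedScaledWulffShape_of_energy_le (hn : 3 ≤ n) (hF : IsMinkowskiNorm F)
    (hMc : IsCompact M) (hne : M.Nonempty) (hM : IsSmoothHypersurface M) (hν : IsUnitNormal M ν)
    (hE : willmoreEnergy F M ν M ≤ wulffArea F (wulffShape F)) :
    IsTranslatedScaledWulffShape F M := by
  have hn2 : 2 ≤ n := by omega
  have hn1 : (n : ℝ) - 1 ≠ 0 := by
    have : (3 : ℝ) ≤ n := by exact_mod_cast hn
    linarith
  have hWpos := wulffArea_wulffShape_pos (by omega) hF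
  have hMm := hMc.isClosed.measurableSet
  -- If the curvature vanished identically the energy would be zero, below the positive Wulff area.
  obtain ⟨p, hp, hHp⟩ : ∃ p ∈ M, meanCurvature F M ν p ≠ 0 := by
    by_contra! hcon
    have h1 : willmoreEnergy F M ν M = 0 := by
      rw [willmoreEnergy, setLIntegral_congr_fun hMm (g := fun _ => 0) fun x hx => by
        simp only [willmoreDensity_eq_zero hn2 (hcon x hx), ENNReal.ofReal_zero]]
      simp
    have h2 := wulffArea_wulffShape_le hn2 hF hMc hne hM hν
    rw [h1] at h2
    exact hWpos.not_ge h2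
  set lam := meanCurvature F M ν p / ((n : ℝ) - 1) with hlam
  set b := anisoNormal F ν p - lam • p with hb
  -- The points sharing curvature and centre with `p`: closed by continuity, and open in `M` because
  -- the curvature is nonzero on `V`, so `M` is umbilical nearby.
  set V : Set 𝔼 := (M ∩ meanCurvature F M ν ⁻¹' {meanCurvature F M ν p}) ∩
    (M ∩ (fun x => anisoNormal F ν x - lam • x) ⁻¹' {b}) with hV
  have hVcl : IsClosed V :=
    ((continuousOn_meanCurvature hF hM hν).preimage_isClosed_of_isClosed hMc.isClosed
      isClosed_singleton).inter (((continuousOn_anisoNormal hF hν).sub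
        (by fun_prop)).preimage_isClosed_of_isClosed hMc.isClosed isClosed_singleton)
  have hpV : p ∈ V := ⟨⟨hp, rfl⟩, ⟨hp, rfl⟩⟩
  have hVM : V ⊆ M := fun x hx => hx.1.1
  have hVopen : IsOpenSubset V M := by
    refine ⟨hVM, fun x hx => ?_⟩
    have hHx : meanCurvature F M ν x = meanCurvature F M ν p := hx.1.2
    have hbx : anisoNormal F ν x - lam • x = b := hx.2.2
    have hev : ∀ᶠ y in 𝓝 x, y ∈ M → ∃ c : ℝ, weingarten F M ν y = c • LinearMap.id := by
      have := (continuousOn_meanCurvature hF hM hν x (hVM hx)).eventually_ne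
        (b₂ := 0) (by rw [hHx]; exact hHp)
      rw [eventually_nhdsWithin_iff] at this
      filter_upwards [this] with y hy hyM
      exact weingarten_eq_smul_of_energy_le hn2 hF hMc hM hν hE hyM (hy hyM)
    have := eventually_center_eq hn hF hM hν (hVM hx) hev
    obtain ⟨O, hO, hOo, hxO⟩ := mem_nhds_iff.1 this
    refine ⟨O, hOo, hxO, fun y hy => ?_⟩
    obtain ⟨h1, h2⟩ := hO hy.2 hy.1
    rw [hHx] at h1 h2
    exact ⟨⟨hy.1, h1⟩, ⟨hy.1, h2.trans hbx⟩⟩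
  have hVc : IsCompact V := hMc.of_isClosed_subset hVcl hVM
  have hVh := hVopen.isSmoothHypersurface hM
  have hVn := hVopen.isUnitNormal hν
  have hVW : IsTranslatedScaledWulffShape F V :=
    isTranslatedScaledWulffShape_of_anisoNormal_eq hn2 hF hVc ⟨p, hpV⟩ hVh hVn
      (div_ne_zero hHp hn1) fun x hx => hx.2.2
  suffices hVM' : M = V by rwa [hVM']
  refine Subset.antisymm ?_ hVM
  -- Otherwise both `V` and `M \ V` are compact hypersurfaces obeying the Willmore inequality. The
  -- positive energy of `M \ V` then gives energy of `V` < energy of `M` ≤ Wulff area ≤ energy of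
  -- `V`.
  by_contra hcon
  have hne' : (M \ V).Nonempty := by
    obtain ⟨x, hx, hxV⟩ := not_subset.1 hcon
    exact ⟨x, hx, hxV⟩
  have hDopen : IsOpenSubset (M \ V) M :=
    ⟨sdiff_subset, fun x hx => ⟨Vᶜ, hVcl.isOpen_compl, hx.2, fun y hy => ⟨hy.1, hy.2⟩⟩⟩
  have hDc : IsCompact (M \ V) := by
    refine hMc.of_isClosed_subset ?_ sdiff_subset
    choose! O hO hxO hOV using hVopen.2
    have : M \ V = M ∩ (⋃ x ∈ V, O x)ᶜ := by
      ext y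
      simp only [Set.mem_sdiff, mem_inter_iff, mem_compl_iff, mem_iUnion, not_exists]
      constructor
      · rintro ⟨h1, h2⟩
        exact ⟨h1, fun x hx hy => h2 (hOV x hx ⟨h1, hy⟩)⟩
      · rintro ⟨h1, h2⟩
        exact ⟨h1, fun hy => h2 y hy (hxO y hy)⟩
    rw [this]
    exact hMc.isClosed.inter (isOpen_biUnion fun x hx => hO x hx).isClosed_compl
  have h1 := wulffArea_wulffShape_le hn2 hF hVc ⟨p, hpV⟩ hVh hVn
  have h2 := wulffArea_wulffShape_le hn2 hF hDc hne' (hDopen.isSmoothHypersurface hM)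
    (hDopen.isUnitNormal hν)
  rw [hVopen.willmoreEnergy_eq hF hM hν hVcl.measurableSet] at h1
  rw [hDopen.willmoreEnergy_eq hF hM hν hDc.isClosed.measurableSet] at h2
  have h3 := willmoreEnergy_lt_of_forall_pos hDc.isClosed.measurableSet
    (disjoint_sdiff_right : Disjoint V (M \ V)) (union_subset hVM sdiff_subset)
    (willmoreEnergy_lt_top hn2 hF hMc hM hν) (hWpos.trans_le h2)
  exact (hE.trans h1).not_gt h3

end Rigidity

end AnisoWillmore

namespace AnisoWillmore

open Filter Topology
open scoped NNReal ENNReal Pointwise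

/-! ### Change of variables under homotheties -/

section Scaling

variable {E : Type*} [NormedAddCommGroup E] [NormedSpace ℝ E] [MeasurableSpace E] [BorelSpace E]

/-- Translations preserve Hausdorff measure and dilations scale it by `r ^ d`. As the homothety is a
measurable equivalence, neither `A` nor `f` has to be measurable. -/
theorem setLIntegral_image_add_smul (d : ℕ) (x₀ : E) {r : ℝ} (hr : 0 < r) (A : Set E)
    (f : E → ℝ≥0∞) :
    ∫⁻ x in (fun y => x₀ + r • y) '' A, f x ∂(μHE[d]) =
      ENNReal.ofReal r ^ d * ∫⁻ y in A, f (x₀ + r • y) ∂(μHE[d]) := by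
  set e : E ≃ᵐ E := ((Homeomorph.smulOfNeZero r hr.ne').trans
    (Homeomorph.addLeft x₀)).toMeasurableEquiv with he
  have hex : ∀ y, e y = x₀ + r • y := fun y => rfl
  have himg : ∀ s : Set E, e.symm ⁻¹' s = (fun y => x₀ + y) '' (r • s) := by
    intro s
    rw [← MeasurableEquiv.image_eq_preimage_symm, ← image_smul, image_image]
    rfl
  have hmap : (μHE[d] : Measure E).map e.symm = (ENNReal.ofReal r ^ d) • (μHE[d] : Measure E) := by
    ext s hs
    have hiso : Isometry fun y => x₀ + y := (IsometryEquiv.addLeft x₀).isometry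
    rw [MeasurableEquiv.map_apply, himg, hiso.euclideanHausdorffMeasure_image,
      Measure.euclideanHausdorffMeasure_smul₀ d hr.ne', Measure.smul_apply, smul_eq_mul, ENNReal.smul_def,
      smul_eq_mul, ENNReal.coe_pow, ← enorm_eq_nnnorm, Real.enorm_of_nonneg hr.le]
  have h1 : (fun y => x₀ + r • y) '' A = e.symm ⁻¹' A := by
    rw [← MeasurableEquiv.image_eq_preimage_symm]; rfl
  rw [h1, ← lintegral_const_mul' _ _ (by finiteness)]
  have h2 := e.symm.measurableEmbedding.restrict_map (μHE[d]) A
  rw [hmap] at h2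
  have h3 := e.symm.measurableEmbedding.lintegral_map (μ := (μHE[d] : Measure E).restrict (e.symm ⁻¹' A)) (fun y => f (e y))
  rw [← h2] at h3
  simp only [MeasurableEquiv.apply_symm_apply] at h3
  rw [← h3, Measure.restrict_smul, lintegral_smul_measure, lintegral_const_mul' _ _ (by finiteness)]
  rfl

end Scaling

/-! ### Equality for Wulff shapes and passage to real integrals -/

section Converse

variable {n : ℕ} {F : EuclideanSpace ℝ (Fin n) → ℝ} {M : Set (EuclideanSpace ℝ (Fin n))}
  {ν : EuclideanSpace ℝ (Fin n) → EuclideanSpace ℝ (Fin n)} {x₀ : EuclideanSpace ℝ (Fin n)} {r : ℝ}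

local notation "𝔼" => EuclideanSpace ℝ (Fin n)

theorem normal_of_eq_wulffShape (hn : 2 ≤ n) (hF : IsMinkowskiNorm F)
    (hM : IsSmoothHypersurface M) (hν : IsUnitNormal M ν) (hr : 0 < r)
    (hMW : M = (fun y => x₀ + r • y) '' wulffShape F) {u : 𝔼} (hu : ‖u‖ = 1) :
    ν (x₀ + r • gradient F u) = u ∨ ν (x₀ + r • gradient F u) = -u := by
  have hn1 : 1 ≤ n := by omega
  refine normal_eq_or_eq_neg_of_isMaxOn hM hν ?_ hu ?_
  · rw [hMW]
    exact ⟨_, (hF.mem_wulffShape_iff hn1).2 ⟨u, hu, rfl⟩, rfl⟩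
  · rw [hMW]
    rintro _ ⟨y, hy, rfl⟩
    obtain ⟨w, hw, rfl⟩ := (hF.mem_wulffShape_iff hn1).1 hy
    have hu0 : u ≠ 0 := by rintro rfl; simp at hu
    have hw0 : w ≠ 0 := by rintro rfl; simp at hw
    have h := hF.inner_gradient_le hw0 u
    rw [← hF.inner_gradient_self hu0] at h
    simp only [inner_add_right, inner_smul_right]
    rw [real_inner_comm (gradient F w) u, real_inner_comm (gradient F u) u]
    gcongr

/-- On the scaled shape `ν_F(z) = ± r⁻¹ • (z - x₀)`, the sign depending on the orientation. By
continuity it is constant near `x`, so `ν_F` is locally affine along `M`. -/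
theorem weingarten_of_eq_wulffShape (hn : 2 ≤ n) (hF : IsMinkowskiNorm F)
    (hM : IsSmoothHypersurface M) (hν : IsUnitNormal M ν) (hr : 0 < r)
    (hMW : M = (fun y => x₀ + r • y) '' wulffShape F) {x : 𝔼} (hx : x ∈ M) :
    ∃ s : ℝ, |s| = r⁻¹ ∧ weingarten F M ν x = s • LinearMap.id := by
  have hn1 : 1 ≤ n := by omega
  have hcase : ∀ z ∈ M, anisoNormal F ν z = r⁻¹ • (z - x₀) ∨
      anisoNormal F ν z = -(r⁻¹ • (z - x₀)) := by
    intro z hz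
    obtain ⟨y, hy, rfl⟩ := hMW ▸ hz
    obtain ⟨u, hu, rfl⟩ := (hF.mem_wulffShape_iff hn1).1 hy
    have hu0 : u ≠ 0 := by rintro rfl; simp at hu
    simp only [anisoNormal, add_sub_cancel_left, inv_smul_smul₀ hr.ne']
    rcases normal_of_eq_wulffShape hn hF hM hν hr hMW hu with h | h
    · left; rw [h]
    · right; rw [h, hF.gradient_neg hu0]
  have hne : ∀ z ∈ M, anisoNormal F ν z ≠ 0 := by
    intro z hz h
    have h1 := hF.inner_gradient_self (hν.ne_zero hz)
    rw [anisoNormal] at h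
    rw [h, inner_zero_left] at h1
    exact (hF.pos _ (hν.ne_zero hz)).ne h1
  obtain ⟨s, hs, hsx⟩ : ∃ s : ℝ, |s| = r⁻¹ ∧ anisoNormal F ν x = s • (x - x₀) := by
    rcases hcase x hx with h | h
    · exact ⟨r⁻¹, abs_of_pos (inv_pos.2 hr), h⟩
    · exact ⟨-r⁻¹, by rw [abs_neg, abs_of_pos (inv_pos.2 hr)], by rw [h, neg_smul]⟩
  have hev : ∀ᶠ z in 𝓝[M] x, anisoNormal F ν z = s • (z - x₀) := by
    have hcont : ContinuousWithinAt (fun z => ⟪anisoNormal F ν z, s • (z - x₀)⟫) M x :=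
      (continuousOn_anisoNormal hF hν x hx).inner
        (ContinuousAt.continuousWithinAt (by fun_prop))
    have hpos : (0 : ℝ) < ⟪anisoNormal F ν x, s • (x - x₀)⟫ := by
      rw [← hsx]; exact real_inner_self_pos.2 (hne x hx)
    filter_upwards [hcont.eventually_const_lt hpos, self_mem_nhdsWithin] with z hz hzM
    have h1 : anisoNormal F ν z = s • (z - x₀) ∨ anisoNormal F ν z = -(s • (z - x₀)) := by
      rcases abs_eq (inv_pos.2 hr).le |>.1 hs with h | h <;> rw [h]
      · exact hcase z hzM
      · rw [neg_smul, neg_neg]; exact (hcase z hzM).symm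
    refine h1.resolve_right fun h => ?_
    rw [← neg_eq_iff_eq_neg.2 h, inner_neg_right] at hz
    have := real_inner_self_nonneg (x := anisoNormal F ν z)
    linarith
  have hd : HasFDerivWithinAt (anisoNormal F ν) (s • ContinuousLinearMap.id ℝ 𝔼) M x := by
    refine HasFDerivWithinAt.congr_of_eventuallyEq ?_ hev hsx
    exact (((hasFDerivAt_id x).sub_const x₀).const_smul s).hasFDerivWithinAt
  refine ⟨s, hs, ?_⟩
  ext1 v
  have h4 := fderivWithin_eq_on_tangentSpace hd v.2
  show (tangentSpace M x).orthogonalProjectionOnto (fderivWithin ℝ (anisoNormal F ν) M x v) = s • v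
  rw [h4]
  show (tangentSpace M x).orthogonalProjectionOnto (s • (v : 𝔼)) = s • v
  rw [map_smul]
  congr 1
  exact Submodule.orthogonalProjectionOnto_mem_subspace_eq_self v

theorem willmoreEnergy_eq_of_isTranslatedScaledWulffShape (hn : 2 ≤ n) (hF : IsMinkowskiNorm F)
    (hM : IsSmoothHypersurface M) (hν : IsUnitNormal M ν) (h : IsTranslatedScaledWulffShape F M) :
    willmoreEnergy F M ν M = wulffArea F (wulffShape F) := by
  have hn1 : 1 ≤ n := by omega
  obtain ⟨r, x₀, hr, hMW⟩ := h
  have hn' : (n : ℝ) - 1 ≠ 0 := by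
    have : (2 : ℝ) ≤ n := by exact_mod_cast hn
    linarith
  have hden : ∀ y ∈ wulffShape F, willmoreDensity F M ν (x₀ + r • y) =
      r⁻¹ ^ (n - 1) * F (wulffNormal F y) := by
    intro y hy
    have hx : x₀ + r • y ∈ M := by rw [hMW]; exact ⟨y, hy, rfl⟩
    obtain ⟨s, hs, hW⟩ := weingarten_of_eq_wulffShape hn hF hM hν hr hMW hx
    obtain ⟨u, hu, rfl⟩ := (hF.mem_wulffShape_iff hn1).1 hy
    rw [willmoreDensity, meanCurvature_of_weingarten_eq_smul hn hM hν hx hW, abs_mul, hs,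
      abs_of_nonneg (show 0 ≤ (n : ℝ) - 1 by simp; omega), mul_div_cancel_right₀ _ hn',
      hF.wulffNormal_gradient hn1 hu]
    rcases normal_of_eq_wulffShape hn hF hM hν hr hMW hu with h | h <;> rw [h]
    rw [hF.even]
  have hWm : MeasurableSet (wulffShape F) := isClosed_frontier.measurableSet
  rw [willmoreEnergy, wulffArea]
  conv_lhs => rw [hMW]
  -- The area factor `r ^ (n - 1)` cancels the curvature factor `r⁻¹ ^ (n - 1)`, which is the scale
  -- invariance of the energy.
  rw [setLIntegral_image_add_smul _ _ hr, ← hMW, ← lintegral_const_mul' _ _ (by finiteness)]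
  refine setLIntegral_congr_fun hWm fun y hy => ?_
  rw [hden y hy, ← ENNReal.ofReal_pow hr.le, ← ENNReal.ofReal_mul (by positivity), ← mul_assoc,
    ← mul_pow, mul_inv_cancel₀ hr.ne', one_pow, one_mul]

theorem anisoArea_wulffShape (hF : IsMinkowskiNorm F) :
    anisoArea F (wulffShape F) (wulffNormal F) = (wulffArea F (wulffShape F)).toReal :=
  integral_eq_lintegral_of_nonneg_ae (ae_of_all _ fun _ => hF.nonneg _)
    (hF.continuous.measurable.comp (IsMinkowskiNorm.measurable_wulffNormal F)).aestronglyMeasurable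

theorem anisoIntegral_meanCurvature_pow (hn : 2 ≤ n) (hF : IsMinkowskiNorm F)
    (hMc : IsCompact M) (hM : IsSmoothHypersurface M) (hν : IsUnitNormal M ν) :
    anisoIntegral F M ν (fun x => |meanCurvature F M ν x| ^ (n - 1)) =
      ((n : ℝ) - 1) ^ (n - 1) * (willmoreEnergy F M ν M).toReal := by
  have hn' : (n : ℝ) - 1 ≠ 0 := by
    have : (2 : ℝ) ≤ n := by exact_mod_cast hn
    linarith
  rw [willmoreEnergy, ← integral_eq_lintegral_of_nonneg_ae
    (ae_of_all _ fun x => willmoreDensity_nonneg hn hF x)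
    ((continuousOn_willmoreDensity hn hF hM hν).aestronglyMeasurable hMc.isClosed.measurableSet),
    ← integral_const_mul, anisoIntegral]
  congr 1 with x
  rw [willmoreDensity, div_pow]
  field_simp

end Converse

end AnisoWillmore

theorem mainTheorem6 {n : ℕ} (hn : 3 ≤ n)
    (F : EuclideanSpace ℝ (Fin n) → ℝ) (hF : AnisoWillmore.IsMinkowskiNorm F)
    (M : Set (EuclideanSpace ℝ (Fin n))) (hM_ne : M.Nonempty) (hM_compact : IsCompact M)
    (hM : AnisoWillmore.IsSmoothHypersurface M)
    (ν : EuclideanSpace ℝ (Fin n) → EuclideanSpace ℝ (Fin n))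
    (hν : AnisoWillmore.IsUnitNormal M ν) :
    ((n : ℝ) - 1) ^ (n - 1) *
        AnisoWillmore.anisoArea F (AnisoWillmore.wulffShape F) (AnisoWillmore.wulffNormal F) ≤
      AnisoWillmore.anisoIntegral F M ν
        (fun x => |AnisoWillmore.meanCurvature F M ν x| ^ (n - 1)) ∧
    (AnisoWillmore.anisoIntegral F M ν
        (fun x => |AnisoWillmore.meanCurvature F M ν x| ^ (n - 1)) =
      ((n : ℝ) - 1) ^ (n - 1) *
        AnisoWillmore.anisoArea F (AnisoWillmore.wulffShape F) (AnisoWillmore.wulffNormal F) ↔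
      AnisoWillmore.IsTranslatedScaledWulffShape F M) := by
  have hn2 : 2 ≤ n := by omega
  have hle := AnisoWillmore.wulffArea_wulffShape_le hn2 hF hM_compact hM_ne hM hν
  -- Finiteness of the energy, and hence of the Wulff area, lets the comparison of extended values
  -- pass faithfully to real numbers.
  have htop := (AnisoWillmore.willmoreEnergy_lt_top hn2 hF hM_compact hM hν).ne
  have hc : (0 : ℝ) < ((n : ℝ) - 1) ^ (n - 1) := by
    have : (3 : ℝ) ≤ n := by exact_mod_cast hn
    exact pow_pos (by linarith) _
  rw [AnisoWillmore.anisoArea_wulffShape hF,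
    AnisoWillmore.anisoIntegral_meanCurvature_pow hn2 hF hM_compact hM hν,
    mul_le_mul_iff_right₀ hc, mul_right_inj' hc.ne',
    ENNReal.toReal_eq_toReal_iff' htop (hle.trans_lt htop.lt_top).ne]
  exact ⟨ENNReal.toReal_mono htop hle,
    fun h => AnisoWillmore.isTranslatedScaledWulffShape_of_energy_le hn hF hM_compact hM_ne hM hν
      h.le,
    AnisoWillmore.willmoreEnergy_eq_of_isTranslatedScaledWulffShape hn2 hF hM hν⟩
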